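/- Let $n\ge 2$, and let $H_n=\mathbb C^n\times\mathbb R$ be the Heisenberg group with coordinates $(z,t)$, $z=x+iy$, contact form $\Theta=dt+\sum_{j=1}^n(x_j\,dy_j-y_j\,dx_j)$, contact bundle $\xi=\ker\Theta$ with its standard CR structure $J$ ($J(\partial_{x_j}+y_j\partial_t)=\partial_{y_j}-x_j\partial_t$), Levi metric $\sum_j(dx_j^2+dy_j^2)$ on $\xi$, pseudohermitian connection $\nabla$ (for which the left invariant frame $\partial_{x_j}+y_j\partial_t,\ \partial_{y_j}-x_j\partial_t$ is parallel) and $T=\partial_t$. A Heisenberg rigid motion is a composition of a left translation of $H_n$ and a rotation $(z,t)\mapsto(Az,t)$, $A\in U(n)$. Let $\Sigma\subset H_n$ be an embedded hypersurface, of class $C^2$, and of class $C^\infty$ in the region of its regular points, where $p\in\Sigma$ is regular if $T_p\Sigma\ne\xi_p$ and singular otherwise. At the regular points let $\xi'=(\xi\cap T\Sigma)\cap J(\xi\cap T\Sigma)$, let $e_n$ be a smooth unit vector field in $\xi\cap T\Sigma$ perpendicular to $\xi'$ (it is determined up to sign), put $e_{2n}=Je_n$, let $\alpha$ be the function with $\alpha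 e_{2n}+T\in T\Sigma$, and let $J'$ be the operator on $\xi\cap T\Sigma$ with $J'=J$ on $\xi'$ and $J'e_n=0$. The shape operator is $\mathfrak S(v)=-\nabla_v e_{2n}+\alpha J'v$ on $\xi\cap T\Sigma$, and the $p$-mean curvature $H$ is its trace. A regular point is umbilic if $\mathfrak S(\xi')\subset\xi'$ and all the eigenvalues of $\mathfrak S$ on $\xi'$ are the same; $\Sigma$ is umbilic if all its regular points are umbilic. Suppose that $\Sigma$ is connected, non-empty and closed (compact without boundary), that it is umbilic, and that, for a suitable choice of $e_n$, $H=c$ at all regular points, where $c>0$ is a constant. (It is not assumed that $\Sigma$ has a singular point.) Then there is a Heisenberg rigid motion $\Phi$ with $\Sigma=\Phi(S_\lambda)$, $\lambda=\frac{c}{2n}$, where the Pansu sphere $S_\lambda$ is the union of the graphs of $g$ and $-g$, $$g(z)=\frac{1}{2\lambda^2}\Bigl(\lambda|z|\sqrt{1-\lambda^2|z|^2}+\cos^{-1}(\lambda|z|)\Bigr),\qquad |z|\le\frac1\lambda .$$ -/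

import Mathlib

open scoped ContDiff Topology

noncomputable section

namespace Heisenberg

/-- The complex coordinate space `ℂⁿ`, with coordinates `z_j = x_j + i y_j`. -/
abbrev Cn (n : ℕ) : Type := EuclideanSpace ℂ (Fin n)

/-- The Heisenberg group `H_n` as the manifold `ℂⁿ × ℝ`, with points `(z, t)`. The group law is
`leftTranslation` below; the additive structure of `ℂⁿ × ℝ` is used only to identify every tangent
space of `H_n` with `ℂⁿ × ℝ` by means of the coordinates `(x, y, t)`. -/
abbrev Hn (n : ℕ) : Type := Cn n × ℝ

/-- The value at `p = (z, t)` and at the tangent vector `w = (v, τ)` of the contact form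
`Θ = dt + ∑ j, (x_j dy_j - y_j dx_j)`. -/
def contactForm {n : ℕ} (p w : Hn n) : ℝ :=
  w.2 + ∑ j, ((p.1 j).re * (w.1 j).im - (p.1 j).im * (w.1 j).re)

/-- The left invariant horizontal frame at `p`: the real linear map that sends
`v = (a_j + i b_j)_j` to `∑ j, (a_j (∂/∂x_j + y_j ∂/∂t) + b_j (∂/∂y_j - x_j ∂/∂t))`.
It identifies `ℂⁿ` with the contact plane `ξ_p` (see `range_frame`). In this identification
the CR structure `J` is multiplication by `i`, the Levi metric `∑ j, (dx_j² + dy_j²)` is the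
standard real inner product of `ℂⁿ`, and the pseudohermitian connection, for which the left
invariant frame is parallel, is componentwise differentiation. -/
def frame {n : ℕ} (p : Hn n) : Cn n →ₗ[ℝ] Hn n where
  toFun v := (v, ∑ j, ((p.1 j).im * (v j).re - (p.1 j).re * (v j).im))
  map_add' v w := by
    ext1
    · rfl
    · simp only [Prod.snd_add, ← Finset.sum_add_distrib]
      refine Finset.sum_congr rfl fun j _ => ?_
      simp only [PiLp.add_apply, Complex.add_re, Complex.add_im]
      ring
  map_smul' r v := by
    ext1
    · rfl
    · simp only [Prod.smul_snd, RingHom.id_apply, smul_eq_mul, Finset.mul_sum]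
      refine Finset.sum_congr rfl fun j _ => ?_
      simp only [PiLp.smul_apply, Complex.smul_re, Complex.smul_im, smul_eq_mul]
      ring

/-- The contact plane `ξ_p`, the kernel of `Θ` at `p`. -/
def contactPlane {n : ℕ} (p : Hn n) : Submodule ℝ (Hn n) where
  carrier := {w | contactForm p w = 0}
  zero_mem' := by simp [contactForm]
  add_mem' := by
    intro v w hv hw
    have h : contactForm p (v + w) = contactForm p v + contactForm p w := by
      simp only [contactForm, Prod.snd_add, Prod.fst_add, PiLp.add_apply, Complex.add_re,
        Complex.add_im]
      rw [add_add_add_comm, ← Finset.sum_add_distrib]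
      congr 1
      exact Finset.sum_congr rfl fun j _ => by ring
    change contactForm p v = 0 at hv
    change contactForm p w = 0 at hw
    change contactForm p (v + w) = 0
    rw [h, hv, hw, add_zero]
  smul_mem' := by
    intro r w hw
    have h : contactForm p (r • w) = r * contactForm p w := by
      simp only [contactForm, Prod.smul_snd, Prod.smul_fst, PiLp.smul_apply, Complex.smul_re,
        Complex.smul_im, smul_eq_mul, mul_add, Finset.mul_sum]
      congr 1
      exact Finset.sum_congr rfl fun j _ => by ring
    change contactForm p w = 0 at hw
    change contactForm p (r • w) = 0
    rw [h, hw, mul_zero]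

theorem range_frame {n : ℕ} (p : Hn n) : LinearMap.range (frame p) = contactPlane p := by
  ext w
  constructor
  · rintro ⟨v, rfl⟩
    change contactForm p (frame p v) = 0
    simp only [contactForm, frame, LinearMap.coe_mk, AddHom.coe_mk, ← Finset.sum_add_distrib]
    exact Finset.sum_eq_zero fun j _ => by ring
  · intro hw
    change contactForm p w = 0 at hw
    refine ⟨w.1, ?_⟩
    ext1
    · rfl
    · simp only [contactForm] at hw
      simp only [frame, LinearMap.coe_mk, AddHom.coe_mk]
      rw [eq_neg_of_add_eq_zero_left hw, ← Finset.sum_neg_distrib]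
      exact Finset.sum_congr rfl fun j _ => by ring

/-! Hypersurfaces -/

/-- `u` is a defining function of class `C^m` of the set `M` near `p`. -/
def IsLocalDefiningFunction {n : ℕ} (m : WithTop ℕ∞) (M : Set (Hn n)) (p : Hn n)
    (u : Hn n → ℝ) : Prop :=
  ∃ U : Set (Hn n), IsOpen U ∧ p ∈ U ∧ ContDiffOn ℝ m u U ∧ (∀ q ∈ U, fderiv ℝ u q ≠ 0) ∧
    M ∩ U = {q ∈ U | u q = 0}

/-- The tangent space `T_pM`: the kernel of `du_p` for the local defining functions `u` of `M`
at `p`. (At a point of a hypersurface all of them have the same kernel.) -/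
def tangentSpaceAt {n : ℕ} (M : Set (Hn n)) (p : Hn n) : Submodule ℝ (Hn n) :=
  ⨅ (u : Hn n → ℝ) (_ : IsLocalDefiningFunction 1 M p u),
    LinearMap.ker (fderiv ℝ u p : Hn n →ₗ[ℝ] ℝ)

/-- The regular part of `M`: the points at which `T_pM ≠ ξ_p`. The other points of `M` are its
singular points. -/
def regularPart {n : ℕ} (M : Set (Hn n)) : Set (Hn n) :=
  {p ∈ M | tangentSpaceAt M p ≠ contactPlane p}

/-- `M` is an embedded hypersurface (without boundary) of class `C²`, and of class `C^∞` in the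
region of its regular points. -/
structure IsEmbeddedHypersurface {n : ℕ} (M : Set (Hn n)) : Prop where
  exists_C2 : ∀ p ∈ M, ∃ u, IsLocalDefiningFunction 2 M p u
  exists_smooth : ∀ p ∈ regularPart M, ∃ u, IsLocalDefiningFunction ∞ M p u

/-- `ξ ∩ TM` at `p`, in terms of the left invariant frame. -/
def horizontalTangent {n : ℕ} (M : Set (Hn n)) (p : Hn n) : Submodule ℝ (Cn n) :=
  (tangentSpaceAt M p).comap (frame p)

/-- The CR structure `J` in terms of the left invariant frame. -/
def J {n : ℕ} : Cn n →ₗ[ℝ] Cn n where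
  toFun v := Complex.I • v
  map_add' v w := smul_add _ v w
  map_smul' r v := smul_comm _ r v

/-- The Levi metric in terms of the left invariant frame. -/
def levi {n : ℕ} (v w : Cn n) : ℝ :=
  ∑ j, ((v j).re * (w j).re + (v j).im * (w j).im)

/-- `ξ' = (ξ ∩ TM) ∩ J (ξ ∩ TM)` at `p`. -/
def xiPrime {n : ℕ} (M : Set (Hn n)) (p : Hn n) : Submodule ℝ (Cn n) :=
  horizontalTangent M p ⊓ (horizontalTangent M p).map J

/-- `e` is a (smooth) choice on the regular part of `M` of the vector field `e_n`: of unit length,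
in `ξ ∩ TM`, and perpendicular to `ξ'`. At each regular point it is unique up to its sign. -/
structure IsCharacteristicField {n : ℕ} (M : Set (Hn n)) (e : Hn n → Cn n) : Prop where
  smooth : ContDiffOn ℝ ∞ e (regularPart M)
  mem : ∀ p ∈ regularPart M, e p ∈ horizontalTangent M p
  perp : ∀ p ∈ regularPart M, ∀ v ∈ xiPrime M p, levi (e p) v = 0
  unit : ∀ p ∈ regularPart M, levi (e p) (e p) = 1

/-- The horizontal normal `e_{2n} = J e_n`. -/
def horizontalNormal {n : ℕ} (e : Hn n → Cn n) (p : Hn n) : Cn n := J (e p)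

/-- The function `α` on the regular part of `M` with `α e_{2n} + T ∈ TM`, where `T = ∂/∂t`
(at a regular point there is exactly one such number, as `e_{2n} ∉ TM`). -/
def alpha {n : ℕ} (M : Set (Hn n)) (e : Hn n → Cn n) (p : Hn n) : ℝ :=
  Classical.epsilon fun a : ℝ =>
    a • frame p (horizontalNormal e p) + ((0, 1) : Hn n) ∈ tangentSpaceAt M p

/-- The operator `J'` on `ξ ∩ TM`, which is `J` on `ξ'` and sends `e_n` to `0`. -/
def JPrime {n : ℕ} (e : Hn n → Cn n) (p : Hn n) (v : Cn n) : Cn n :=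
  J (v - levi v (e p) • e p)

/-- The covariant derivative `∇_v X` at `p` of a horizontal vector field `X` along `M` in the
direction of a horizontal tangent vector `v`. (A derivative within `M` of a function that is
differentiable along `M` has well-determined values at the vectors that are tangent to `M`.) -/
def covariantDerivative {n : ℕ} (M : Set (Hn n)) (X : Hn n → Cn n) (p : Hn n) (v : Cn n) :
    Cn n :=
  fderivWithin ℝ X M p (frame p v)

/-- The shape operator `v ↦ -∇_v e_{2n} + α J' v` of `M`, for `v` in `ξ ∩ TM`. -/
def shapeOperator {n : ℕ} (M : Set (Hn n)) (e : Hn n → Cn n) (p : Hn n) (v : Cn n) : Cn n :=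
  -covariantDerivative M (horizontalNormal e) p v + alpha M e p • JPrime e p v

/-- `k` is an eigenvalue of the shape operator acting on `ξ'`. -/
def IsXiPrimeEigenvalue {n : ℕ} (M : Set (Hn n)) (e : Hn n → Cn n) (p : Hn n) (k : ℝ) : Prop :=
  ∃ v ∈ xiPrime M p, v ≠ 0 ∧ shapeOperator M e p v = k • v

/-- Umbilic points: the shape operator maps `ξ'` to itself and all its eigenvalues there are the
same. -/
def IsUmbilicPoint {n : ℕ} (M : Set (Hn n)) (e : Hn n → Cn n) (p : Hn n) : Prop :=
  (∀ v ∈ xiPrime M p, shapeOperator M e p v ∈ xiPrime M p) ∧ ∃! k, IsXiPrimeEigenvalue M e p k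

/-- A hypersurface is umbilic if all its regular points are umbilic points. (A change of the sign
of `e` changes the sign of the shape operator and does not affect this.) -/
def IsUmbilic {n : ℕ} (M : Set (Hn n)) (e : Hn n → Cn n) : Prop :=
  ∀ p ∈ regularPart M, IsUmbilicPoint M e p

/-- `h` is the `p`-mean curvature of `M` at the regular point `p`: the trace of the shape operator
on the `(2n-1)`-dimensional space `ξ ∩ TM`, computed in an orthonormal basis for the Levi
metric. -/
def HasPMeanCurvatureAt {n : ℕ} (M : Set (Hn n)) (e : Hn n → Cn n) (p : Hn n) (h : ℝ) : Prop :=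
  ∃ b : Fin (2 * n - 1) → Cn n, (∀ i, b i ∈ horizontalTangent M p) ∧
    (∀ i j, levi (b i) (b j) = if i = j then 1 else 0) ∧
    ∑ i, levi (shapeOperator M e p (b i)) (b i) = h

/-! Heisenberg rigid motions and Pansu spheres -/

/-- The left translation `q ↦ p · q` of the Heisenberg group. -/
def leftTranslation {n : ℕ} (p q : Hn n) : Hn n :=
  (p.1 + q.1, p.2 + q.2 + ∑ j, ((p.1 j).im * (q.1 j).re - (p.1 j).re * (q.1 j).im))

/-- The rotation `(z, t) ↦ (A z, t)` for `A` in the unitary group `U(n)`. -/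
def rotation {n : ℕ} (A : Cn n ≃ₗᵢ[ℂ] Cn n) (q : Hn n) : Hn n := (A q.1, q.2)

/-- The group `PSH(n)` of Heisenberg rigid motions consists of the compositions of a rotation in
`U(n)` with a left translation. -/
def IsRigidMotion {n : ℕ} (Φ : Hn n → Hn n) : Prop :=
  ∃ (p : Hn n) (A : Cn n ≃ₗᵢ[ℂ] Cn n), ∀ q, Φ q = leftTranslation p (rotation A q)

/-- The function of `r = |z|` whose graph is the upper half of the Pansu sphere `S_lam`. -/
def pansuProfile (lam r : ℝ) : ℝ :=
  1 / (2 * lam ^ 2) * (lam * r * Real.sqrt (1 - lam ^ 2 * r ^ 2) + Real.arccos (lam * r))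

/-- The Pansu sphere `S_lam`, the union of the graphs over `|z| ≤ 1 / lam` of the profile and of
its negative. -/
def pansuSphere (n : ℕ) (lam : ℝ) : Set (Hn n) :=
  {q | ‖q.1‖ ≤ 1 / lam ∧ (q.2 = pansuProfile lam ‖q.1‖ ∨ q.2 = -pansuProfile lam ‖q.1‖)}

end Heisenberg

end

/-!
The contact plane at every point is identified with `ℂⁿ` by the left invariant frame, so that `J`
is multiplication by `i` and `∇` is componentwise differentiation. Let `N = e_{2n}` be the
horizontal normal, `k` the eigenvalue of the shape operator on `ξ'`, `l = c - (2n - 2) k` its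
eigenvalue in the characteristic direction `-i N`, and `ζ = -k + i α`. For an umbilic hypersurface
the derivative of `N` is the multiplication by `ζ` on `ξ'`, and it is `l i N` in the direction
`-i N` (`IsUmbilic.isUmbilicNormal`, `IsLocalNormal.fderiv_char`).

The commutators of sections of `ξ'` and of `-i N`, applied to `N`, give the structure equations:
`ζ` is constant along `ξ'`, and its derivative along `-i N` is `i ζ (ζ + l)`
(`IsUmbilicNormal.codazzi`, `IsUmbilicNormal.fderiv_alpha`). Since `n ≥ 2`, the brackets of
sections of `ξ'` leave the contact planes, and a function on the hypersurface whose derivatives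
vanish on `ξ ∩ TM` is locally constant (`IsUmbilicNormal.eventually_eq`). Thus the structure
equations provide conserved quantities: the zero set of `ζ` is open in the hypersurface, and where
`ζ ≠ 0`, the center `a = z - N / ζ` and the energy `(k - c / 2n) / |ζ|²ⁿ` are locally constant.

At the singular points `|ζ|` tends to infinity. If `ζ` vanished somewhere it would vanish
everywhere, and then `T` would be tangent at the maximum of `t`; hence `ζ ≠ 0`. A singular point is
isolated, because near it the hypersurface is a graph over `ℂⁿ` and `|z - a| = 1 / |ζ|` tends to
zero there; so the regular part is not separated by the singular points, and the conserved
quantities are constants (`IsUmbilicData.eq_of_eventually_eq`). There is a singular point, as the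
function `α / |ζ|² - c t`, with `t` measured from the center, has nonzero derivative along `-i N`
and thus no maximum at a regular point (`IsUmbilicData.not_isLocalExtrOn`). The energy tends to
zero at this point, whence `k = c / 2n = λ`. Then `|z - a|² = 1 / (λ² + α²)`, and integrating the
derivative of `t` along `-i N` gives `t` as a function of `α` up to a constant; this is the profile
of the Pansu sphere (`IsUmbilicData.eventually_height_eq`, `pansuProfile_eq`). So the hypersurface
is contained in a translate of the Pansu sphere.

Conversely, the part of the translated Pansu sphere off its axis is connected, and its intersection
with the hypersurface is closed. It is also open: the radial direction `z - a` is transversal to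
the hypersurface, which therefore persists along the nearby horizontal rays from the axis, and it
can meet such a ray only on the sphere (`HasPansuProfile.dilate_mem`). So the two sets coincide.
-/

open scoped InnerProductSpace

noncomputable section

namespace Heisenberg

variable {n : ℕ}

/-! ### Linear algebra of the horizontal frame -/

theorem levi_eq_inner (v w : Cn n) : levi v w = ⟪v, w⟫_ℝ := by
  simp only [levi, PiLp.inner_apply, Complex.inner]
  refine Finset.sum_congr rfl fun j _ => ?_
  simp [mul_comm]

theorem frame_apply (p : Hn n) (v : Cn n) :
    frame p v = (v, ⟪Complex.I • v, p.1⟫_ℝ) := by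
  ext1
  · rfl
  · simp only [frame, LinearMap.coe_mk, AddHom.coe_mk, PiLp.inner_apply, Complex.inner]
    refine Finset.sum_congr rfl fun j _ => ?_
    simp

theorem contactForm_apply (p w : Hn n) :
    contactForm p w = w.2 - ⟪Complex.I • w.1, p.1⟫_ℝ := by
  simp only [contactForm, PiLp.inner_apply, Complex.inner, sub_eq_add_neg, ← Finset.sum_neg_distrib]
  congr 1
  refine Finset.sum_congr rfl fun j _ => ?_
  simp
  ring

theorem J_apply (v : Cn n) : J v = Complex.I • v := rfl

theorem inner_I_I (v w : Cn n) : ⟪Complex.I • v, Complex.I • w⟫_ℝ = ⟪v, w⟫_ℝ := by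
  simp only [PiLp.inner_apply, Complex.inner]
  refine Finset.sum_congr rfl fun j _ => ?_
  simp

theorem inner_I_right (v w : Cn n) : ⟪v, Complex.I • w⟫_ℝ = -⟪Complex.I • v, w⟫_ℝ := by
  simp only [PiLp.inner_apply, Complex.inner, ← Finset.sum_neg_distrib]
  refine Finset.sum_congr rfl fun j _ => ?_
  simp
  ring

theorem inner_I_self (v : Cn n) : ⟪Complex.I • v, v⟫_ℝ = 0 := by
  have h := inner_I_right v v
  rw [real_inner_comm] at h
  linarith

theorem I_smul_I_smul (v : Cn n) : Complex.I • Complex.I • v = -v := by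
  rw [smul_smul, Complex.I_mul_I, neg_one_smul]

theorem contactForm_frame (p : Hn n) (v : Cn n) : contactForm p (frame p v) = 0 := by
  simp [contactForm_apply, frame_apply]

@[simp]
theorem frame_fst (p : Hn n) (v : Cn n) : (frame p v).1 = v := rfl

theorem contactForm_frame_add_smul (p : Hn n) (v : Cn n) (c : ℝ) :
    contactForm p (frame p v + c • ((0, 1) : Hn n)) = c := by
  simp [contactForm_apply, frame_apply]

theorem eq_frame_add_smul (p X : Hn n) :
    X = frame p X.1 + contactForm p X • ((0, 1) : Hn n) := by
  ext1
  · simp [frame_apply]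
  · simp [frame_apply, contactForm_apply]

/-- Multiplication by `i` as a continuous real linear map. -/
def IL : Cn n →L[ℝ] Cn n :=
  (Complex.I • ContinuousLinearMap.id ℂ (Cn n) : Cn n →L[ℂ] Cn n).restrictScalars ℝ

theorem IL_apply (v : Cn n) : IL v = Complex.I • v := rfl

theorem contDiff_frame_apply {m : WithTop ℕ∞} :
    ContDiff ℝ m fun x : Hn n × Cn n => frame x.1 x.2 := by
  simp only [frame_apply, ← IL_apply]
  exact contDiff_snd.prodMk
    ((IL.contDiff.comp contDiff_snd).inner ℝ (contDiff_fst.comp contDiff_fst))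

/-- The left invariant frame is parallel for `∇` only: in the coordinates of `ℂⁿ × ℝ`, the
derivative of a horizontal field has an additional vertical component. -/
theorem fderiv_frame {V : Hn n → Cn n} {p : Hn n} (hV : DifferentiableAt ℝ V p) (X : Hn n) :
    DifferentiableAt ℝ (fun q => frame q (V q)) p ∧
    fderiv ℝ (fun q => frame q (V q)) p X =
      frame p (fderiv ℝ V p X) + ⟪Complex.I • V p, X.1⟫_ℝ • ((0, 1) : Hn n) := by
  simp only [frame_apply, ← IL_apply]
  have h1 : HasFDerivAt (fun q => IL (V q)) (IL.comp (fderiv ℝ V p)) p :=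
    (IL.hasFDerivAt).comp p hV.hasFDerivAt
  have h2 : HasFDerivAt (fun q : Hn n => q.1) (ContinuousLinearMap.fst ℝ (Cn n) ℝ) p :=
    hasFDerivAt_fst
  have h := hV.hasFDerivAt.prodMk (h1.inner ℝ h2)
  refine ⟨h.differentiableAt, ?_⟩
  rw [h.fderiv]
  ext1
  · simp
  · simp [add_comm]

/-- The commutator of the horizontal vector fields with components `W` and `V`. The last term is
due to the bracket of the left invariant frame. -/
theorem fderiv_commutator {F : Type*} [NormedAddCommGroup F] [NormedSpace ℝ F] {f : Hn n → F}
    {V W : Hn n → Cn n} {p : Hn n} (hf : ContDiffAt ℝ 2 f p) (hV : DifferentiableAt ℝ V p)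
    (hW : DifferentiableAt ℝ W p) :
    fderiv ℝ (fun q => fderiv ℝ f q (frame q (V q))) p (frame p (W p)) -
      fderiv ℝ (fun q => fderiv ℝ f q (frame q (W q))) p (frame p (V p)) =
    fderiv ℝ f p (frame p (fderiv ℝ V p (frame p (W p)) - fderiv ℝ W p (frame p (V p)))) +
      (2 * ⟪Complex.I • V p, W p⟫_ℝ) • fderiv ℝ f p (0, 1) := by
  have hd : DifferentiableAt ℝ (fderiv ℝ f) p :=
    (hf.fderiv_right (m := 1) (by norm_num)).differentiableAt (by norm_num)
  have hs := hf.isSymmSndFDerivAt (by simp)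
  rw [fderiv_clm_apply hd (fderiv_frame hV 0).1,
    fderiv_clm_apply hd (fderiv_frame hW 0).1]
  simp only [add_apply, ContinuousLinearMap.comp_apply,
    ContinuousLinearMap.flip_apply, (fderiv_frame hV _).2, (fderiv_frame hW _).2, map_add,
    map_sub, map_smul]
  rw [hs.eq (frame p (W p)) (frame p (V p))]
  have h1 : (frame p (W p)).1 = W p := by simp [frame_apply]
  have h2 : (frame p (V p)).1 = V p := by simp [frame_apply]
  have h3 : ⟪Complex.I • W p, V p⟫_ℝ = -⟪Complex.I • V p, W p⟫_ℝ := by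
    rw [real_inner_comm, inner_I_right]
  rw [h1, h2, h3, two_mul, add_smul, neg_smul]
  abel

/-! ### Straightening a hypersurface -/

/-- A local diffeomorphism that straightens the level sets of `u` near `p`: it is
`q ↦ (q - p) + (u q - du_p (q - p)) ν`, where `du_p ν = 1`. -/
theorem exists_straightening {E : Type*} [NormedAddCommGroup E] [NormedSpace ℝ E] [CompleteSpace E]
    {u : E → ℝ} {p : E} {U : Set E} (hU : U ∈ 𝓝 p) (hu : ContDiffAt ℝ 1 u p)
    (hne : fderiv ℝ u p ≠ 0) (h0 : u p = 0) :
    ∃ Ψ : OpenPartialHomeomorph E E, p ∈ Ψ.source ∧ Ψ.source ⊆ U ∧ Ψ p = 0 ∧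
      (∀ q ∈ Ψ.source, fderiv ℝ u p (Ψ q) = u q) ∧ ContDiffOn ℝ 1 Ψ.symm Ψ.target ∧
      HasFDerivAt Ψ.symm (ContinuousLinearMap.id ℝ E) 0 := by
  obtain ⟨ν, hν⟩ : ∃ ν, fderiv ℝ u p ν = 1 := by
    obtain ⟨w, hw⟩ : ∃ w, fderiv ℝ u p w ≠ 0 := by
      by_contra! h
      exact hne (ContinuousLinearMap.ext h)
    exact ⟨(fderiv ℝ u p w)⁻¹ • w, by simp [hw]⟩
  set du := fderiv ℝ u p with hdu
  let f : E → E := fun q => (q - p) + (u q - du (q - p)) • ν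
  have hf : ContDiffAt ℝ 1 f p := by
    have h1 : ContDiffAt ℝ 1 (fun q : E => q - p) p := contDiffAt_id.sub contDiffAt_const
    exact h1.add ((hu.sub (du.contDiff.contDiffAt.comp p h1)).smul contDiffAt_const)
  have hf' : HasFDerivAt f ((ContinuousLinearEquiv.refl ℝ E : E ≃L[ℝ] E) : E →L[ℝ] E) p := by
    have h1 : HasFDerivAt (fun q : E => q - p) (ContinuousLinearMap.id ℝ E) p :=
      (hasFDerivAt_id p).sub_const p
    have h2 : HasFDerivAt u du p := (hu.differentiableAt (by norm_num)).hasFDerivAt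
    have h3 := h1.add ((h2.sub (du.hasFDerivAt.comp p h1)).smul_const ν)
    refine h3.congr_fderiv ?_
    ext x
    simp
  let Φ := hf.toOpenPartialHomeomorph f hf' one_ne_zero
  have hΦ : ∀ q, Φ q = f q := fun q => rfl
  have hfp : f p = 0 := by simp [f, h0]
  have hps : p ∈ Φ.source := hf.mem_toOpenPartialHomeomorph_source hf' one_ne_zero
  have hsymm : ContDiffAt ℝ 1 Φ.symm (f p) := hf.to_localInverse hf' one_ne_zero
  have hsymm0 : Φ.symm 0 = p := by
    rw [← hfp]; exact Φ.left_inv hps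
  have hsd : HasFDerivAt Φ.symm (ContinuousLinearMap.id ℝ E) 0 := by
    have h0t : (0 : E) ∈ Φ.target := by
      rw [← hfp]; exact Φ.map_source hps
    have := Φ.hasFDerivAt_symm (f' := ContinuousLinearEquiv.refl ℝ E) h0t
      (by rw [hsymm0]; exact hf')
    simpa using this
  obtain ⟨T, hT, hTc⟩ : ∃ T ∈ 𝓝 (0 : E), ContDiffOn ℝ 1 Φ.symm T := by
    rw [hfp] at hsymm
    obtain ⟨T, hT, h⟩ := hsymm.contDiffOn (m := 1) le_rfl (by simp)
    refine ⟨T, ?_, ?_⟩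
    · simpa using hT
    · simpa using h
  have hnhd : interior U ∩ Φ ⁻¹' (interior T) ∩ Φ.source ∈ 𝓝 p := by
    refine Filter.inter_mem (Filter.inter_mem (interior_mem_nhds.2 hU) ?_)
      (Φ.open_source.mem_nhds hps)
    refine (Φ.continuousAt hps).preimage_mem_nhds ?_
    rw [hΦ, hfp]
    exact interior_mem_nhds.2 hT
  set O := interior (interior U ∩ Φ ⁻¹' (interior T) ∩ Φ.source) with hO
  have hOo : IsOpen O := isOpen_interior
  have hOsub : O ⊆ interior U ∩ Φ ⁻¹' (interior T) ∩ Φ.source := interior_subset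
  refine ⟨Φ.restrOpen O hOo, ?_, ?_, ?_, ?_, ?_, ?_⟩
  · exact ⟨hps, mem_interior_iff_mem_nhds.2 hnhd⟩
  · exact fun q hq => interior_subset (hOsub hq.2).1.1
  · exact hfp
  · intro q hq
    change du (f q) = u q
    simp [f, hν]
  · refine (hTc.mono (s := T) (fun x hx => ?_))
    have hx' := (Φ.restrOpen O hOo).map_target hx
    have h1 : Φ ((Φ.restrOpen O hOo).symm x) = x := (Φ.restrOpen O hOo).right_inv hx
    have h2 := (hOsub hx'.2).1.2
    rw [Set.mem_preimage, h1] at h2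
    exact interior_subset h2
  · exact hsd

theorem IsLocalDefiningFunction.of_le {m m' : WithTop ℕ∞} {M : Set (Hn n)} {p : Hn n} {u : Hn n → ℝ}
    (h : IsLocalDefiningFunction m M p u) (hm : m' ≤ m) : IsLocalDefiningFunction m' M p u := by
  obtain ⟨U, hU, hp, hu, hne, hMU⟩ := h
  exact ⟨U, hU, hp, hu.of_le hm, hne, hMU⟩

/-- Every vector in the kernel of the differential of a defining function is the velocity of a
curve in the hypersurface. -/
theorem IsLocalDefiningFunction.exists_curve {M : Set (Hn n)} {p : Hn n} {u : Hn n → ℝ}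
    (h : IsLocalDefiningFunction 1 M p u) (hpM : p ∈ M) {X : Hn n} (hX : fderiv ℝ u p X = 0) :
    ∃ γ : ℝ → Hn n, γ 0 = p ∧ HasDerivAt γ X 0 ∧ ∀ᶠ s in 𝓝 0, γ s ∈ M := by
  obtain ⟨U, hU, hp, hu, hne, hMU⟩ := h
  have h0 : u p = 0 := by
    have : p ∈ M ∩ U := ⟨hpM, hp⟩
    rw [hMU] at this
    exact this.2
  obtain ⟨Ψ, hps, hsU, hΨ0, hΨ, -, hd⟩ := exists_straightening (hU.mem_nhds hp)
    (hu.contDiffAt (hU.mem_nhds hp)) (hne p hp) h0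
  have hline : HasDerivAt (fun s : ℝ => s • X) X 0 := by
    simpa using (hasDerivAt_id (0 : ℝ)).smul_const X
  refine ⟨fun s => Ψ.symm (s • X), ?_, ?_, ?_⟩
  · simp only [zero_smul]
    rw [← hΨ0]; exact Ψ.left_inv hps
  · have := HasFDerivAt.comp_hasDerivAt (x := (0 : ℝ)) (f := fun s : ℝ => s • X) (l := Ψ.symm)
      (l' := ContinuousLinearMap.id ℝ (Hn n)) (f' := X) (by simpa using hd) hline
    exact this
  · have ht : Ψ.target ∈ 𝓝 ((0 : ℝ) • X) := by
      rw [zero_smul, ← hΨ0]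
      exact Ψ.open_target.mem_nhds (Ψ.map_source hps)
    filter_upwards [hline.continuousAt.preimage_mem_nhds ht] with s hs
    have hs' := Ψ.map_target hs
    have h1 := hΨ _ hs'
    rw [Ψ.right_inv hs, map_smul, hX, smul_zero] at h1
    have : Ψ.symm (s • X) ∈ {q ∈ U | u q = 0} := ⟨hsU hs', h1.symm⟩
    rw [← hMU] at this
    exact this.1

/-- The rule of Lagrange multipliers, for an objective that is merely differentiable. -/
theorem IsLocalDefiningFunction.fderiv_eq_zero_of_isLocalExtrOn {M : Set (Hn n)} {p : Hn n}
    {u : Hn n → ℝ}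
    (h : IsLocalDefiningFunction 1 M p u) (hpM : p ∈ M) {f : Hn n → ℝ}
    (hf : DifferentiableAt ℝ f p) (hmax : IsLocalExtrOn f M p) {X : Hn n}
    (hX : fderiv ℝ u p X = 0) : fderiv ℝ f p X = 0 := by
  obtain ⟨γ, h0, hd, hM⟩ := h.exists_curve hpM hX
  have hfd : HasDerivAt (fun s => f (γ s)) (fderiv ℝ f p X) 0 := by
    refine HasFDerivAt.comp_hasDerivAt (0 : ℝ) ?_ hd
    rw [h0]; exact hf.hasFDerivAt
  have ht : Filter.Tendsto γ (𝓝 0) (𝓝[M] p) := by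
    refine tendsto_nhdsWithin_iff.2 ⟨?_, hM⟩
    rw [← h0]; exact hd.continuousAt
  have hext : IsLocalExtr (fun s => f (γ s)) 0 := by
    rcases hmax with hm | hm
    · left
      have := ht.eventually hm
      simpa [IsMinFilter, h0] using this
    · right
      have := ht.eventually hm
      simpa [IsMaxFilter, h0] using this
  exact hext.hasDerivAt_eq_zero hfd

theorem tangentSpaceAt_eq {M : Set (Hn n)} {p : Hn n} {u : Hn n → ℝ}
    (h : IsLocalDefiningFunction 1 M p u) (hpM : p ∈ M) :
    tangentSpaceAt M p = LinearMap.ker (fderiv ℝ u p : Hn n →ₗ[ℝ] ℝ) := by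
  refine le_antisymm (iInf₂_le u h) (le_iInf₂ fun w hw => ?_)
  intro X hX
  obtain ⟨U, hU, hp, hwc, hne, hMU⟩ := hw
  have h0 : ∀ q ∈ M ∩ U, w q = 0 := fun q hq => by
    rw [hMU] at hq; exact hq.2
  refine LinearMap.mem_ker.2 (h.fderiv_eq_zero_of_isLocalExtrOn hpM
    ((hwc.contDiffAt (hU.mem_nhds hp)).differentiableAt (by norm_num)) (Or.inl ?_) hX)
  have : ∀ᶠ q in 𝓝[M] p, q ∈ M ∩ U :=
    Filter.inter_mem self_mem_nhdsWithin (mem_nhdsWithin_of_mem_nhds (hU.mem_nhds hp))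
  filter_upwards [this] with q hq
  rw [h0 q hq, h0 p ⟨hpM, hp⟩]

theorem IsEmbeddedHypersurface.fderiv_eq_zero_of_isLocalExtrOn {M : Set (Hn n)}
    (hM : IsEmbeddedHypersurface M) {p : Hn n} (hp : p ∈ M) {f : Hn n → ℝ}
    (hf : DifferentiableAt ℝ f p) (hmax : IsLocalExtrOn f M p) {X : Hn n}
    (hX : X ∈ tangentSpaceAt M p) : fderiv ℝ f p X = 0 := by
  obtain ⟨u, hu⟩ := hM.exists_C2 p hp
  have hu1 := hu.of_le (m' := 1) (by norm_num)
  rw [tangentSpaceAt_eq hu1 hp] at hX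
  exact hu1.fderiv_eq_zero_of_isLocalExtrOn hp hf hmax hX

theorem IsEmbeddedHypersurface.exists_curve {M : Set (Hn n)}
    (hM : IsEmbeddedHypersurface M) {p : Hn n} (hp : p ∈ M) {X : Hn n}
    (hX : X ∈ tangentSpaceAt M p) :
    ∃ γ : ℝ → Hn n, γ 0 = p ∧ HasDerivAt γ X 0 ∧ ∀ᶠ s in 𝓝 0, γ s ∈ M := by
  obtain ⟨u, hu⟩ := hM.exists_C2 p hp
  have hu1 := hu.of_le (m' := 1) (by norm_num)
  rw [tangentSpaceAt_eq hu1 hp] at hX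
  exact hu1.exists_curve hp hX

/-- Derivatives within `M` of maps that agree on `M` agree on tangent vectors. -/
theorem IsEmbeddedHypersurface.hasFDerivWithinAt_unique {F : Type*} [NormedAddCommGroup F]
    [NormedSpace ℝ F] {M : Set (Hn n)} (hM : IsEmbeddedHypersurface M) {p : Hn n} (hp : p ∈ M)
    {f g : Hn n → F} {f' g' : Hn n →L[ℝ] F} (hf : HasFDerivWithinAt f f' M p)
    (hg : HasFDerivWithinAt g g' M p) (hfg : f =ᶠ[𝓝[M] p] g) {X : Hn n}
    (hX : X ∈ tangentSpaceAt M p) : f' X = g' X := by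
  obtain ⟨γ, h0, hd, hγ⟩ := hM.exists_curve hp hX
  have ht : Filter.Tendsto γ (𝓝 0) (𝓝[M] p) := by
    refine tendsto_nhdsWithin_iff.2 ⟨?_, hγ⟩
    rw [← h0]; exact hd.continuousAt
  have hg2 : HasFDerivWithinAt f g' M p := hg.congr_of_eventuallyEq hfg (hfg.self_of_nhdsWithin hp)
  have key : ∀ L : Hn n →L[ℝ] F, HasFDerivWithinAt f L M p →
      HasDerivAt (fun s => f (γ s)) (L X) 0 := by
    intro L hL
    have hdw : HasDerivWithinAt γ X (γ ⁻¹' M) 0 := hd.hasDerivWithinAt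
    have := HasFDerivWithinAt.comp_hasDerivWithinAt (x := (0 : ℝ)) (f := γ) (t := M)
      (s := γ ⁻¹' M) (l := f) (l' := L) (f' := X) (by rw [h0]; exact hL) hdw (fun _ h => h)
    exact this.hasDerivAt hγ
  exact (key f' hf).unique (key g' hg2)

/-- A map that vanishes on `M` near `p` has vanishing derivative along `M`. -/
theorem IsEmbeddedHypersurface.fderiv_eq_zero {F : Type*} [NormedAddCommGroup F]
    [NormedSpace ℝ F] {M : Set (Hn n)} (hM : IsEmbeddedHypersurface M) {p : Hn n} (hp : p ∈ M)
    {f : Hn n → F} (hf : DifferentiableAt ℝ f p) (hf0 : ∀ᶠ q in 𝓝[M] p, f q = 0) {X : Hn n}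
    (hX : X ∈ tangentSpaceAt M p) : fderiv ℝ f p X = 0 := by
  have := hM.hasFDerivWithinAt_unique hp hf.hasFDerivAt.hasFDerivWithinAt
    (hasFDerivWithinAt_const (0 : F) p M) hf0 hX
  simpa using this

/-- Local parametrizations of a hypersurface by a Euclidean space of dimension at least `2`. -/
theorem IsLocalDefiningFunction.exists_parametrization {M : Set (Hn n)} {p : Hn n} {u : Hn n → ℝ}
    (hn : 1 ≤ n) (h : IsLocalDefiningFunction 1 M p u) (hpM : p ∈ M) {O : Set (Hn n)}
    (hO : O ∈ 𝓝 p) :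
    ∃ (m : ℕ) (φ : EuclideanSpace ℝ (Fin m) → Hn n) (U : Set (Hn n)), 1 < m ∧ ContDiff ℝ 1 φ ∧
      Function.Injective φ ∧ IsOpen U ∧ p ∈ U ∧ U ⊆ O ∧ Set.range φ = M ∩ U := by
  obtain ⟨U, hU, hp, hu, hne, hMU⟩ := h
  have h0 : u p = 0 := by
    have : p ∈ M ∩ U := ⟨hpM, hp⟩
    rw [hMU] at this
    exact this.2
  obtain ⟨Ψ, hps, hsU, hΨ0, hΨ, hΨc, hd⟩ := exists_straightening
    (Filter.inter_mem (hU.mem_nhds hp) hO)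
    (hu.contDiffAt (hU.mem_nhds hp)) (hne p hp) h0
  set K := LinearMap.ker (fderiv ℝ u p : Hn n →ₗ[ℝ] ℝ) with hK
  have hrank : Module.finrank ℝ K + 1 = 2 * n + 1 := by
    rw [hK, Module.Dual.finrank_ker_add_one_of_ne_zero]
    · rw [Module.finrank_prod, Module.finrank_self, finrank_real_of_complex]
      simp
    · intro h
      refine hne p hp (ContinuousLinearMap.ext fun x => ?_)
      exact LinearMap.congr_fun h x
  let G := EuclideanSpace ℝ (Fin (Module.finrank ℝ K))
  let κ : G ≃L[ℝ] K := toEuclidean.symm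
  have h0t : (0 : Hn n) ∈ Ψ.target := by rw [← hΨ0]; exact Ψ.map_source hps
  have hnhd : (fun x : G => ((κ x : K) : Hn n)) ⁻¹' Ψ.target ∈ 𝓝 (0 : G) := by
    refine (Ψ.open_target.preimage ?_).mem_nhds ?_
    · fun_prop
    · simpa using h0t
  obtain ⟨r, hr, hball⟩ := Metric.mem_nhds_iff.1 hnhd
  let β := OpenPartialHomeomorph.univBall (0 : G) r
  have hβt : β.target = Metric.ball 0 r := OpenPartialHomeomorph.univBall_target _ hr
  have hβs : β.source = Set.univ := OpenPartialHomeomorph.univBall_source _ _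
  have hβm : ∀ x, β x ∈ Metric.ball (0 : G) r := fun x => by
    rw [← hβt]; exact β.map_source (by rw [hβs]; trivial)
  obtain ⟨W, hW, hWK⟩ : ∃ W : Set (Hn n), IsOpen W ∧
      ((↑) : K → Hn n) ⁻¹' W = κ.symm ⁻¹' (Metric.ball 0 r) := by
    have : IsOpen (κ.symm ⁻¹' (Metric.ball (0 : G) r)) :=
      Metric.isOpen_ball.preimage κ.symm.continuous
    exact isOpen_induced_iff.1 this
  have hWK' : ∀ y : K, (y : Hn n) ∈ W ↔ κ.symm y ∈ Metric.ball (0 : G) r := fun y => by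
    have := Set.ext_iff.1 hWK y
    exact this
  refine ⟨Module.finrank ℝ K, fun x => Ψ.symm (κ (β x) : K), Ψ.source ∩ Ψ ⁻¹' W, by omega,
    ?_, ?_, Ψ.isOpen_inter_preimage hW, ⟨hps, ?_⟩, fun q hq => (hsU hq.1).2, ?_⟩
  · refine contDiffOn_univ.1 (hΨc.comp (ContDiff.contDiffOn ?_) ?_)
    · exact K.subtypeL.contDiff.comp (κ.contDiff.comp
        (OpenPartialHomeomorph.contDiff_univBall (n := 1)))
    · intro x _
      exact hball (hβm x)
  · intro x y hxy
    have h1 := Ψ.symm.injOn (hball (hβm x)) (hball (hβm y)) hxy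
    have h2 := κ.injective (Subtype.ext h1)
    exact β.injOn (by rw [hβs]; trivial) (by rw [hβs]; trivial) h2
  · rw [Set.mem_preimage, hΨ0]
    refine (hWK' 0).2 ?_
    simpa using hr
  · ext q
    constructor
    · rintro ⟨x, rfl⟩
      have ht : ((κ (β x) : K) : Hn n) ∈ Ψ.target := hball (hβm x)
      have hs := Ψ.map_target ht
      refine ⟨?_, hs, ?_⟩
      · have h1 := hΨ _ hs
        rw [Ψ.right_inv ht] at h1
        have h2 : fderiv ℝ u p ((κ (β x) : K) : Hn n) = 0 := (κ (β x)).2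
        have : Ψ.symm ((κ (β x) : K) : Hn n) ∈ {q ∈ U | u q = 0} :=
          ⟨(hsU hs).1, by rw [← h1, h2]⟩
        rw [← hMU] at this
        exact this.1
      · rw [Set.mem_preimage, Ψ.right_inv ht]
        exact (hWK' _).2 (by simpa using hβm x)
    · rintro ⟨hqM, hqs, hqW⟩
      have hq0 : u q = 0 := by
        have : q ∈ M ∩ U := ⟨hqM, (hsU hqs).1⟩
        rw [hMU] at this
        exact this.2
      have hk : Ψ q ∈ K := LinearMap.mem_ker.2 ((hΨ q hqs).trans hq0)
      have hb := (hWK' ⟨Ψ q, hk⟩).1 hqW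
      refine ⟨β.symm (κ.symm ⟨Ψ q, hk⟩), ?_⟩
      have : β (β.symm (κ.symm ⟨Ψ q, hk⟩)) = κ.symm ⟨Ψ q, hk⟩ :=
        β.right_inv (by rw [hβt]; exact hb)
      simp only [this, ContinuousLinearEquiv.apply_symm_apply]
      exact Ψ.left_inv hqs

/-! ### The horizontal gradient and the regular points -/

/-- The horizontal gradient of `u`, with respect to the Levi metric and in terms of the left
invariant frame. -/
def horizontalGradient (u : Hn n → ℝ) (q : Hn n) : Cn n :=
  ∑ i, fderiv ℝ u q (frame q (stdOrthonormalBasis ℝ (Cn n) i)) • stdOrthonormalBasis ℝ (Cn n) i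

theorem inner_horizontalGradient (u : Hn n → ℝ) (q : Hn n) (v : Cn n) :
    ⟪horizontalGradient u q, v⟫_ℝ = fderiv ℝ u q (frame q v) := by
  conv_rhs => rw [← (stdOrthonormalBasis ℝ (Cn n)).sum_repr' v]
  simp only [horizontalGradient, sum_inner, real_inner_smul_left, map_sum, map_smul, smul_eq_mul]
  exact Finset.sum_congr rfl fun i _ => mul_comm _ _

theorem fderiv_eq_horizontalGradient (u : Hn n → ℝ) (q X : Hn n) :
    fderiv ℝ u q X =
      ⟪horizontalGradient u q, X.1⟫_ℝ + contactForm q X * fderiv ℝ u q (0, 1) := by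
  conv_lhs => rw [eq_frame_add_smul q X]
  rw [map_add, map_smul, inner_horizontalGradient, smul_eq_mul]

theorem contDiffOn_horizontalGradient {u : Hn n → ℝ} {U : Set (Hn n)} (hU : IsOpen U)
    {m m' : WithTop ℕ∞} (hu : ContDiffOn ℝ m u U) (hm : m' + 1 ≤ m) :
    ContDiffOn ℝ m' (horizontalGradient u) U := by
  unfold horizontalGradient
  refine ContDiffOn.sum fun i _ => ContDiffOn.fun_smul ?_ contDiffOn_const
  exact (hu.fderiv_of_isOpen hU hm).clm_apply
    (contDiff_frame_apply.comp (contDiff_id.prodMk contDiff_const)).contDiffOn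

theorem mem_regularPart_iff {M : Set (Hn n)} {p : Hn n} {u : Hn n → ℝ}
    (h : IsLocalDefiningFunction 1 M p u) (hpM : p ∈ M) :
    p ∈ regularPart M ↔ horizontalGradient u p ≠ 0 := by
  have hne : fderiv ℝ u p ≠ 0 := by
    obtain ⟨U, hU, hp, hu, hne, hMU⟩ := h
    exact hne p hp
  have key : tangentSpaceAt M p = contactPlane p ↔ horizontalGradient u p = 0 := by
    rw [tangentSpaceAt_eq h hpM]
    constructor
    · intro hk
      have : frame p (horizontalGradient u p) ∈ contactPlane p := contactForm_frame _ _
      rw [← hk] at this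
      have h2 : fderiv ℝ u p (frame p (horizontalGradient u p)) = 0 := this
      rw [← inner_horizontalGradient] at h2
      exact inner_self_eq_zero.1 h2
    · intro h0
      have hT : fderiv ℝ u p (0, 1) ≠ 0 := fun h1 => hne <| ContinuousLinearMap.ext fun X => by
        rw [fderiv_eq_horizontalGradient, h0, h1]
        simp
      ext X
      have : fderiv ℝ u p X = 0 ↔ contactForm p X = 0 := by
        rw [fderiv_eq_horizontalGradient, h0]
        simp only [inner_zero_left, zero_add, mul_eq_zero, hT, or_false]
      exact this
  constructor
  · exact fun h1 h2 => h1.2 (key.2 h2)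
  · exact fun h1 => ⟨hpM, fun h2 => h1 (key.1 h2)⟩

theorem mem_xiPrime {M : Set (Hn n)} {p : Hn n} {N : Cn n}
    (hN : ∀ v, v ∈ horizontalTangent M p ↔ ⟪N, v⟫_ℝ = 0) (v : Cn n) :
    v ∈ xiPrime M p ↔ ⟪N, v⟫_ℝ = 0 ∧ ⟪Complex.I • N, v⟫_ℝ = 0 := by
  simp only [xiPrime, Submodule.mem_inf, Submodule.mem_map, hN, J_apply]
  refine and_congr_right fun _ => ⟨?_, fun h => ⟨-(Complex.I • v), ?_, ?_⟩⟩
  · rintro ⟨w, hw, rfl⟩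
    rw [inner_I_I, hw]
  · rw [inner_neg_right, inner_I_right, h, neg_neg]
  · rw [smul_neg, I_smul_I_smul, neg_neg]

/-- If `g` spans the orthogonal complement of `ξ ∩ TM`, then the horizontal normal is the
normalization of `g` up to sign. -/
theorem IsCharacteristicField.horizontalNormal_eq {M : Set (Hn n)} {e : Hn n → Cn n}
    (he : IsCharacteristicField M e) {p : Hn n} (hp : p ∈ regularPart M) {g : Cn n} (hg0 : g ≠ 0)
    (hg : ∀ v, v ∈ horizontalTangent M p ↔ ⟪g, v⟫_ℝ = 0) :
    ⟪J (e p), ‖g‖⁻¹ • g⟫_ℝ ^ 2 = 1 ∧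
      J (e p) = ⟪J (e p), ‖g‖⁻¹ • g⟫_ℝ • (‖g‖⁻¹ • g) := by
  set N := ‖g‖⁻¹ • g with hN
  have hgn : ‖g‖ ≠ 0 := norm_ne_zero_iff.2 hg0
  have hNN : ⟪N, N⟫_ℝ = 1 := by
    rw [hN, real_inner_smul_left, real_inner_smul_right, real_inner_self_eq_norm_sq]
    field_simp
  have hN' : ∀ v, v ∈ horizontalTangent M p ↔ ⟪N, v⟫_ℝ = 0 := fun v => by
    rw [hg, hN, real_inner_smul_left]
    simp [hgn]
  have h1 := (hN' _).1 (he.mem p hp)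
  set c := ⟪Complex.I • N, e p⟫_ℝ with hc
  have hv : e p - c • (Complex.I • N) ∈ xiPrime M p := by
    rw [mem_xiPrime hN']
    constructor
    · rw [inner_sub_right, h1, real_inner_smul_right, inner_I_right, inner_I_self]
      simp
    · rw [inner_sub_right, real_inner_smul_right, inner_I_I, hNN, ← hc]
      simp
  have h2 := he.perp p hp _ hv
  have h3 := ((mem_xiPrime hN' _).1 hv).2
  rw [levi_eq_inner] at h2
  have h4 : e p = c • (Complex.I • N) := by
    rw [← sub_eq_zero, ← inner_self_eq_zero (𝕜 := ℝ)]
    conv_lhs => rw [inner_sub_left, real_inner_smul_left, h2, h3]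
    simp
  have h5 : J (e p) = (-c) • N := by
    conv_lhs => rw [h4, map_smul, J_apply, I_smul_I_smul]
    rw [smul_neg, neg_smul]
  have h6 : ⟪J (e p), N⟫_ℝ = -c := by
    rw [h5, real_inner_smul_left, hNN, mul_one]
  refine ⟨?_, by rw [h6]; exact h5⟩
  have h7 := he.unit p hp
  rw [levi_eq_inner, h4, real_inner_smul_left, real_inner_smul_right, inner_I_I, hNN] at h7
  rw [h6]
  linarith [h7]

/-- A local extension `N`, `α` to the open set `U` of `H_n` of the horizontal normal and of the
function `α` of the hypersurface `M`. Its tangent spaces are the kernels of the form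
`⟪N, dz⟫ - α Θ`, and `symm` says that the differential of this form vanishes on them. -/
structure IsLocalNormal (M U : Set (Hn n)) (N : Hn n → Cn n) (α : Hn n → ℝ) : Prop where
  isOpen : IsOpen U
  smooth_normal : ContDiffOn ℝ ∞ N U
  smooth_alpha : ContDiffOn ℝ ∞ α U
  norm : ∀ q ∈ U, ⟪N q, N q⟫_ℝ = 1
  mem_tangent : ∀ q ∈ M ∩ U, ∀ X, X ∈ tangentSpaceAt M q ↔ ⟪N q, X.1⟫_ℝ = α q * contactForm q X
  symm : ∀ q ∈ M ∩ U, ∀ X ∈ tangentSpaceAt M q, ∀ Y ∈ tangentSpaceAt M q,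
    ⟪fderiv ℝ N q X, Y.1⟫_ℝ - fderiv ℝ α q X * contactForm q Y + α q * ⟪Complex.I • Y.1, X.1⟫_ℝ =
    ⟪fderiv ℝ N q Y, X.1⟫_ℝ - fderiv ℝ α q Y * contactForm q X + α q * ⟪Complex.I • X.1, Y.1⟫_ℝ

theorem IsLocalNormal.mono {M U U' : Set (Hn n)} {N : Hn n → Cn n} {α : Hn n → ℝ}
    (h : IsLocalNormal M U N α) (hU' : IsOpen U') (hs : U' ⊆ U) : IsLocalNormal M U' N α where
  isOpen := hU'
  smooth_normal := h.smooth_normal.mono hs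
  smooth_alpha := h.smooth_alpha.mono hs
  norm q hq := h.norm q (hs hq)
  mem_tangent q hq := h.mem_tangent q ⟨hq.1, hs hq.2⟩
  symm q hq := h.symm q ⟨hq.1, hs hq.2⟩

theorem hasFDerivAt_contactForm (p Y : Hn n) :
    HasFDerivAt (fun q => contactForm q Y)
      (-((innerSL ℝ (Complex.I • Y.1)).comp (ContinuousLinearMap.fst ℝ (Cn n) ℝ))) p := by
  simp only [contactForm_apply]
  have h2 : HasFDerivAt (fun q : Hn n => q.1) (ContinuousLinearMap.fst ℝ (Cn n) ℝ) p :=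
    hasFDerivAt_fst
  exact ((innerSL ℝ (Complex.I • Y.1)).hasFDerivAt.comp p h2).const_sub _

/-- A smooth defining function `u` with `du = ρ (⟪N, dz⟫ - α Θ)` provides a local normal. -/
theorem isLocalNormal_of_fderiv_eq {M U : Set (Hn n)} {N : Hn n → Cn n} {α ρ u : Hn n → ℝ}
    (hU : IsOpen U) (hMU : M ∩ U = {q ∈ U | u q = 0}) (hu : ContDiffOn ℝ ∞ u U)
    (hN : ContDiffOn ℝ ∞ N U) (hα : ContDiffOn ℝ ∞ α U) (hρ : ContDiffOn ℝ ∞ ρ U)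
    (hρ0 : ∀ q ∈ U, ρ q ≠ 0) (hne : ∀ q ∈ U, fderiv ℝ u q ≠ 0)
    (hnorm : ∀ q ∈ U, ⟪N q, N q⟫_ℝ = 1)
    (hdu : ∀ q ∈ U, ∀ X, fderiv ℝ u q X = ρ q * (⟪N q, X.1⟫_ℝ - α q * contactForm q X)) :
    IsLocalNormal M U N α := by
  have hmem : ∀ q ∈ M ∩ U, ∀ X,
      X ∈ tangentSpaceAt M q ↔ ⟪N q, X.1⟫_ℝ = α q * contactForm q X := fun q hq X => by
    rw [tangentSpaceAt_eq ⟨U, hU, hq.2, hu.of_le (by simp), hne, hMU⟩ hq.1]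
    have : fderiv ℝ u q X = 0 ↔ ⟪N q, X.1⟫_ℝ = α q * contactForm q X := by
      rw [hdu q hq.2, mul_eq_zero, sub_eq_zero]
      simp [hρ0 q hq.2]
    exact this
  refine ⟨hU, hN, hα, hnorm, hmem, fun q hq X hX Y hY => ?_⟩
  have hUq := hU.mem_nhds hq.2
  have hat : ∀ {F : Type} [NormedAddCommGroup F] [NormedSpace ℝ F] {f : Hn n → F},
      ContDiffOn ℝ ∞ f U → HasFDerivAt f (fderiv ℝ f q) q := fun hf =>
    ((hf.contDiffAt hUq).differentiableAt (by simp)).hasFDerivAt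
  have key : ∀ X Y, X ∈ tangentSpaceAt M q → Y ∈ tangentSpaceAt M q →
      fderiv ℝ (fderiv ℝ u) q X Y = ρ q * (⟪fderiv ℝ N q X, Y.1⟫_ℝ -
        fderiv ℝ α q X * contactForm q Y + α q * ⟪Complex.I • Y.1, X.1⟫_ℝ) := by
    intro X Y hX hY
    have hd : HasFDerivAt (fderiv ℝ u) (fderiv ℝ (fderiv ℝ u) q) q :=
      (((hu.contDiffAt hUq).fderiv_right (m := 1) (by norm_cast)).differentiableAt
        (by norm_num)).hasFDerivAt
    have h1 : HasFDerivAt (fun x => fderiv ℝ u x Y)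
        ((ContinuousLinearMap.apply ℝ ℝ Y).comp (fderiv ℝ (fderiv ℝ u) q)) q :=
      (ContinuousLinearMap.apply ℝ ℝ Y).hasFDerivAt.comp q hd
    have h2 := (hat hρ).mul (((hat hN).inner ℝ (hasFDerivAt_const Y.1 q)).sub
      ((hat hα).mul (hasFDerivAt_contactForm q Y)))
    have h3 := (h1.congr_of_eventuallyEq
      (f₁ := fun x => ρ x * (⟪N x, Y.1⟫_ℝ - α x * contactForm x Y))
      (by filter_upwards [hUq] with x hx using (hdu x hx Y).symm)).unique h2
    have h4 := congrArg (fun L => L X) h3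
    have h5 := (hmem q hq Y).1 hY
    simp only [ContinuousLinearMap.comp_apply, ContinuousLinearMap.apply_apply] at h4
    rw [h4]
    simp [h5]
    left
    ring
  have hs := (hu.contDiffAt hUq).isSymmSndFDerivAt (by simpa using by norm_cast)
  have h1 := key X Y hX hY
  rw [hs.eq X Y, key Y X hY hX] at h1
  exact (mul_left_cancel₀ (hρ0 q hq.2) h1).symm

/-- Near its regular points, a hypersurface with a characteristic field has a local normal that
extends the horizontal normal `J e` and the function `α`. -/
theorem IsCharacteristicField.exists_isLocalNormal {M : Set (Hn n)} {e : Hn n → Cn n}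
    (hM : IsEmbeddedHypersurface M) (he : IsCharacteristicField M e) {p : Hn n}
    (hp : p ∈ regularPart M) :
    ∃ (U : Set (Hn n)) (N : Hn n → Cn n) (α : Hn n → ℝ), p ∈ U ∧ IsLocalNormal M U N α ∧
      ∀ q ∈ M ∩ U, q ∈ regularPart M ∧ N q = J (e q) ∧ α q = alpha M e q := by
  obtain ⟨u, U₀, hU₀, hpU, hu, hne, hMU⟩ := hM.exists_smooth p hp
  have hdef : ∀ q ∈ U₀, IsLocalDefiningFunction 1 M q u := fun q hq =>
    ⟨U₀, hU₀, hq, hu.of_le (by simp), hne, hMU⟩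
  set g := horizontalGradient u with hg
  have hgs : ContDiffOn ℝ ∞ g U₀ := contDiffOn_horizontalGradient hU₀ hu (by simp)
  have hgp : g p ≠ 0 := (mem_regularPart_iff (hdef p hpU) hp.1).1 hp
  -- the open set on which the horizontal gradient does not vanish
  have hU₁ : IsOpen (U₀ ∩ g ⁻¹' {0}ᶜ) := hgs.continuousOn.isOpen_inter_preimage hU₀
    isOpen_compl_singleton
  set U₁ := U₀ ∩ g ⁻¹' {0}ᶜ with hU₁d
  have hreg : ∀ q ∈ M ∩ U₁, q ∈ regularPart M := fun q hq =>
    (mem_regularPart_iff (hdef q hq.2.1) hq.1).2 hq.2.2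
  have hg1 : ContDiffOn ℝ ∞ g U₁ := hgs.mono Set.inter_subset_left
  have hnorm : ContDiffOn ℝ ∞ (fun q => ‖g q‖) U₁ := hg1.norm ℝ fun q hq => hq.2
  have hn0 : ∀ q ∈ U₁, ‖g q‖ ≠ 0 := fun q hq => norm_ne_zero_iff.2 hq.2
  have hht : ∀ q ∈ M ∩ U₁, ∀ v, v ∈ horizontalTangent M q ↔ ⟪g q, v⟫_ℝ = 0 := fun q hq v => by
    rw [horizontalTangent, Submodule.mem_comap, tangentSpaceAt_eq (hdef q hq.2.1) hq.1,
      LinearMap.mem_ker, hg, inner_horizontalGradient]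
    rfl
  -- the sign that relates the normalized gradient to the horizontal normal is locally constant
  set s : Hn n → ℝ := fun q => ⟪J (e q), ‖g q‖⁻¹ • g q⟫_ℝ with hs
  have hs1 : ∀ q ∈ M ∩ U₁, s q ^ 2 = 1 ∧ J (e q) = s q • (‖g q‖⁻¹ • g q) := fun q hq =>
    he.horizontalNormal_eq (hreg q hq) hq.2.2 (hht q hq)
  have hpU₁ : p ∈ M ∩ U₁ := ⟨hp.1, hpU, hgp⟩
  have hscont : ContinuousWithinAt s (M ∩ U₁) p := by
    have h1 : ContinuousWithinAt e (M ∩ U₁) p :=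
      (he.smooth.continuousOn p hp).mono hreg
    have h2 : ContinuousWithinAt (fun q => ‖g q‖⁻¹ • g q) (M ∩ U₁) p :=
      (((hnorm.inv hn0).smul hg1).continuousOn p hpU₁.2).mono Set.inter_subset_right
    have h3 : ContinuousWithinAt (fun q => J (e q)) (M ∩ U₁) p :=
      IL.continuous.continuousAt.comp_continuousWithinAt h1
    exact h3.inner (𝕜 := ℝ) h2
  obtain ⟨U₂, hU₂, hpU₂, hs2⟩ : ∃ U₂, IsOpen U₂ ∧ p ∈ U₂ ∧ ∀ q ∈ U₂ ∩ (M ∩ U₁), s q = s p := by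
    have h1 : ∀ᶠ q in 𝓝[M ∩ U₁] p, dist (s q) (s p) < 1 :=
      hscont (Metric.ball_mem_nhds _ one_pos)
    obtain ⟨U₂, hU₂, hpU₂, h2⟩ := mem_nhdsWithin.1 h1
    refine ⟨U₂, hU₂, hpU₂, fun q hq => ?_⟩
    have h3 : dist (s q) (s p) < 1 := h2 hq
    have h4 := (hs1 q hq.2).1
    have h5 := (hs1 p hpU₁).1
    rw [Real.dist_eq, abs_lt] at h3
    rcases sq_eq_one_iff.1 h4 with h | h <;>
      rcases sq_eq_one_iff.1 h5 with h' | h' <;> rw [h, h'] at h3 ⊢ <;> linarith [h3.1, h3.2]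
  set σ := s p with hσ
  have hσ1 : σ ^ 2 = 1 := (hs1 p hpU₁).1
  have hσ0 : σ ≠ 0 := fun h => by rw [h] at hσ1; norm_num at hσ1
  set ρ : Hn n → ℝ := fun q => σ * ‖g q‖ with hρ
  set N : Hn n → Cn n := fun q => σ • (‖g q‖⁻¹ • g q) with hN
  set α : Hn n → ℝ := fun q => -fderiv ℝ u q (0, 1) / ρ q with hα
  have hρs : ContDiffOn ℝ ∞ ρ U₁ := contDiffOn_const.mul hnorm
  have hρ0 : ∀ q ∈ U₁, ρ q ≠ 0 := fun q hq => mul_ne_zero hσ0 (hn0 q hq)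
  have hNs : ContDiffOn ℝ ∞ N U₁ := contDiffOn_const.fun_smul ((hnorm.inv hn0).fun_smul hg1)
  have hus : ContDiffOn ℝ ∞ (fun q => fderiv ℝ u q (0, 1)) U₁ :=
    ((hu.fderiv_of_isOpen hU₀ (by simp)).mono Set.inter_subset_left).clm_apply contDiffOn_const
  have hαs : ContDiffOn ℝ ∞ α U₁ := hus.neg.div hρs hρ0
  have hN1 : ∀ q ∈ U₁, ⟪N q, N q⟫_ℝ = 1 := fun q hq => by
    have := hn0 q hq
    change ⟪σ • ‖g q‖⁻¹ • g q, σ • ‖g q‖⁻¹ • g q⟫_ℝ = 1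
    rw [smul_smul, real_inner_smul_left, real_inner_smul_right, real_inner_self_eq_norm_sq]
    field_simp
    exact hσ1
  have hdu : ∀ q ∈ U₁, ∀ X,
      fderiv ℝ u q X = ρ q * (⟪N q, X.1⟫_ℝ - α q * contactForm q X) := fun q hq X => by
    have := hn0 q hq
    rw [fderiv_eq_horizontalGradient]
    simp only [hN, hα, hρ, real_inner_smul_left]
    field_simp
    rw [hσ1]
    ring
  have hMU₁ : M ∩ U₁ = {q ∈ U₁ | u q = 0} := by
    ext q
    constructor
    · rintro ⟨h1, h2⟩
      have : q ∈ M ∩ U₀ := ⟨h1, h2.1⟩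
      rw [hMU] at this
      exact ⟨h2, this.2⟩
    · rintro ⟨h1, h2⟩
      have : q ∈ M ∩ U₀ := by
        rw [hMU]; exact ⟨h1.1, h2⟩
      exact ⟨this.1, h1⟩
  have hloc : IsLocalNormal M U₁ N α := isLocalNormal_of_fderiv_eq hU₁ hMU₁
    (hu.mono Set.inter_subset_left) hNs hαs hρs hρ0 (fun q hq => hne q hq.1) hN1 hdu
  refine ⟨U₁ ∩ U₂, N, α, ⟨hpU₁.2, hpU₂⟩, hloc.mono (hU₁.inter hU₂) Set.inter_subset_left,
    fun q hq => ?_⟩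
  have hq1 : q ∈ M ∩ U₁ := ⟨hq.1, hq.2.1⟩
  have hNq : N q = J (e q) := by
    rw [(hs1 q hq1).2, hs2 q ⟨hq.2.2, hq1⟩]
  refine ⟨hreg q hq1, hNq, ?_⟩
  have hiff : ∀ a : ℝ, a • frame q (horizontalNormal e q) + ((0, 1) : Hn n) ∈ tangentSpaceAt M q ↔
      a = α q := fun a => by
    have h1 : a • frame q (horizontalNormal e q) + ((0, 1) : Hn n) =
        frame q (a • N q) + (1 : ℝ) • ((0, 1) : Hn n) := by
      rw [one_smul, map_smul, hNq, horizontalNormal]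
    rw [hloc.mem_tangent q hq1, h1, contactForm_frame_add_smul, mul_one, Prod.fst_add, frame_fst,
      Prod.smul_fst, smul_zero, add_zero, real_inner_smul_right, hN1 q hq1.2, mul_one]
  have := Classical.epsilon_spec (p := fun a : ℝ =>
    a • frame q (horizontalNormal e q) + ((0, 1) : Hn n) ∈ tangentSpaceAt M q)
    ⟨α q, (hiff _).2 rfl⟩
  exact ((hiff _).1 this).symm

/-! ### The shape operator of an umbilic hypersurface of constant `p`-mean curvature -/

/-- The eigenvalue of the shape operator in the direction of the characteristic field `-i N`, in
terms of a local normal `N`. -/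
def charEigenvalue (N : Hn n → Cn n) (q : Hn n) : ℝ :=
  ⟪fderiv ℝ N q (frame q (-(Complex.I • N q))), Complex.I • N q⟫_ℝ

/-- The eigenvalue of the shape operator on `ξ'`, if the trace of the shape operator is `c`. -/
def xiEigenvalue (c : ℝ) (N : Hn n → Cn n) (q : Hn n) : ℝ :=
  (c - charEigenvalue N q) / (2 * n - 2)

/-- Local normals for which the shape operator at the points of `M` is the multiplication by
`xiEigenvalue c N` on `ξ'` and has trace `c`. -/
structure IsUmbilicNormal (c : ℝ) (M U : Set (Hn n)) (N : Hn n → Cn n) (α : Hn n → ℝ) : Prop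
    extends IsLocalNormal M U N α where
  fderiv_xiPrime : ∀ q ∈ M ∩ U, ∀ v, ⟪N q, v⟫_ℝ = 0 → ⟪Complex.I • N q, v⟫_ℝ = 0 →
    fderiv ℝ N q (frame q v) = -xiEigenvalue c N q • v + α q • (Complex.I • v)

theorem IsLocalNormal.frame_mem {M U : Set (Hn n)} {N : Hn n → Cn n} {α : Hn n → ℝ}
    (h : IsLocalNormal M U N α) {q : Hn n} (hq : q ∈ M ∩ U) {v : Cn n} :
    frame q v ∈ tangentSpaceAt M q ↔ ⟪N q, v⟫_ℝ = 0 := by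
  rw [h.mem_tangent q hq, contactForm_frame, mul_zero, frame_fst]

/-- The symmetry of the second fundamental form, up to the term with the Levi form. -/
theorem IsLocalNormal.symm_frame {M U : Set (Hn n)} {N : Hn n → Cn n} {α : Hn n → ℝ}
    (h : IsLocalNormal M U N α) {q : Hn n} (hq : q ∈ M ∩ U) {v w : Cn n} (hv : ⟪N q, v⟫_ℝ = 0)
    (hw : ⟪N q, w⟫_ℝ = 0) :
    ⟪fderiv ℝ N q (frame q v), w⟫_ℝ + α q * ⟪Complex.I • w, v⟫_ℝ =
      ⟪fderiv ℝ N q (frame q w), v⟫_ℝ + α q * ⟪Complex.I • v, w⟫_ℝ := by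
  have := h.symm q hq _ ((h.frame_mem hq).2 hv) _ ((h.frame_mem hq).2 hw)
  simpa [contactForm_frame] using this

theorem IsLocalNormal.differentiableAt {M U : Set (Hn n)} {N : Hn n → Cn n} {α : Hn n → ℝ}
    (h : IsLocalNormal M U N α) {q : Hn n} (hq : q ∈ U) :
    DifferentiableAt ℝ N q :=
  (h.smooth_normal.contDiffAt (h.isOpen.mem_nhds hq)).differentiableAt (by simp)

theorem IsLocalNormal.inner_fderiv_self {M U : Set (Hn n)} {N : Hn n → Cn n} {α : Hn n → ℝ}
    (h : IsLocalNormal M U N α) {q : Hn n} (hq : q ∈ U) (X : Hn n) :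
    ⟪fderiv ℝ N q X, N q⟫_ℝ = 0 := by
  have hd := h.differentiableAt hq
  have h1 : HasFDerivAt (fun x => ⟪N x, N x⟫_ℝ) (0 : Hn n →L[ℝ] ℝ) q :=
    (hasFDerivAt_const (1 : ℝ) q).congr_of_eventuallyEq
      (by filter_upwards [h.isOpen.mem_nhds hq] with x hx using h.norm x hx)
  have h2 := (hd.hasFDerivAt.inner ℝ hd.hasFDerivAt).unique h1
  have h3 := congrArg (fun L => L X) h2
  simp [real_inner_comm] at h3
  rwa [real_inner_comm]

/-- The orthogonal splitting of `N^⊥` into `ξ'` and the line of `-i N`. -/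
theorem inner_sub_eq_zero {N v : Cn n} (hN : ⟪N, N⟫_ℝ = 1) (hv : ⟪N, v⟫_ℝ = 0) :
    ⟪N, v - ⟪Complex.I • N, v⟫_ℝ • (Complex.I • N)⟫_ℝ = 0 ∧
      ⟪Complex.I • N, v - ⟪Complex.I • N, v⟫_ℝ • (Complex.I • N)⟫_ℝ = 0 := by
  constructor
  · rw [inner_sub_right, real_inner_smul_right, inner_I_right, inner_I_self, hv]
    simp
  · rw [inner_sub_right, real_inner_smul_right, inner_I_I, hN]
    simp

/-- If the derivative of `N` maps `ξ'` to itself, then the characteristic direction is an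
eigenvector of the shape operator too. -/
theorem IsLocalNormal.fderiv_char {M U : Set (Hn n)} {N : Hn n → Cn n} {α : Hn n → ℝ}
    (h : IsLocalNormal M U N α) {q : Hn n} (hq : q ∈ M ∩ U)
    (hk : ∀ v, ⟪N q, v⟫_ℝ = 0 → ⟪Complex.I • N q, v⟫_ℝ = 0 →
      ⟪fderiv ℝ N q (frame q v), Complex.I • N q⟫_ℝ = 0) :
    fderiv ℝ N q (frame q (-(Complex.I • N q))) =
      charEigenvalue N q • (Complex.I • N q) := by
  set D := fderiv ℝ N q (frame q (-(Complex.I • N q))) with hD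
  have h1 : ⟪N q, D⟫_ℝ = 0 := by
    rw [real_inner_comm]; exact h.inner_fderiv_self hq.2 _
  obtain ⟨h2, h3⟩ := inner_sub_eq_zero (h.norm q hq.2) h1
  set w := D - ⟪Complex.I • N q, D⟫_ℝ • (Complex.I • N q) with hw
  have hNI : ⟪N q, -(Complex.I • N q)⟫_ℝ = 0 := by
    rw [inner_neg_right, inner_I_right, inner_I_self]; simp
  have h4 := h.symm_frame hq hNI h2
  have h5 := hk w h2 h3
  have h6 : ⟪Complex.I • -(Complex.I • N q), w⟫_ℝ = 0 := by
    rw [smul_neg, I_smul_I_smul, neg_neg, h2]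
  have h7 : ⟪Complex.I • w, -(Complex.I • N q)⟫_ℝ = 0 := by
    rw [inner_neg_right, inner_I_I, real_inner_comm, h2, neg_zero]
  rw [h6, h7, inner_neg_right, h5, ← hD] at h4
  have h8 : ⟪w, w⟫_ℝ = 0 := by
    conv_lhs => rw [hw, ← hw, inner_sub_left, real_inner_smul_left, h3]
    linarith
  have h9 : D = ⟪Complex.I • N q, D⟫_ℝ • (Complex.I • N q) :=
    sub_eq_zero.1 (inner_self_eq_zero.1 h8)
  rw [charEigenvalue, ← hD, real_inner_comm]
  exact h9

/-- The covariant derivative of the horizontal normal in terms of a local normal. -/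
theorem IsLocalNormal.covariantDerivative_eq {M U : Set (Hn n)} {N : Hn n → Cn n} {α : Hn n → ℝ}
    {e : Hn n → Cn n} (hM : IsEmbeddedHypersurface M) (h : IsLocalNormal M U N α)
    (hag : ∀ q ∈ M ∩ U, N q = J (e q)) {q : Hn n} (hq : q ∈ M ∩ U) {v : Cn n}
    (hv : ⟪N q, v⟫_ℝ = 0) :
    covariantDerivative M (horizontalNormal e) q v = fderiv ℝ N q (frame q v) := by
  have hev : horizontalNormal e =ᶠ[𝓝[M] q] N := by
    have : M ∩ U ∈ 𝓝[M] q :=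
      Filter.inter_mem self_mem_nhdsWithin (mem_nhdsWithin_of_mem_nhds (h.isOpen.mem_nhds hq.2))
    filter_upwards [this] with x hx using (hag x hx).symm
  have hd : HasFDerivWithinAt N (fderiv ℝ N q) M q :=
    (h.differentiableAt hq.2).hasFDerivAt.hasFDerivWithinAt
  have hd2 : DifferentiableWithinAt ℝ (horizontalNormal e) M q :=
    (hd.congr_of_eventuallyEq hev (hev.self_of_nhdsWithin hq.1)).differentiableWithinAt
  exact hM.hasFDerivWithinAt_unique hq.1 hd2.hasFDerivWithinAt hd hev ((h.frame_mem hq).2 hv)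

/-- The shape operator in terms of a local normal. -/
theorem IsLocalNormal.shapeOperator_eq {M U : Set (Hn n)} {N : Hn n → Cn n} {α : Hn n → ℝ}
    {e : Hn n → Cn n} (hM : IsEmbeddedHypersurface M) (h : IsLocalNormal M U N α)
    (hag : ∀ q ∈ M ∩ U, N q = J (e q) ∧ α q = alpha M e q) {q : Hn n} (hq : q ∈ M ∩ U) {v : Cn n}
    (hv : ⟪N q, v⟫_ℝ = 0) :
    shapeOperator M e q v = -fderiv ℝ N q (frame q v) +
      α q • (Complex.I • (v - ⟪Complex.I • N q, v⟫_ℝ • (Complex.I • N q))) := by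
  have he : e q = -(Complex.I • N q) := by
    rw [(hag q hq).1, J_apply, I_smul_I_smul, neg_neg]
  rw [shapeOperator, h.covariantDerivative_eq hM (fun x hx => (hag x hx).1) hq hv, ← (hag q hq).2,
    JPrime, J_apply, he, levi_eq_inner, inner_neg_right, smul_neg, neg_smul, neg_neg,
    real_inner_comm]

/-- A symmetric operator on a finite-dimensional space with a single eigenvalue is scalar. -/
theorem _root_.LinearMap.IsSymmetric.eq_smul_of_unique_eigenvalue {E : Type*}
    [NormedAddCommGroup E] [InnerProductSpace ℝ E] [FiniteDimensional ℝ E] {T : E →ₗ[ℝ] E}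
    (hT : T.IsSymmetric) {k : ℝ} (hk : ∀ μ, ∀ v ≠ 0, T v = μ • v → μ = k) (v : E) :
    T v = k • v := by
  have h1 := hT.orthogonalComplement_iSup_eigenspaces_eq_bot
  have h2 : (⨆ μ, Module.End.eigenspace T μ) ≤ Module.End.eigenspace T k := by
    refine iSup_le fun μ w hw => ?_
    by_cases hw0 : w = 0
    · rw [hw0]; exact zero_mem _
    · rw [← hk μ w hw0 (Module.End.mem_eigenspace_iff.1 hw)]
      exact hw
  rw [Submodule.orthogonal_eq_bot_iff] at h1
  rw [h1] at h2
  exact Module.End.mem_eigenspace_iff.1 (h2 Submodule.mem_top)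

/-- A unit vector orthogonal to the unit vector `N` has unit length in every orthonormal family of
maximal size that is orthogonal to `N`. -/
theorem sum_inner_sq_eq_one (hn : 1 ≤ n) {N e : Cn n} (hN : ⟪N, N⟫_ℝ = 1) (he : ⟪e, e⟫_ℝ = 1)
    (hNe : ⟪N, e⟫_ℝ = 0) {b : Fin (2 * n - 1) → Cn n} (hb : ∀ i, ⟪N, b i⟫_ℝ = 0)
    (hbo : ∀ i j, ⟪b i, b j⟫_ℝ = if i = j then 1 else 0) :
    ∑ i, ⟪b i, e⟫_ℝ ^ 2 = 1 := by
  let b' : Option (Fin (2 * n - 1)) → Cn n := fun o => o.elim N b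
  have ho : Orthonormal ℝ b' := by
    rw [orthonormal_iff_ite]
    rintro (_ | i) (_ | j)
    · simpa [b'] using hN
    · simpa [b'] using hb j
    · simpa [b', real_inner_comm] using hb i
    · simpa [b'] using hbo i j
  have hcard : Fintype.card (Option (Fin (2 * n - 1))) = Module.finrank ℝ (Cn n) := by
    rw [finrank_real_of_complex]
    simp
    omega
  have hspan := ho.linearIndependent.span_eq_top_of_card_eq_finrank' hcard
  let B := OrthonormalBasis.mk ho hspan.ge
  have h1 := B.sum_sq_norm_inner_right e
  have h2 : ‖e‖ ^ 2 = 1 := by rw [← real_inner_self_eq_norm_sq, he]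
  rw [h2, Fintype.sum_option] at h1
  simpa [B, b', hNe] using h1

/-- On `ξ'` the shape operator is symmetric, since the term `α J'` compensates the antisymmetric
part of `∇ N`. So a single eigenvalue makes it scalar there, and the trace determines this scalar.
-/
theorem IsUmbilic.isUmbilicNormal {M U : Set (Hn n)} {N : Hn n → Cn n} {α : Hn n → ℝ}
    {e : Hn n → Cn n} {c : ℝ} (hn : 2 ≤ n) (hM : IsEmbeddedHypersurface M) (humb : IsUmbilic M e)
    (hH : ∀ p ∈ regularPart M, HasPMeanCurvatureAt M e p c) (h : IsLocalNormal M U N α)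
    (hag : ∀ q ∈ M ∩ U, q ∈ regularPart M ∧ N q = J (e q) ∧ α q = alpha M e q) :
    IsUmbilicNormal c M U N α := by
  refine ⟨h, fun q hq => ?_⟩
  have hht : ∀ v, v ∈ horizontalTangent M q ↔ ⟪N q, v⟫_ℝ = 0 := fun v => h.frame_mem hq
  have hNN := h.norm q hq.2
  have hxi := mem_xiPrime hht
  have hS : ∀ v, ⟪N q, v⟫_ℝ = 0 → shapeOperator M e q v = _ := fun v hv =>
    h.shapeOperator_eq hM (fun q hq => (hag q hq).2) hq hv
  let A : Cn n →ₗ[ℝ] Cn n :=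
    -((fderiv ℝ N q : Hn n →ₗ[ℝ] Cn n) ∘ₗ frame q) + α q • J
  have hA : ∀ v, A v = -fderiv ℝ N q (frame q v) + α q • (Complex.I • v) := fun v => rfl
  have hSA : ∀ v ∈ xiPrime M q, shapeOperator M e q v = A v := fun v hv => by
    rw [hS v ((hxi v).1 hv).1, ((hxi v).1 hv).2, hA, zero_smul, sub_zero]
  obtain ⟨hinv, k, hk, huniq⟩ := humb q (hag q hq).1
  have hAinv : ∀ v ∈ xiPrime M q, A v ∈ xiPrime M q := fun v hv => by
    rw [← hSA v hv]; exact hinv v hv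
  have hsymm : LinearMap.IsSymmetric (𝕜 := ℝ) (E := xiPrime M q) (A.restrict hAinv) := by
    rintro ⟨v, hv⟩ ⟨w, hw⟩
    have h1 := h.symm_frame hq ((hxi v).1 hv).1 ((hxi w).1 hw).1
    change ⟪A v, w⟫_ℝ = ⟪v, A w⟫_ℝ
    rw [hA, hA, inner_add_left, inner_add_right, inner_neg_left, inner_neg_right,
      real_inner_smul_left, real_inner_smul_right]
    have h2 : ⟪v, Complex.I • w⟫_ℝ = ⟪Complex.I • w, v⟫_ℝ := real_inner_comm _ _
    have h3 : ⟪v, fderiv ℝ N q (frame q w)⟫_ℝ = ⟪fderiv ℝ N q (frame q w), v⟫_ℝ :=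
      real_inner_comm _ _
    rw [h2, h3]
    linarith
  have hAk : ∀ v ∈ xiPrime M q, A v = k • v := fun v hv => by
    have := hsymm.eq_smul_of_unique_eigenvalue (k := k) (fun μ w hw0 hw => ?_) ⟨v, hv⟩
    · exact congrArg Subtype.val this
    · refine huniq μ ⟨w, w.2, fun h0 => hw0 (Subtype.ext h0), ?_⟩
      rw [hSA _ w.2]
      exact congrArg Subtype.val hw
  have hder : ∀ v, ⟪N q, v⟫_ℝ = 0 → ⟪Complex.I • N q, v⟫_ℝ = 0 →
      fderiv ℝ N q (frame q v) = -k • v + α q • (Complex.I • v) := fun v h1 h2 => by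
    have h3 := hAk v ((hxi v).2 ⟨h1, h2⟩)
    rw [hA] at h3
    rw [neg_smul, ← h3]
    abel
  have hNI : ⟪N q, Complex.I • N q⟫_ℝ = 0 := by
    rw [inner_I_right, inner_I_self, neg_zero]
  have hchar := h.fderiv_char hq fun v h1 h2 => by
    rw [hder v h1 h2, inner_add_left, real_inner_smul_left, real_inner_smul_left, inner_I_I,
      real_inner_comm, h2, real_inner_comm, h1]
    simp
  set l := charEigenvalue N q with hl
  have hchar' : fderiv ℝ N q (frame q (Complex.I • N q)) = -l • (Complex.I • N q) := by
    rw [map_neg, map_neg] at hchar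
    rw [neg_smul, ← hchar, neg_neg]
  -- the trace of the shape operator
  have htr : l + (2 * n - 2) * k = c := by
    obtain ⟨b, hb, hbo, hsum⟩ := hH q (hag q hq).1
    simp only [levi_eq_inner, hht] at hb hbo hsum
    have hpars := sum_inner_sq_eq_one (by omega) hNN (by rw [inner_I_I]; exact hNN) hNI hb hbo
    have hterm : ∀ i, ⟪shapeOperator M e q (b i), b i⟫_ℝ =
        k + (l - k) * ⟪b i, Complex.I • N q⟫_ℝ ^ 2 := fun i => by
      obtain ⟨h1, h2⟩ := inner_sub_eq_zero hNN (hb i)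
      rw [hS _ (hb i)]
      set t := ⟪Complex.I • N q, b i⟫_ℝ with ht
      set w := b i - t • (Complex.I • N q) with hw
      have hbi : b i = w + t • (Complex.I • N q) := by rw [hw]; abel
      have h3 : ⟪w, b i⟫_ℝ = 1 - t ^ 2 := by
        rw [hw, inner_sub_left, hbo, real_inner_smul_left, ← ht]
        simp; ring
      have h4 : fderiv ℝ N q (frame q (b i)) =
          -k • w + α q • (Complex.I • w) + t • (-l • (Complex.I • N q)) := by
        conv_lhs => rw [hbi]
        rw [map_add, map_add, hder w h1 h2, map_smul, map_smul, hchar']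
      rw [h4]
      have h5 : -(-k • w + α q • (Complex.I • w) + t • (-l • (Complex.I • N q))) +
          α q • (Complex.I • w) = k • w + (t * l) • (Complex.I • N q) := by
        module
      rw [h5, inner_add_left, real_inner_smul_left, real_inner_smul_left, h3, ← ht,
        real_inner_comm, ← ht]
      ring
    simp only [hterm, Finset.sum_add_distrib, ← Finset.mul_sum, hpars] at hsum
    simp at hsum
    rw [Nat.cast_sub (by omega)] at hsum
    push_cast at hsum
    linarith
  have hkx : xiEigenvalue c N q = k := by
    have : (2 : ℝ) ≤ n := by exact_mod_cast hn
    rw [xiEigenvalue, ← hl, div_eq_iff (by linarith)]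
    linarith
  rw [hkx]
  exact hder

/-! ### Structure equations -/

section structureEquations

variable {M U : Set (Hn n)} {N : Hn n → Cn n} {α : Hn n → ℝ} {c : ℝ}

theorem IsLocalNormal.eventually_mem (h : IsLocalNormal M U N α) {q : Hn n} (hq : q ∈ U) :
    ∀ᶠ x in 𝓝[M] q, x ∈ M ∩ U :=
  Filter.inter_mem self_mem_nhdsWithin (mem_nhdsWithin_of_mem_nhds (h.isOpen.mem_nhds hq))

/-- Maps that agree on `M` have the same derivative in tangent directions. -/
theorem IsLocalNormal.fderiv_congr {F : Type*} [NormedAddCommGroup F] [NormedSpace ℝ F]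
    (h : IsLocalNormal M U N α) (hM : IsEmbeddedHypersurface M) {q : Hn n} (hq : q ∈ M ∩ U)
    {f g : Hn n → F} {f' g' : Hn n →L[ℝ] F} (hf : HasFDerivAt f f' q) (hg : HasFDerivAt g g' q)
    (hfg : ∀ x ∈ M ∩ U, f x = g x) {v : Cn n} (hv : ⟪N q, v⟫_ℝ = 0) :
    f' (frame q v) = g' (frame q v) :=
  hM.hasFDerivWithinAt_unique hq.1 hf.hasFDerivWithinAt hg.hasFDerivWithinAt
    ((h.eventually_mem hq.2).mono hfg) ((h.frame_mem hq).2 hv)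

theorem IsLocalNormal.contDiffOn_charEigenvalue (h : IsLocalNormal M U N α) :
    ContDiffOn ℝ ∞ (charEigenvalue N) U := by
  have hIN : ContDiffOn ℝ ∞ (fun q => Complex.I • N q) U :=
    (IL (n := n)).contDiff.comp_contDiffOn h.smooth_normal
  refine ContDiffOn.inner ℝ ?_ hIN
  exact (h.smooth_normal.fderiv_of_isOpen h.isOpen (by simp)).clm_apply
    (contDiff_frame_apply.comp_contDiffOn (contDiffOn_id.prodMk hIN.neg))

theorem IsLocalNormal.contDiffOn_xiEigenvalue (h : IsLocalNormal M U N α) (c : ℝ) :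
    ContDiffOn ℝ ∞ (xiEigenvalue c N) U :=
  (contDiffOn_const.sub h.contDiffOn_charEigenvalue).div_const _

/-- The component of the constant vector `v` that is Hermitian orthogonal to `N`: a section of `ξ'`
through `v`. -/
def xiSection (N : Hn n → Cn n) (v : Cn n) (q : Hn n) : Cn n :=
  v - ⟪N q, v⟫_ℝ • N q - ⟪Complex.I • N q, v⟫_ℝ • (Complex.I • N q)

theorem xiSection_apply {q : Hn n} {v : Cn n} (h1 : ⟪N q, v⟫_ℝ = 0)
    (h2 : ⟪Complex.I • N q, v⟫_ℝ = 0) : xiSection N v q = v := by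
  simp [xiSection, h1, h2]

theorem inner_I_smul_self_right (v : Cn n) : ⟪v, Complex.I • v⟫_ℝ = 0 := by
  rw [inner_I_right, inner_I_self, neg_zero]

theorem inner_xiSection {q : Hn n} (hN : ⟪N q, N q⟫_ℝ = 1) (v : Cn n) :
    ⟪N q, xiSection N v q⟫_ℝ = 0 ∧ ⟪Complex.I • N q, xiSection N v q⟫_ℝ = 0 := by
  constructor
  · rw [xiSection, inner_sub_right, inner_sub_right, real_inner_smul_right, real_inner_smul_right,
      hN, inner_I_smul_self_right]
    ring
  · rw [xiSection, inner_sub_right, inner_sub_right, real_inner_smul_right, real_inner_smul_right,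
      inner_I_I, hN, inner_I_self]
    ring

theorem hasFDerivAt_I_smul {f : Hn n → Cn n} {q : Hn n} {f' : Hn n →L[ℝ] Cn n}
    (hf : HasFDerivAt f f' q) : HasFDerivAt (fun x => Complex.I • f x) (IL.comp f') q :=
  IL.hasFDerivAt.comp q hf

theorem differentiableAt_xiSection {q : Hn n} (hN : DifferentiableAt ℝ N q) (v : Cn n) :
    DifferentiableAt ℝ (xiSection N v) q := by
  have hIN := (hasFDerivAt_I_smul hN.hasFDerivAt).differentiableAt
  have hv : DifferentiableAt ℝ (fun _ : Hn n => v) q := differentiableAt_const v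
  exact ((hv.sub ((hN.inner ℝ hv).smul hN))).sub ((hIN.inner ℝ hv).smul hIN)

theorem fderiv_xiSection {q : Hn n} (hN : DifferentiableAt ℝ N q) {v : Cn n}
    (h1 : ⟪N q, v⟫_ℝ = 0) (h2 : ⟪Complex.I • N q, v⟫_ℝ = 0) (X : Hn n) :
    fderiv ℝ (xiSection N v) q X = -(⟪fderiv ℝ N q X, v⟫_ℝ • N q) -
      ⟪Complex.I • fderiv ℝ N q X, v⟫_ℝ • (Complex.I • N q) := by
  have hd := hN.hasFDerivAt
  have hId := hasFDerivAt_I_smul hd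
  have hv : HasFDerivAt (fun _ : Hn n => v) (0 : Hn n →L[ℝ] Cn n) q := hasFDerivAt_const v q
  have h3 : fderiv ℝ (xiSection N v) q = _ :=
    ((hv.sub ((hd.inner ℝ hv).smul hd)).sub ((hId.inner ℝ hv).smul hId)).fderiv
  rw [h3]
  simp [h1, h2, IL_apply]

/-- For `n ≥ 2`, the space `ξ'` is nonzero. -/
theorem exists_ne_zero_xiPrime (hn : 2 ≤ n) (N : Cn n) :
    ∃ v : Cn n, v ≠ 0 ∧ ⟪N, v⟫_ℝ = 0 ∧ ⟪Complex.I • N, v⟫_ℝ = 0 := by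
  let A : Cn n →ₗ[ℝ] ℝ × ℝ :=
    ((innerSL ℝ N : Cn n →ₗ[ℝ] ℝ)).prod (innerSL ℝ (Complex.I • N) : Cn n →ₗ[ℝ] ℝ)
  have hA : LinearMap.ker A ≠ ⊥ := by
    apply LinearMap.ker_ne_bot_of_finrank_lt
    rw [finrank_real_of_complex, Module.finrank_prod, Module.finrank_self]
    simp
    omega
  obtain ⟨v, hv, hv0⟩ := Submodule.exists_mem_ne_zero_of_ne_bot hA
  have hv' : (⟪N, v⟫_ℝ, ⟪Complex.I • N, v⟫_ℝ) = ((0, 0) : ℝ × ℝ) := hv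
  exact ⟨v, hv0, congrArg Prod.fst hv', congrArg Prod.snd hv'⟩

theorem IsUmbilicNormal.fderiv_char (h : IsUmbilicNormal c M U N α) {q : Hn n}
    (hq : q ∈ M ∩ U) :
    fderiv ℝ N q (frame q (-(Complex.I • N q))) = charEigenvalue N q • (Complex.I • N q) :=
  h.toIsLocalNormal.fderiv_char hq fun v h1 h2 => by
    rw [h.fderiv_xiPrime q hq v h1 h2, inner_add_left, real_inner_smul_left, real_inner_smul_left,
      inner_I_I, real_inner_comm, h2, real_inner_comm, h1]
    simp

/-- The tangent vector `α e_{2n} + T`. -/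
def transversal (N : Hn n → Cn n) (α : Hn n → ℝ) (q : Hn n) : Hn n :=
  frame q (α q • N q) + ((0, 1) : Hn n)

theorem IsLocalNormal.transversal_mem (h : IsLocalNormal M U N α) {q : Hn n} (hq : q ∈ M ∩ U) :
    transversal N α q ∈ tangentSpaceAt M q := by
  have h1 := contactForm_frame_add_smul q (α q • N q) 1
  rw [one_smul] at h1
  rw [h.mem_tangent q hq, transversal, h1, Prod.fst_add, frame_fst, add_zero, real_inner_smul_right,
    h.norm q hq.2]

/-- The commutator of the sections of `ξ'` through `v` and `i v`: it is transversal to the contact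
planes. -/
theorem IsUmbilicNormal.commutator_xiSection {F : Type*} [NormedAddCommGroup F] [NormedSpace ℝ F]
    (h : IsUmbilicNormal c M U N α) {q : Hn n} (hq : q ∈ M ∩ U) {f : Hn n → F}
    (hf : ContDiffAt ℝ 2 f q) {v : Cn n} (h1 : ⟪N q, v⟫_ℝ = 0) (h2 : ⟪Complex.I • N q, v⟫_ℝ = 0) :
    fderiv ℝ (fun x => fderiv ℝ f x (frame x (xiSection N v x))) q (frame q (Complex.I • v)) -
      fderiv ℝ (fun x => fderiv ℝ f x (frame x (xiSection N (Complex.I • v) x))) q (frame q v) =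
    (2 * ⟪v, v⟫_ℝ) • (fderiv ℝ f q (transversal N α q) +
      xiEigenvalue c N q • fderiv ℝ f q (frame q (-(Complex.I • N q)))) := by
  have hd := h.differentiableAt hq.2
  have h1' : ⟪N q, Complex.I • v⟫_ℝ = 0 := by rw [inner_I_right, h2, neg_zero]
  have h2' : ⟪Complex.I • N q, Complex.I • v⟫_ℝ = 0 := by rw [inner_I_I, h1]
  have key := fderiv_commutator hf (differentiableAt_xiSection hd v)
    (differentiableAt_xiSection hd (Complex.I • v))
  rw [xiSection_apply h1 h2, xiSection_apply h1' h2', fderiv_xiSection hd h1 h2,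
    fderiv_xiSection hd h1' h2', h.fderiv_xiPrime q hq v h1 h2,
    h.fderiv_xiPrime q hq _ h1' h2'] at key
  rw [key]
  simp only [I_smul_I_smul, smul_add, smul_comm Complex.I (_ : ℝ), smul_neg, inner_add_left,
    real_inner_smul_left, inner_neg_left, inner_I_I, inner_I_self, inner_I_smul_self_right,
    transversal, map_add, map_neg, map_sub, map_smul]
  module

/-- The equation of Codazzi for the directions `v` in `ξ'` and `-i N`: the components along `i N`,
`v` and `i v` of the commutator of sections through these directions, applied to `N`. -/
theorem IsUmbilicNormal.codazzi (h : IsUmbilicNormal c M U N α) (hM : IsEmbeddedHypersurface M)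
    {q : Hn n} (hq : q ∈ M ∩ U) {v : Cn n} (hv0 : v ≠ 0) (h1 : ⟪N q, v⟫_ℝ = 0)
    (h2 : ⟪Complex.I • N q, v⟫_ℝ = 0) :
    fderiv ℝ (charEigenvalue N) q (frame q v) = 0 ∧
    fderiv ℝ (xiEigenvalue c N) q (frame q (-(Complex.I • N q))) =
      (charEigenvalue N q - 2 * xiEigenvalue c N q) * α q ∧
    fderiv ℝ α q (frame q (-(Complex.I • N q))) =
      xiEigenvalue c N q ^ 2 - α q ^ 2 - charEigenvalue N q * xiEigenvalue c N q := by
  have hUq := h.isOpen.mem_nhds hq.2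
  have hd := h.differentiableAt hq.2
  have hId := hasFDerivAt_I_smul hd.hasFDerivAt
  have hN2 : ContDiffAt ℝ 2 N q := (h.smooth_normal.contDiffAt hUq).of_le (by norm_cast)
  have hdk := ((h.contDiffOn_xiEigenvalue c).contDiffAt hUq).differentiableAt (by simp)
  have hdl := (h.contDiffOn_charEigenvalue.contDiffAt hUq).differentiableAt (by simp)
  have hda := (h.smooth_alpha.contDiffAt hUq).differentiableAt (by simp)
  have hN1 := h.norm q hq.2
  have hNI : ⟪N q, -(Complex.I • N q)⟫_ℝ = 0 := by
    rw [inner_neg_right, inner_I_smul_self_right, neg_zero]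
  have hV := differentiableAt_xiSection hd v
  have hE : DifferentiableAt ℝ (fun x => -(Complex.I • N x)) q := hId.neg.differentiableAt
  have key := fderiv_commutator hN2 hV hE
  have hdN : DifferentiableAt ℝ (fderiv ℝ N) q :=
    (hN2.fderiv_right (m := 1) (by norm_num)).differentiableAt (by norm_num)
  -- the derivatives of `N` along the two sections are known on `M`, which determines their
  -- derivatives in tangent directions
  have e1 := h.fderiv_congr hM hq
    (hdN.clm_apply (fderiv_frame hV 0).1).hasFDerivAt
    ((hdk.hasFDerivAt.fun_neg.fun_smul hV.hasFDerivAt).fun_add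
      (hda.hasFDerivAt.fun_smul (hasFDerivAt_I_smul hV.hasFDerivAt)))
    (fun x hx => h.fderiv_xiPrime x hx _ (inner_xiSection (h.norm x hx.2) v).1
      (inner_xiSection (h.norm x hx.2) v).2) hNI
  have e2 := h.fderiv_congr hM hq
    (hdN.clm_apply (fderiv_frame hE 0).1).hasFDerivAt
    (hdl.hasFDerivAt.smul hId) (fun x hx => h.fderiv_char hx) h1
  have hdE : fderiv ℝ (fun x => -(Complex.I • N x)) q (frame q v) =
      -(Complex.I • fderiv ℝ N q (frame q v)) := by
    have h3 : fderiv ℝ (fun x => -(Complex.I • N x)) q = _ := hId.neg.fderiv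
    rw [h3]
    simp [IL_apply]
  have hdV : fderiv ℝ (xiSection N v) q (frame q (-(Complex.I • N q))) = 0 := by
    rw [fderiv_xiSection hd h1 h2, h.fderiv_char hq, real_inner_smul_left, h2,
      smul_comm Complex.I (charEigenvalue N q), I_smul_I_smul, real_inner_smul_left,
      inner_neg_left, h1]
    simp
  have h1' : ⟪N q, Complex.I • v⟫_ℝ = 0 := by rw [inner_I_right, h2, neg_zero]
  have h2' : ⟪Complex.I • N q, Complex.I • v⟫_ℝ = 0 := by rw [inner_I_I, h1]
  have hvN : ⟪v, N q⟫_ℝ = 0 := by rw [real_inner_comm, h1]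
  have hvIN : ⟪v, Complex.I • N q⟫_ℝ = 0 := by rw [real_inner_comm, h2]
  have hvv : ⟪v, v⟫_ℝ ≠ 0 := inner_self_ne_zero.2 hv0
  rw [xiSection_apply h1 h2, e1, e2, hdE, hdV, h.fderiv_xiPrime q hq v h1 h2] at key
  clear e1 e2
  generalize frame q (-(Complex.I • N q)) = X at *
  simp only [add_apply, neg_apply, smul_apply, ContinuousLinearMap.smulRight_apply,
    ContinuousLinearMap.comp_apply, hdV, IL_apply, xiSection_apply h1 h2, smul_zero, zero_add,
    h.fderiv_xiPrime q hq v h1 h2, inner_neg_right, inner_I_I, hvN, smul_add,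
    smul_comm Complex.I (_ : ℝ), I_smul_I_smul, map_sub, map_add, map_neg, map_smul, map_zero,
    h.fderiv_xiPrime q hq _ h1' h2'] at key
  refine ⟨?_, ?_, ?_⟩
  · have := congrArg (fun w => ⟪w, Complex.I • N q⟫_ℝ) key
    simp only [inner_add_left, inner_sub_left, inner_neg_left, real_inner_smul_left, inner_I_I,
      hvN, hvIN, hN1, inner_zero_left] at this
    linarith
  · have := congrArg (fun w => ⟪w, v⟫_ℝ) key
    simp only [inner_add_left, inner_sub_left, inner_neg_left, real_inner_smul_left, h2,
      inner_I_self, inner_zero_left] at this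
    refine mul_right_cancel₀ hvv ?_
    linarith
  · have := congrArg (fun w => ⟪w, Complex.I • v⟫_ℝ) key
    simp only [inner_add_left, inner_sub_left, inner_neg_left, real_inner_smul_left, inner_I_I, h1,
      inner_I_smul_self_right, inner_zero_left] at this
    refine mul_right_cancel₀ hvv ?_
    linarith

theorem IsUmbilicNormal.fderiv_xiEigenvalue (h : IsUmbilicNormal c M U N α)
    (hM : IsEmbeddedHypersurface M) {q : Hn n} (hq : q ∈ M ∩ U) {v : Cn n} (h1 : ⟪N q, v⟫_ℝ = 0)
    (h2 : ⟪Complex.I • N q, v⟫_ℝ = 0) :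
    fderiv ℝ (xiEigenvalue c N) q (frame q v) = 0 := by
  by_cases hv0 : v = 0
  · simp [hv0]
  have hdl := (h.contDiffOn_charEigenvalue.contDiffAt (h.isOpen.mem_nhds hq.2)).differentiableAt
    (by simp)
  have h3 : fderiv ℝ (xiEigenvalue c N) q = _ :=
    ((hdl.hasFDerivAt.const_sub c).mul_const ((2 * n - 2 : ℝ)⁻¹)).fderiv
  rw [h3]
  simp [(h.codazzi hM hq hv0 h1 h2).1]

/-- The function `α` is constant in the directions `v` of `ξ'`. The commutator of the sections
through `v` and `i v`, applied to `N`, involves the derivative of `N` along `α e_{2n} + T`; the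
symmetry of the second fundamental form expresses its component along `v` by the derivative of `α`.
-/
theorem IsUmbilicNormal.fderiv_alpha (h : IsUmbilicNormal c M U N α)
    (hM : IsEmbeddedHypersurface M) {q : Hn n} (hq : q ∈ M ∩ U) {v : Cn n} (h1 : ⟪N q, v⟫_ℝ = 0)
    (h2 : ⟪Complex.I • N q, v⟫_ℝ = 0) : fderiv ℝ α q (frame q v) = 0 := by
  by_cases hv0 : v = 0
  · simp [hv0]
  have hUq := h.isOpen.mem_nhds hq.2
  have hd := h.differentiableAt hq.2
  have hN2 : ContDiffAt ℝ 2 N q := (h.smooth_normal.contDiffAt hUq).of_le (by norm_cast)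
  have hdk := ((h.contDiffOn_xiEigenvalue c).contDiffAt hUq).differentiableAt (by simp)
  have hda := (h.smooth_alpha.contDiffAt hUq).differentiableAt (by simp)
  have h1' : ⟪N q, Complex.I • v⟫_ℝ = 0 := by rw [inner_I_right, h2, neg_zero]
  have h2' : ⟪Complex.I • N q, Complex.I • v⟫_ℝ = 0 := by rw [inner_I_I, h1]
  have hvv : ⟪v, v⟫_ℝ ≠ 0 := inner_self_ne_zero.2 hv0
  have hdN : DifferentiableAt ℝ (fderiv ℝ N) q :=
    (hN2.fderiv_right (m := 1) (by norm_num)).differentiableAt (by norm_num)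
  -- the derivative of `N` along a section of `ξ'` is known on `M`
  have hder : ∀ w w' : Cn n, ⟪N q, w'⟫_ℝ = 0 →
      fderiv ℝ (fun x => fderiv ℝ N x (frame x (xiSection N w x))) q (frame q w') = _ :=
    fun w w' hw' => h.fderiv_congr hM hq
      (hdN.clm_apply (fderiv_frame (differentiableAt_xiSection hd w) 0).1).hasFDerivAt
      ((hdk.hasFDerivAt.fun_neg.fun_smul (differentiableAt_xiSection hd w).hasFDerivAt).fun_add
        (hda.hasFDerivAt.fun_smul
          (hasFDerivAt_I_smul (differentiableAt_xiSection hd w).hasFDerivAt)))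
      (fun x hx => h.fderiv_xiPrime x hx _ (inner_xiSection (h.norm x hx.2) w).1
        (inner_xiSection (h.norm x hx.2) w).2) hw'
  have key := h.commutator_xiSection hq hN2 h1 h2
  rw [hder v _ h1', hder _ v h1, h.fderiv_char hq] at key
  -- the component along `v`
  have key2 := congrArg (fun w => ⟪w, v⟫_ℝ) key
  have hsymm := h.symm q hq _ (h.transversal_mem hq) _ ((h.frame_mem hq).2 h1)
  have hT1 : contactForm q (transversal N α q) = 1 := by
    have := contactForm_frame_add_smul q (α q • N q) 1
    rwa [one_smul] at this
  have hT2 : (transversal N α q).1 = α q • N q := by simp [transversal]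
  have hNv : ⟪Complex.I • v, N q⟫_ℝ = 0 := by rw [real_inner_comm, h1']
  have hNv' : ⟪v, N q⟫_ℝ = 0 := by rw [real_inner_comm, h1]
  rw [contactForm_frame, frame_fst, hT1, hT2, h.fderiv_xiPrime q hq v h1 h2,
    smul_comm Complex.I (α q)] at hsymm
  simp only [inner_add_left, real_inner_smul_left, real_inner_smul_right, hNv, hNv', h2] at hsymm
  simp only [add_apply, neg_apply, smul_apply, ContinuousLinearMap.smulRight_apply,
    ContinuousLinearMap.comp_apply, IL_apply, xiSection_apply h1 h2, xiSection_apply h1' h2',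
    fderiv_xiSection hd h1 h2, fderiv_xiSection hd h1' h2', h.fderiv_xiEigenvalue hM hq h1 h2,
    h.fderiv_xiEigenvalue hM hq h1' h2', smul_sub, smul_neg, smul_comm Complex.I (_ : ℝ),
    I_smul_I_smul, inner_add_left, inner_sub_left, inner_neg_left, real_inner_smul_left, h1, h2,
    inner_I_self, neg_smul] at key2
  have h3 : ⟪v, v⟫_ℝ * (3 * fderiv ℝ α q (frame q v)) = 0 := by
    have h4 : ⟪fderiv ℝ N q (transversal N α q), v⟫_ℝ = -fderiv ℝ α q (frame q v) := by linarith
    rw [h4] at key2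
    linarith
  rcases mul_eq_zero.1 h3 with h5 | h5
  · exact absurd h5 hvv
  · linarith

/-- A function on `M` that is constant in the directions of `ξ ∩ TM` is constant in all directions:
the contact planes are not integrable along `ξ'`, as the dimension of `ξ'` is at least `2`. -/
theorem IsUmbilicNormal.fderiv_eq_zero {F : Type*} [NormedAddCommGroup F] [NormedSpace ℝ F]
    (hn : 2 ≤ n) (h : IsUmbilicNormal c M U N α) (hM : IsEmbeddedHypersurface M) {f : Hn n → F}
    (hf : ContDiffOn ℝ 2 f U)
    (hxi : ∀ q ∈ M ∩ U, ∀ v, ⟪N q, v⟫_ℝ = 0 → ⟪Complex.I • N q, v⟫_ℝ = 0 →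
      fderiv ℝ f q (frame q v) = 0)
    (hchar : ∀ q ∈ M ∩ U, fderiv ℝ f q (frame q (-(Complex.I • N q))) = 0)
    {q : Hn n} (hq : q ∈ M ∩ U) {X : Hn n} (hX : X ∈ tangentSpaceAt M q) :
    fderiv ℝ f q X = 0 := by
  have hUq := h.isOpen.mem_nhds hq.2
  have hf2 := hf.contDiffAt hUq
  have hd := h.differentiableAt hq.2
  have hdf : DifferentiableAt ℝ (fderiv ℝ f) q :=
    (hf2.fderiv_right (m := 1) (by norm_num)).differentiableAt (by norm_num)
  obtain ⟨v, hv0, h1, h2⟩ := exists_ne_zero_xiPrime hn (N q)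
  have hvv : ⟪v, v⟫_ℝ ≠ 0 := inner_self_ne_zero.2 hv0
  have h1' : ⟪N q, Complex.I • v⟫_ℝ = 0 := by rw [inner_I_right, h2, neg_zero]
  have hder : ∀ w w' : Cn n, ⟪N q, w'⟫_ℝ = 0 →
      fderiv ℝ (fun x => fderiv ℝ f x (frame x (xiSection N w x))) q (frame q w') = 0 :=
    fun w w' hw' => h.fderiv_congr hM hq (g' := (0 : Hn n →L[ℝ] F))
      (hdf.clm_apply (fderiv_frame (differentiableAt_xiSection hd w) 0).1).hasFDerivAt
      (hasFDerivAt_const (0 : F) q) (fun x hx => hxi x hx _ (inner_xiSection (h.norm x hx.2) w).1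
        (inner_xiSection (h.norm x hx.2) w).2) hw'
  have key := h.commutator_xiSection hq hf2 h1 h2
  rw [hder v _ h1', hder _ v h1, hchar q hq, smul_zero, add_zero, sub_zero] at key
  have hT : fderiv ℝ f q (transversal N α q) = 0 := by
    rcases smul_eq_zero.1 key.symm with h3 | h3
    · exact absurd h3 (mul_ne_zero two_ne_zero hvv)
    · exact h3
  -- split `X` along `ξ'`, the characteristic direction and the transversal vector
  have hhor : ∀ w, ⟪N q, w⟫_ℝ = 0 → fderiv ℝ f q (frame q w) = 0 := fun w hw => by
    obtain ⟨h3, h4⟩ := inner_sub_eq_zero (h.norm q hq.2) hw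
    have h5 : w = (w - ⟪Complex.I • N q, w⟫_ℝ • (Complex.I • N q)) +
        (-⟪Complex.I • N q, w⟫_ℝ) • (-(Complex.I • N q)) := by
      module
    rw [h5, map_add, map_add, hxi q hq _ h3 h4, map_smul, map_smul, hchar q hq, smul_zero, add_zero]
  have hX' := (h.mem_tangent q hq X).1 hX
  have hXe : X = frame q (X.1 - contactForm q X • (α q • N q)) +
      contactForm q X • transversal N α q := by
    conv_lhs => rw [eq_frame_add_smul q X]
    rw [transversal, map_sub, map_smul, smul_add]
    abel
  rw [hXe, map_add, map_smul, hT, smul_zero, add_zero]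
  apply hhor
  rw [inner_sub_right, real_inner_smul_right, real_inner_smul_right, h.norm q hq.2, hX']
  ring

/-- A function on `M` that is constant in the directions of `ξ ∩ TM` is locally constant. -/
theorem IsUmbilicNormal.eventually_eq {F : Type*} [NormedAddCommGroup F] [NormedSpace ℝ F]
    (hn : 2 ≤ n) (h : IsUmbilicNormal c M U N α) (hM : IsEmbeddedHypersurface M) {f : Hn n → F}
    (hf : ContDiffOn ℝ 2 f U)
    (hxi : ∀ q ∈ M ∩ U, ∀ v, ⟪N q, v⟫_ℝ = 0 → ⟪Complex.I • N q, v⟫_ℝ = 0 →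
      fderiv ℝ f q (frame q v) = 0)
    (hchar : ∀ q ∈ M ∩ U, fderiv ℝ f q (frame q (-(Complex.I • N q))) = 0)
    {q : Hn n} (hq : q ∈ M ∩ U) : ∀ᶠ x in 𝓝[M] q, f x = f q := by
  obtain ⟨u, hu⟩ := hM.exists_C2 q hq.1
  have hu1 := hu.of_le (m' := 1) (by norm_num)
  obtain ⟨U₀, hU₀, hqU₀, huc, hne, hMU⟩ := hu1
  obtain ⟨m, φ, U', hm, hφ, -, hU', hqU', hsub, hran⟩ :=
    IsLocalDefiningFunction.exists_parametrization (by omega) ⟨U₀, hU₀, hqU₀, huc, hne, hMU⟩ hq.1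
    (Filter.inter_mem (h.isOpen.mem_nhds hq.2) (hU₀.mem_nhds hqU₀))
  have hmem : ∀ x, φ x ∈ M ∩ U' := fun x => hran ▸ Set.mem_range_self x
  have hφd : ∀ x, HasFDerivAt φ (fderiv ℝ φ x) x := fun x =>
    ((hφ.differentiable (by norm_num)) x).hasFDerivAt
  have htan : ∀ x Y, fderiv ℝ φ x Y ∈ tangentSpaceAt M (φ x) := fun x Y => by
    have h1 := hsub (hmem x).2
    rw [tangentSpaceAt_eq ⟨U₀, hU₀, h1.2, huc, hne, hMU⟩ (hmem x).1]
    have h2 : HasFDerivAt u (fderiv ℝ u (φ x)) (φ x) :=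
      ((huc.contDiffAt (hU₀.mem_nhds h1.2)).differentiableAt (by norm_num)).hasFDerivAt
    have h3 : (fun y => u (φ y)) = fun _ => 0 := by
      funext y
      have : φ y ∈ M ∩ U₀ := ⟨(hmem y).1, (hsub (hmem y).2).2⟩
      rw [hMU] at this
      exact this.2
    have h4 := h2.comp x (hφd x)
    have h5 : HasFDerivAt (fun y => u (φ y)) (0 : EuclideanSpace ℝ (Fin m) →L[ℝ] ℝ) x := by
      rw [h3]; exact hasFDerivAt_const 0 x
    exact congrArg (fun L => L Y) (h4.unique h5)
  have hfφ : ∀ x, HasFDerivAt (fun y => f (φ y)) (0 : EuclideanSpace ℝ (Fin m) →L[ℝ] F) x :=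
    fun x => by
      have h1 := (hsub (hmem x).2).1
      have h2 : HasFDerivAt f (fderiv ℝ f (φ x)) (φ x) :=
        ((hf.contDiffAt (h.isOpen.mem_nhds h1)).differentiableAt (by norm_num)).hasFDerivAt
      have h3 := h2.comp x (hφd x)
      refine h3.congr_fderiv (ContinuousLinearMap.ext fun Y => ?_)
      exact h.fderiv_eq_zero hn hM hf hxi hchar ⟨(hmem x).1, h1⟩ (htan x Y)
  have hconst := is_const_of_fderiv_eq_zero (fun x => (hfφ x).differentiableAt)
    (fun x => (hfφ x).fderiv)
  obtain ⟨x₀, hx₀⟩ : q ∈ Set.range φ := hran ▸ ⟨hq.1, hqU'⟩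
  have : M ∩ U' ∈ 𝓝[M] q :=
    Filter.inter_mem self_mem_nhdsWithin (mem_nhdsWithin_of_mem_nhds (hU'.mem_nhds hqU'))
  filter_upwards [this] with x hx
  obtain ⟨y, hy⟩ : x ∈ Set.range φ := hran ▸ hx
  rw [← hy, ← hx₀]
  exact hconst y x₀

end structureEquations

/-! ### Conserved quantities -/

/-- `N`, `α` and `k` are the horizontal normal, the function `α` and the eigenvalue of the shape
operator on `ξ'` along the regular part of the umbilic hypersurface `M` of constant `p`-mean
curvature `c`. -/
structure IsUmbilicData (c : ℝ) (M : Set (Hn n)) (N : Hn n → Cn n) (α k : Hn n → ℝ) : Prop where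
  isEmbedded : IsEmbeddedHypersurface M
  exists_normal : ∀ p ∈ regularPart M, ∃ (U : Set (Hn n)) (N' : Hn n → Cn n) (α' : Hn n → ℝ),
    p ∈ U ∧ IsUmbilicNormal c M U N' α' ∧ ∀ q ∈ M ∩ U,
      q ∈ regularPart M ∧ N' q = N q ∧ α' q = α q ∧ xiEigenvalue c N' q = k q

/-- The eigenvalue `k` is defined here by the trace, from the derivative of `N` in the
characteristic direction, so that it is a smooth function. -/
theorem IsUmbilic.exists_isUmbilicData {c : ℝ} {M : Set (Hn n)} {e : Hn n → Cn n} (hn : 2 ≤ n)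
    (hM : IsEmbeddedHypersurface M) (he : IsCharacteristicField M e) (humb : IsUmbilic M e)
    (hH : ∀ p ∈ regularPart M, HasPMeanCurvatureAt M e p c) :
    ∃ N α k, IsUmbilicData c M N α k := by
  refine ⟨fun q => J (e q), alpha M e, fun q => (c + ⟪covariantDerivative M (horizontalNormal e) q
    (e q), e q⟫_ℝ) / (2 * n - 2), hM, fun p hp => ?_⟩
  obtain ⟨U, N, α, hpU, hloc, hag⟩ := he.exists_isLocalNormal hM hp
  refine ⟨U, N, α, hpU, humb.isUmbilicNormal hn hM hH hloc hag, fun q hq => ?_⟩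
  obtain ⟨hqr, hN, hα⟩ := hag q hq
  refine ⟨hqr, hN, hα, ?_⟩
  have he' : e q = -(Complex.I • N q) := by
    rw [hN, J_apply, I_smul_I_smul, neg_neg]
  rw [hloc.covariantDerivative_eq hM (fun x hx => (hag x hx).2.1) hq
    ((hloc.frame_mem hq).1 (he.mem q hqr)), xiEigenvalue, charEigenvalue, he', inner_neg_right,
    sub_eq_add_neg]

/-- The space of the possible values of a point, the horizontal normal, `α` and `k`. -/
abbrev StateSpace (n : ℕ) : Type := Hn n × Cn n × ℝ × ℝ

/-- The derivative of the state in the direction `v` of `ξ'`, according to the structure equations.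
-/
def xiVelocity (σ : StateSpace n) (v : Cn n) : StateSpace n :=
  (frame σ.1 v, -σ.2.2.2 • v + σ.2.2.1 • (Complex.I • v), 0, 0)

/-- The derivative of the state in the characteristic direction `-i N`, according to the structure
equations. -/
def charVelocity (c : ℝ) (σ : StateSpace n) : StateSpace n :=
  (frame σ.1 (-(Complex.I • σ.2.1)), (c - (2 * n - 2) * σ.2.2.2) • (Complex.I • σ.2.1),
    σ.2.2.2 ^ 2 - σ.2.2.1 ^ 2 - (c - (2 * n - 2) * σ.2.2.2) * σ.2.2.2,
    (c - 2 * n * σ.2.2.2) * σ.2.2.1)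

/-- The state of a hypersurface at a point. -/
def state (N : Hn n → Cn n) (α k : Hn n → ℝ) (q : Hn n) : StateSpace n := (q, N q, α q, k q)

theorem IsUmbilicNormal.mono {M U U' : Set (Hn n)} {N : Hn n → Cn n} {α : Hn n → ℝ} {c : ℝ}
    (h : IsUmbilicNormal c M U N α) (hU' : IsOpen U') (hs : U' ⊆ U) :
    IsUmbilicNormal c M U' N α where
  toIsLocalNormal := h.toIsLocalNormal.mono hU' hs
  fderiv_xiPrime q hq := h.fderiv_xiPrime q ⟨hq.1, hs hq.2⟩

theorem IsUmbilicNormal.contDiffOn_state {M U : Set (Hn n)} {N : Hn n → Cn n} {α : Hn n → ℝ}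
    {c : ℝ} (h : IsUmbilicNormal c M U N α) :
    ContDiffOn ℝ ∞ (state N α (xiEigenvalue c N)) U :=
  contDiffOn_id.prodMk
    (h.smooth_normal.prodMk (h.smooth_alpha.prodMk (h.contDiffOn_xiEigenvalue c)))

theorem IsUmbilicNormal.fderiv_state {M U : Set (Hn n)} {N : Hn n → Cn n} {α : Hn n → ℝ}
    {c : ℝ} (h : IsUmbilicNormal c M U N α) {q : Hn n} (hq : q ∈ U) (X : Hn n) :
    fderiv ℝ (state N α (xiEigenvalue c N)) q X =
      (X, fderiv ℝ N q X, fderiv ℝ α q X, fderiv ℝ (xiEigenvalue c N) q X) := by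
  have hUq := h.isOpen.mem_nhds hq
  have hdN := (h.smooth_normal.contDiffAt hUq).differentiableAt (by simp)
  have hdk := ((h.contDiffOn_xiEigenvalue c).contDiffAt hUq).differentiableAt (by simp)
  have hda := (h.smooth_alpha.contDiffAt hUq).differentiableAt (by simp)
  have h1 : fderiv ℝ (state N α (xiEigenvalue c N)) q = _ :=
    ((hasFDerivAt_id q).prodMk
      (hdN.hasFDerivAt.prodMk (hda.hasFDerivAt.prodMk hdk.hasFDerivAt))).fderiv
  rw [h1]
  rfl

theorem IsUmbilicNormal.fderiv_state_xi {M U : Set (Hn n)} {N : Hn n → Cn n} {α : Hn n → ℝ}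
    {c : ℝ} (h : IsUmbilicNormal c M U N α) (hM : IsEmbeddedHypersurface M) {q : Hn n}
    (hq : q ∈ M ∩ U) {v : Cn n} (h1 : ⟪N q, v⟫_ℝ = 0) (h2 : ⟪Complex.I • N q, v⟫_ℝ = 0) :
    fderiv ℝ (state N α (xiEigenvalue c N)) q (frame q v) =
      xiVelocity (state N α (xiEigenvalue c N) q) v := by
  rw [h.fderiv_state hq.2, h.fderiv_xiPrime q hq v h1 h2, h.fderiv_alpha hM hq h1 h2,
    h.fderiv_xiEigenvalue hM hq h1 h2]
  rfl

theorem IsUmbilicNormal.fderiv_state_char {M U : Set (Hn n)} {N : Hn n → Cn n} {α : Hn n → ℝ}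
    {c : ℝ} (hn : 2 ≤ n) (h : IsUmbilicNormal c M U N α) (hM : IsEmbeddedHypersurface M) {q : Hn n}
    (hq : q ∈ M ∩ U) :
    fderiv ℝ (state N α (xiEigenvalue c N)) q (frame q (-(Complex.I • N q))) =
      charVelocity c (state N α (xiEigenvalue c N) q) := by
  obtain ⟨v, hv0, h1, h2⟩ := exists_ne_zero_xiPrime hn (N q)
  obtain ⟨-, h3, h4⟩ := h.codazzi hM hq hv0 h1 h2
  have hl : charEigenvalue N q = c - (2 * n - 2) * xiEigenvalue c N q := by
    have : (2 : ℝ) ≤ n := by exact_mod_cast hn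
    have : (2 * n - 2 : ℝ) ≠ 0 := by linarith
    rw [xiEigenvalue, mul_div_cancel₀ _ this]
    ring
  rw [h.fderiv_state hq.2, h.fderiv_char hq, h3, h4, hl]
  simp only [charVelocity, state]
  congr 3
  ring

section data

variable {M : Set (Hn n)} {N : Hn n → Cn n} {α k : Hn n → ℝ} {c : ℝ}

/-- The derivative of a composite `Γ ∘ s` in the direction `X` is the derivative of `Γ` along the
line through `s q` with the velocity of `s`. -/
theorem fderiv_comp_eq {E F G : Type*} [NormedAddCommGroup E] [NormedSpace ℝ E]
    [NormedAddCommGroup F] [NormedSpace ℝ F] [NormedAddCommGroup G] [NormedSpace ℝ G]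
    {Γ : F → G} {s : E → F} {q X : E} (hΓ : DifferentiableAt ℝ Γ (s q))
    (hs : DifferentiableAt ℝ s q) {d : G}
    (hd : HasDerivAt (fun r : ℝ => Γ (s q + r • fderiv ℝ s q X)) d 0) :
    fderiv ℝ (fun x => Γ (s x)) q X = d := by
  have h1 : fderiv ℝ (fun x => Γ (s x)) q = _ := (hΓ.hasFDerivAt.comp q hs.hasFDerivAt).fderiv
  rw [h1, ContinuousLinearMap.comp_apply]
  exact (hΓ.hasFDerivAt.hasLineDerivAt (fderiv ℝ s q X)).unique hd

/-- A function of the state whose derivatives in the directions of `ξ ∩ TM` vanish is locally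
constant along `M`. -/
theorem IsUmbilicData.eventually_eq (hn : 2 ≤ n) (h : IsUmbilicData c M N α k) {F : Type*}
    [NormedAddCommGroup F] [NormedSpace ℝ F] {Γ : StateSpace n → F} {O : Set (StateSpace n)}
    (hO : IsOpen O) (hΓ : ContDiffOn ℝ 2 Γ O)
    (hxi : ∀ q ∈ regularPart M, state N α k q ∈ O → ⟪N q, N q⟫_ℝ = 1 →
      ∀ v, ⟪N q, v⟫_ℝ = 0 → ⟪Complex.I • N q, v⟫_ℝ = 0 →
      HasDerivAt (fun s : ℝ => Γ (state N α k q + s • xiVelocity (state N α k q) v)) 0 0)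
    (hchar : ∀ q ∈ regularPart M, state N α k q ∈ O → ⟪N q, N q⟫_ℝ = 1 →
      HasDerivAt (fun s : ℝ => Γ (state N α k q + s • charVelocity c (state N α k q))) 0 0)
    {p : Hn n} (hp : p ∈ regularPart M) (hpO : state N α k p ∈ O) :
    ∀ᶠ x in 𝓝[M] p, x ∈ regularPart M ∧ Γ (state N α k x) = Γ (state N α k p) := by
  obtain ⟨U, N', α', hpU, hU, hag⟩ := h.exists_normal p hp
  have hst : ∀ q ∈ M ∩ U, state N' α' (xiEigenvalue c N') q = state N α k q := fun q hq => by
    obtain ⟨-, h1, h2, h3⟩ := hag q hq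
    simp only [state, h1, h2, h3]
  have hsm := hU.contDiffOn_state
  have hU' := hsm.continuousOn.isOpen_inter_preimage hU.isOpen hO
  set s := state N' α' (xiEigenvalue c N') with hs
  have hpU' : p ∈ M ∩ (U ∩ s ⁻¹' O) := ⟨hp.1, hpU, by
    rw [Set.mem_preimage, hst p ⟨hp.1, hpU⟩]; exact hpO⟩
  have hn' := hU.mono hU' Set.inter_subset_left
  have hΓs : ContDiffOn ℝ 2 (fun x => Γ (s x)) (U ∩ s ⁻¹' O) :=
    hΓ.comp ((hsm.of_le (by norm_cast)).mono Set.inter_subset_left) fun x hx => hx.2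
  have hΓd : ∀ q ∈ M ∩ (U ∩ s ⁻¹' O), DifferentiableAt ℝ Γ (s q) := fun q hq =>
    (hΓ.contDiffAt (hO.mem_nhds hq.2.2)).differentiableAt (by norm_num)
  have hsd : ∀ q ∈ M ∩ (U ∩ s ⁻¹' O), DifferentiableAt ℝ s q := fun q hq =>
    (hsm.contDiffAt (hU.isOpen.mem_nhds hq.2.1)).differentiableAt (by simp)
  have key := hn'.eventually_eq hn h.isEmbedded hΓs (fun q hq v h1 h2 => ?_) (fun q hq => ?_) hpU'
  · filter_upwards [key, hn'.eventually_mem hpU'.2] with x hx hxU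
    have hxU1 : x ∈ M ∩ U := ⟨hxU.1, hxU.2.1⟩
    refine ⟨(hag x hxU1).1, ?_⟩
    rw [← hst x hxU1, ← hst p ⟨hp.1, hpU⟩]
    exact hx
  · have hq1 : q ∈ M ∩ U := ⟨hq.1, hq.2.1⟩
    obtain ⟨hqr, hN, -⟩ := hag q hq1
    refine fderiv_comp_eq (hΓd q hq) (hsd q hq) ?_
    rw [hU.fderiv_state_xi h.isEmbedded hq1 h1 h2, ← hs, hst q hq1]
    refine hxi q hqr ?_ ?_ v (hN ▸ h1) (hN ▸ h2)
    · rw [← hst q hq1]; exact hq.2.2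
    · rw [← hN]; exact hU.norm q hq1.2
  · have hq1 : q ∈ M ∩ U := ⟨hq.1, hq.2.1⟩
    obtain ⟨hqr, hN, -⟩ := hag q hq1
    refine fderiv_comp_eq (hΓd q hq) (hsd q hq) ?_
    rw [hU.fderiv_state_char hn h.isEmbedded hq1, ← hs, hst q hq1]
    refine hchar q hqr ?_ ?_
    · rw [← hst q hq1]; exact hq.2.2
    · rw [← hN]; exact hU.norm q hq1.2

/-- At a local extremum along `M` of a function of the state, its derivative in the characteristic
direction vanishes. -/
theorem IsUmbilicData.char_eq_zero (hn : 2 ≤ n) (h : IsUmbilicData c M N α k)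
    {Γ : StateSpace n → ℝ} {p : Hn n} (hp : p ∈ regularPart M)
    (hΓ : DifferentiableAt ℝ Γ (state N α k p))
    (hmax : IsLocalExtrOn (fun q => Γ (state N α k q)) M p) {d : ℝ}
    (hd : HasDerivAt (fun s : ℝ => Γ (state N α k p + s • charVelocity c (state N α k p))) d 0) :
    d = 0 := by
  obtain ⟨U, N', α', hpU, hU, hag⟩ := h.exists_normal p hp
  have hst : ∀ q ∈ M ∩ U, state N' α' (xiEigenvalue c N') q = state N α k q := fun q hq => by
    obtain ⟨-, h1, h2, h3⟩ := hag q hq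
    simp only [state, h1, h2, h3]
  have hsm := hU.contDiffOn_state
  have hpM : p ∈ M ∩ U := ⟨hp.1, hpU⟩
  have hNI : ⟪N' p, -(Complex.I • N' p)⟫_ℝ = 0 := by
    rw [inner_neg_right, inner_I_smul_self_right, neg_zero]
  have hev : (fun q => Γ (state N α k q)) =ᶠ[𝓝[M] p]
      fun q => Γ (state N' α' (xiEigenvalue c N') q) := by
    filter_upwards [hU.eventually_mem hpU] with x hx
    rw [hst x hx]
  have hsd : DifferentiableAt ℝ (state N' α' (xiEigenvalue c N')) p :=
    (hsm.contDiffAt (hU.isOpen.mem_nhds hpU)).differentiableAt (by simp)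
  rw [← hst p hpM] at hΓ hd
  rw [← hU.fderiv_state_char hn h.isEmbedded hpM] at hd
  rw [← fderiv_comp_eq hΓ hsd hd]
  refine h.isEmbedded.fderiv_eq_zero_of_isLocalExtrOn hp.1 (hΓ.comp p hsd) ?_
    ((hU.frame_mem hpM).2 hNI)
  rcases hmax with hm | hm
  · left
    exact hm.congr hev (hev.self_of_nhdsWithin hp.1)
  · right
    exact hm.congr hev (hev.self_of_nhdsWithin hp.1)

theorem IsUmbilicData.norm (h : IsUmbilicData c M N α k) {p : Hn n} (hp : p ∈ regularPart M) :
    ⟪N p, N p⟫_ℝ = 1 := by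
  obtain ⟨U, N', α', hpU, hU, hag⟩ := h.exists_normal p hp
  rw [← (hag p ⟨hp.1, hpU⟩).2.1]
  exact hU.norm p hpU

theorem IsUmbilicData.mem_tangent (h : IsUmbilicData c M N α k) {p : Hn n}
    (hp : p ∈ regularPart M) (X : Hn n) :
    X ∈ tangentSpaceAt M p ↔ ⟪N p, X.1⟫_ℝ = α p * contactForm p X := by
  obtain ⟨U, N', α', hpU, hU, hag⟩ := h.exists_normal p hp
  obtain ⟨-, h1, h2, -⟩ := hag p ⟨hp.1, hpU⟩
  rw [← h1, ← h2]
  exact hU.mem_tangent p ⟨hp.1, hpU⟩ X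

theorem IsUmbilicData.continuousWithinAt_state (h : IsUmbilicData c M N α k) {p : Hn n}
    (hp : p ∈ regularPart M) : ContinuousWithinAt (state N α k) M p := by
  obtain ⟨U, N', α', hpU, hU, hag⟩ := h.exists_normal p hp
  have h1 : ContinuousWithinAt (state N' α' (xiEigenvalue c N')) M p :=
    (hU.contDiffOn_state.continuousOn.continuousAt (hU.isOpen.mem_nhds hpU)).continuousWithinAt
  refine h1.congr_of_eventuallyEq ?_ ?_
  · filter_upwards [hU.eventually_mem hpU] with x hx
    obtain ⟨-, h1, h2, h3⟩ := hag x hx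
    simp only [state, h1, h2, h3]
  · obtain ⟨-, h1, h2, h3⟩ := hag p ⟨hp.1, hpU⟩
    simp only [state, h1, h2, h3]

end data

/-! ### Center, height and energy -/

/-- The height of the point `q` above the contact plane at `(a, 0)`: the `t`-coordinate of the left
translate of `q` by the inverse of `(a, 0)`. -/
def heightFrom (a : Cn n) (q : Hn n) : ℝ := q.2 - ⟪Complex.I • q.1, a⟫_ℝ

theorem contDiff_heightFrom (a : Cn n) {m : WithTop ℕ∞} : ContDiff ℝ m (heightFrom a) := by
  have h1 : ContDiff ℝ m (fun q : Hn n => IL q.1) := IL.contDiff.comp contDiff_fst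
  exact contDiff_snd.sub (h1.inner ℝ contDiff_const)

theorem hasDerivAt_heightFrom (a : Cn n) (q : Hn n) (v : Cn n) :
    HasDerivAt (fun s : ℝ => heightFrom a (q + s • frame q v)) ⟪Complex.I • v, q.1 - a⟫_ℝ 0 := by
  have h1 : (fun s : ℝ => heightFrom a (q + s • frame q v)) =
      fun s => heightFrom a q + s * ⟪Complex.I • v, q.1 - a⟫_ℝ := by
    funext s
    simp only [heightFrom, frame_apply, Prod.snd_add, Prod.smul_snd, Prod.fst_add, Prod.smul_fst,
      smul_add, smul_comm Complex.I s, inner_add_left, real_inner_smul_left, inner_sub_right,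
      smul_eq_mul]
    ring
  rw [h1]
  simpa using ((hasDerivAt_id (0 : ℝ)).mul_const ⟪Complex.I • v, q.1 - a⟫_ℝ).const_add
    (heightFrom a q)

/-- The square `k² + α²` of the modulus of `ζ = -k + i α`. -/
def curvatureSq (σ : StateSpace n) : ℝ := σ.2.2.2 ^ 2 + σ.2.2.1 ^ 2

/-- The center `z - N / ζ`, where `ζ = -k + i α`. -/
def center (σ : StateSpace n) : Cn n :=
  σ.1.1 + (σ.2.2.2 / curvatureSq σ) • σ.2.1 + (σ.2.2.1 / curvatureSq σ) • (Complex.I • σ.2.1)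

theorem contDiff_curvatureSq {m : WithTop ℕ∞} : ContDiff ℝ m (curvatureSq (n := n)) := by
  unfold curvatureSq
  fun_prop

theorem contDiffOn_center {m : WithTop ℕ∞} :
    ContDiffOn ℝ m (center (n := n)) {σ | curvatureSq σ ≠ 0} := by
  have h1 : ContDiff ℝ m (fun σ : StateSpace n => IL σ.2.1) := IL.contDiff.comp (by fun_prop)
  have h2 : ContDiff ℝ m (fun σ : StateSpace n => σ.2.1) := by fun_prop
  have h3 : ContDiff ℝ m (fun σ : StateSpace n => σ.2.2.2) := by fun_prop
  have h4 : ContDiff ℝ m (fun σ : StateSpace n => σ.2.2.1) := by fun_prop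
  have h5 : ContDiff ℝ m (fun σ : StateSpace n => σ.1.1) := by fun_prop
  have h6 := (contDiff_curvatureSq (n := n) (m := m)).contDiffOn (s := {σ | curvatureSq σ ≠ 0})
  exact (h5.contDiffOn.add ((h3.contDiffOn.div h6 fun _ h => h).smul h2.contDiffOn)).add
    ((h4.contDiffOn.div h6 fun _ h => h).smul h1.contDiffOn)

theorem isOpen_curvatureSq_ne_zero : IsOpen {σ : StateSpace n | curvatureSq σ ≠ 0} :=
  isOpen_ne_fun (contDiff_curvatureSq (m := 0)).continuous continuous_const

section derivatives

variable (σ : StateSpace n) (c : ℝ)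

theorem hasDerivAt_fst_xi (v : Cn n) :
    HasDerivAt (fun s : ℝ => (σ + s • xiVelocity σ v).1.1) v 0 := by
  simpa [xiVelocity] using ((hasDerivAt_id (0 : ℝ)).smul_const v).const_add σ.1.1

theorem hasDerivAt_normal_xi (v : Cn n) :
    HasDerivAt (fun s : ℝ => (σ + s • xiVelocity σ v).2.1)
      (-σ.2.2.2 • v + σ.2.2.1 • (Complex.I • v)) 0 := by
  simpa [xiVelocity] using ((hasDerivAt_id (0 : ℝ)).smul_const
    (-σ.2.2.2 • v + σ.2.2.1 • (Complex.I • v))).const_add σ.2.1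

theorem alpha_xi (v : Cn n) (s : ℝ) : (σ + s • xiVelocity σ v).2.2.1 = σ.2.2.1 := by
  simp [xiVelocity]

theorem eigenvalue_xi (v : Cn n) (s : ℝ) : (σ + s • xiVelocity σ v).2.2.2 = σ.2.2.2 := by
  simp [xiVelocity]

theorem curvatureSq_xi (v : Cn n) (s : ℝ) :
    curvatureSq (σ + s • xiVelocity σ v) = curvatureSq σ := by
  simp only [curvatureSq, alpha_xi, eigenvalue_xi]

theorem hasDerivAt_fst_char :
    HasDerivAt (fun s : ℝ => (σ + s • charVelocity c σ).1.1) (-(Complex.I • σ.2.1)) 0 := by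
  simpa [charVelocity] using ((hasDerivAt_id (0 : ℝ)).smul_const
    (-(Complex.I • σ.2.1))).const_add σ.1.1

theorem hasDerivAt_normal_char :
    HasDerivAt (fun s : ℝ => (σ + s • charVelocity c σ).2.1)
      ((c - (2 * n - 2) * σ.2.2.2) • (Complex.I • σ.2.1)) 0 := by
  simpa [charVelocity] using ((hasDerivAt_id (0 : ℝ)).smul_const
    ((c - (2 * n - 2) * σ.2.2.2) • (Complex.I • σ.2.1))).const_add σ.2.1

theorem hasDerivAt_alpha_char :
    HasDerivAt (fun s : ℝ => (σ + s • charVelocity c σ).2.2.1)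
      (σ.2.2.2 ^ 2 - σ.2.2.1 ^ 2 - (c - (2 * n - 2) * σ.2.2.2) * σ.2.2.2) 0 := by
  simpa [charVelocity] using ((hasDerivAt_id (0 : ℝ)).mul_const
    (σ.2.2.2 ^ 2 - σ.2.2.1 ^ 2 - (c - (2 * n - 2) * σ.2.2.2) * σ.2.2.2)).const_add σ.2.2.1

theorem hasDerivAt_eigenvalue_char :
    HasDerivAt (fun s : ℝ => (σ + s • charVelocity c σ).2.2.2)
      ((c - 2 * n * σ.2.2.2) * σ.2.2.1) 0 := by
  simpa [charVelocity] using ((hasDerivAt_id (0 : ℝ)).mul_const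
    ((c - 2 * n * σ.2.2.2) * σ.2.2.1)).const_add σ.2.2.2

theorem hasDerivAt_curvatureSq_char :
    HasDerivAt (fun s : ℝ => curvatureSq (σ + s • charVelocity c σ))
      (-2 * σ.2.2.1 * curvatureSq σ) 0 := by
  have h := ((hasDerivAt_eigenvalue_char σ c).pow 2).add ((hasDerivAt_alpha_char σ c).pow 2)
  refine h.congr_deriv ?_
  simp [curvatureSq]
  ring

theorem hasDerivAt_center_xi {v : Cn n} (h : curvatureSq σ ≠ 0) :
    HasDerivAt (fun s : ℝ => center (σ + s • xiVelocity σ v)) 0 0 := by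
  simp only [center, alpha_xi, eigenvalue_xi, curvatureSq_xi]
  have h1 := ((hasDerivAt_fst_xi σ v).add
    ((hasDerivAt_normal_xi σ v).const_smul (σ.2.2.2 / curvatureSq σ))).add
    (((IL (n := n)).hasFDerivAt.comp_hasDerivAt (0 : ℝ) (hasDerivAt_normal_xi σ v)).const_smul
      (σ.2.2.1 / curvatureSq σ))
  refine h1.congr_deriv ?_
  simp only [map_add, map_smul, IL_apply, I_smul_I_smul]
  have h2 : v + (σ.2.2.2 / curvatureSq σ) • (-σ.2.2.2 • v + σ.2.2.1 • (Complex.I • v)) +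
      (σ.2.2.1 / curvatureSq σ) • (-σ.2.2.2 • (Complex.I • v) + σ.2.2.1 • -v) =
      (1 - (σ.2.2.2 ^ 2 + σ.2.2.1 ^ 2) / curvatureSq σ) • v := by
    module
  rw [h2, ← curvatureSq, div_self h, sub_self, zero_smul]

theorem hasDerivAt_center_char (h : curvatureSq σ ≠ 0) :
    HasDerivAt (fun s : ℝ => center (σ + s • charVelocity c σ)) 0 0 := by
  have hN := hasDerivAt_normal_char σ c
  have hs := hasDerivAt_curvatureSq_char σ c
  have h0 : σ + (0 : ℝ) • charVelocity c σ = σ := by simp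
  have h1 := ((hasDerivAt_fst_char σ c).add
    (((hasDerivAt_eigenvalue_char σ c).div hs (by rwa [h0])).smul hN)).add
    (((hasDerivAt_alpha_char σ c).div hs (by rwa [h0])).smul
      ((IL (n := n)).hasFDerivAt.comp_hasDerivAt (0 : ℝ) hN))
  refine h1.congr_deriv ?_
  simp only [map_smul, IL_apply, I_smul_I_smul, Pi.div_apply, h0, Function.comp_apply]
  generalize Complex.I • σ.2.1 = w
  match_scalars <;> field_simp <;> rw [curvatureSq] <;> ring

theorem inner_center_sub {a : Cn n} (hN : ⟪σ.2.1, σ.2.1⟫_ℝ = 1) (ha : center σ = a) :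
    ⟪σ.2.1, σ.1.1 - a⟫_ℝ = -(σ.2.2.2 / curvatureSq σ) := by
  rw [← ha, center, inner_sub_right, inner_add_right, inner_add_right, real_inner_smul_right,
    real_inner_smul_right, hN, inner_I_smul_self_right]
  ring

theorem hasDerivAt_heightFrom_xi {a v : Cn n} (ha : center σ = a) (h1 : ⟪σ.2.1, v⟫_ℝ = 0)
    (h2 : ⟪Complex.I • σ.2.1, v⟫_ℝ = 0) :
    HasDerivAt (fun s : ℝ => heightFrom a (σ + s • xiVelocity σ v).1) 0 0 := by
  have h := hasDerivAt_heightFrom a σ.1 v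
  refine h.congr_deriv ?_
  have h3 : ⟪Complex.I • v, σ.2.1⟫_ℝ = 0 := by rw [real_inner_comm, inner_I_right, h2, neg_zero]
  have h4 : ⟪v, σ.2.1⟫_ℝ = 0 := by rw [real_inner_comm, h1]
  rw [← ha, center, inner_sub_right, inner_add_right, inner_add_right, real_inner_smul_right,
    real_inner_smul_right, inner_I_I, h3, h4]
  ring

theorem hasDerivAt_heightFrom_char {a : Cn n} (hN : ⟪σ.2.1, σ.2.1⟫_ℝ = 1) (ha : center σ = a) :
    HasDerivAt (fun s : ℝ => heightFrom a (σ + s • charVelocity c σ).1)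
      (-(σ.2.2.2 / curvatureSq σ)) 0 := by
  have h := hasDerivAt_heightFrom a σ.1 (-(Complex.I • σ.2.1))
  refine h.congr_deriv ?_
  rw [smul_neg, I_smul_I_smul, neg_neg, inner_center_sub σ hN ha]

end derivatives

section data

variable {M : Set (Hn n)} {N : Hn n → Cn n} {α k : Hn n → ℝ} {c : ℝ}

/-- The vanishing of `ζ` propagates: where `k ≠ c / 2n`, the function `|ζ|²ⁿ / (k - c / 2n)` is
locally constant. -/
theorem IsUmbilicData.eventually_curvatureSq_eq_zero (hn : 2 ≤ n) (hc : 0 < c)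
    (h : IsUmbilicData c M N α k) {p : Hn n} (hp : p ∈ regularPart M)
    (h0 : curvatureSq (state N α k p) = 0) :
    ∀ᶠ x in 𝓝[M] p, x ∈ regularPart M ∧ curvatureSq (state N α k x) = 0 := by
  have hn0 : (n : ℝ) ≠ 0 := by positivity
  set O : Set (StateSpace n) := {σ | σ.2.2.2 - c / (2 * n) ≠ 0} with hO
  have hOo : IsOpen O := isOpen_ne_fun (by fun_prop) continuous_const
  have hpO : state N α k p ∈ O := by
    have hk : k p = 0 := by
      have h1 : k p ^ 2 + α p ^ 2 = 0 := h0
      nlinarith [sq_nonneg (k p), sq_nonneg (α p)]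
    change k p - c / (2 * n) ≠ 0
    rw [hk, zero_sub, neg_ne_zero]
    positivity
  have key := h.eventually_eq hn (Γ := fun σ => curvatureSq σ ^ n / (σ.2.2.2 - c / (2 * n))) hOo
    ((contDiff_curvatureSq.contDiffOn.pow n).div (by fun_prop) fun σ h => h)
    (fun q _ _ _ v _ _ => ?_) (fun q _ hq _ => ?_) hp hpO
  · have hev : ∀ᶠ x in 𝓝[M] p, state N α k x ∈ O :=
      (h.continuousWithinAt_state hp) (hOo.mem_nhds hpO)
    filter_upwards [key, hev] with x hx hxO
    refine ⟨hx.1, ?_⟩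
    have h1 := hx.2
    simp only [h0, zero_pow (by omega : n ≠ 0), zero_div] at h1
    rcases div_eq_zero_iff.1 h1 with h2 | h2
    · exact pow_eq_zero_iff (by omega) |>.1 h2
    · exact absurd h2 hxO
  · simp only [curvatureSq_xi, eigenvalue_xi]
    exact hasDerivAt_const _ _
  · set σ := state N α k q
    have h00 : σ + (0 : ℝ) • charVelocity c σ = σ := by simp
    have h1 := ((hasDerivAt_curvatureSq_char σ c).pow n).div
      ((hasDerivAt_eigenvalue_char σ c).sub_const (c / (2 * n))) (by rw [h00]; exact hq)
    refine h1.congr_deriv ?_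
    have hq' : σ.2.2.2 - c / (2 * n) ≠ 0 := hq
    have h2 : curvatureSq σ ^ n = curvatureSq σ ^ (n - 1) * curvatureSq σ := by
      rw [← pow_succ]; congr 1; omega
    simp only [h00, Pi.pow_apply, h2]
    rw [div_eq_zero_iff]
    left
    field_simp
    ring

theorem IsUmbilicData.eventually_center_eq (hn : 2 ≤ n) (h : IsUmbilicData c M N α k) {p : Hn n}
    (hp : p ∈ regularPart M) (h0 : curvatureSq (state N α k p) ≠ 0) :
    ∀ᶠ x in 𝓝[M] p, x ∈ regularPart M ∧ center (state N α k x) = center (state N α k p) :=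
  h.eventually_eq hn isOpen_curvatureSq_ne_zero contDiffOn_center
    (fun _ _ hO _ _ _ _ => hasDerivAt_center_xi _ hO)
    (fun _ _ hO _ => hasDerivAt_center_char _ c hO) hp h0

/-- The energy `(k - c / 2n) / |ζ|²ⁿ` is locally constant. -/
theorem IsUmbilicData.eventually_energy_eq (hn : 2 ≤ n) (h : IsUmbilicData c M N α k) {p : Hn n}
    (hp : p ∈ regularPart M) (h0 : curvatureSq (state N α k p) ≠ 0) :
    ∀ᶠ x in 𝓝[M] p, x ∈ regularPart M ∧
      (k x - c / (2 * n)) / curvatureSq (state N α k x) ^ n =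
        (k p - c / (2 * n)) / curvatureSq (state N α k p) ^ n := by
  have hn0 : (n : ℝ) ≠ 0 := by positivity
  refine h.eventually_eq hn (Γ := fun σ => (σ.2.2.2 - c / (2 * n)) / curvatureSq σ ^ n)
    isOpen_curvatureSq_ne_zero (ContDiffOn.div (by fun_prop) (contDiff_curvatureSq.contDiffOn.pow n)
      fun σ h => pow_ne_zero n h) (fun q _ _ _ v _ _ => ?_) (fun q _ hq _ => ?_) hp h0
  · simp only [curvatureSq_xi, eigenvalue_xi]
    exact hasDerivAt_const _ _
  · set σ := state N α k q
    have h00 : σ + (0 : ℝ) • charVelocity c σ = σ := by simp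
    have hq' : curvatureSq σ ≠ 0 := hq
    have h1 := ((hasDerivAt_eigenvalue_char σ c).sub_const (c / (2 * n))).div
      ((hasDerivAt_curvatureSq_char σ c).pow n) (by
        rw [Pi.pow_apply, h00]; exact pow_ne_zero n hq)
    refine h1.congr_deriv ?_
    have h2 : curvatureSq σ ^ n = curvatureSq σ ^ (n - 1) * curvatureSq σ := by
      rw [← pow_succ]; congr 1; omega
    simp only [h00, Pi.pow_apply, h2]
    rw [div_eq_zero_iff]
    left
    field_simp
    ring

/-- The profile of the Pansu sphere, parametrized by the value `β` of `α`: the height at the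
distance `1 / √(lam² + β²)` from the axis, on the upper half for `β ≥ 0` and on the lower half for
`β ≤ 0` (see `pansuProfile_eq`). -/
def pansuHeight (lam β : ℝ) : ℝ :=
  1 / (2 * lam ^ 2) * (Real.arctan (β / lam) + lam * β / (lam ^ 2 + β ^ 2))

theorem hasDerivAt_pansuHeight {lam : ℝ} (hl : 0 < lam) (β : ℝ) :
    HasDerivAt (pansuHeight lam) (lam / (lam ^ 2 + β ^ 2) ^ 2) β := by
  have hs : lam ^ 2 + β ^ 2 ≠ 0 := by positivity
  have h1 := ((((hasDerivAt_id β).div_const lam).arctan).add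
    (((hasDerivAt_id β).const_mul lam).div (((hasDerivAt_id β).pow 2).const_add (lam ^ 2))
      hs)).const_mul (1 / (2 * lam ^ 2))
  refine h1.congr_deriv ?_
  have h2 : (1 : ℝ) + (β / lam) ^ 2 = (lam ^ 2 + β ^ 2) / lam ^ 2 := by
    field_simp
  simp only [Pi.pow_apply, id, h2]
  field_simp
  ring

theorem contDiff_pansuHeight {lam : ℝ} (hl : 0 < lam) {m : WithTop ℕ∞} :
    ContDiff ℝ m (pansuHeight lam) := by
  unfold pansuHeight
  refine contDiff_const.mul ((Real.contDiff_arctan.comp (by fun_prop)).add ?_)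
  exact ContDiff.div (by fun_prop) (by fun_prop) fun β => by positivity

/-- On a hypersurface with `k = c / 2n` and with the center `a`, the difference of the height and
the profile of the Pansu sphere is locally constant. -/
theorem IsUmbilicData.eventually_height_eq (hn : 2 ≤ n) (hc : 0 < c) (h : IsUmbilicData c M N α k)
    {a : Cn n} (hk : ∀ q ∈ regularPart M, k q = c / (2 * n))
    (ha : ∀ q ∈ regularPart M, center (state N α k q) = a) {p : Hn n} (hp : p ∈ regularPart M) :
    ∀ᶠ x in 𝓝[M] p, x ∈ regularPart M ∧
      heightFrom a x - pansuHeight (c / (2 * n)) (α x) =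
        heightFrom a p - pansuHeight (c / (2 * n)) (α p) := by
  have hn0 : (0 : ℝ) < n := by positivity
  have hl : 0 < c / (2 * n) := by positivity
  have hcl : c = 2 * n * (c / (2 * n)) := by field_simp
  set lam := c / (2 * n) with hlam
  refine h.eventually_eq hn (Γ := fun σ => heightFrom a σ.1 - pansuHeight lam σ.2.2.1)
    isOpen_univ (ContDiff.contDiffOn (((contDiff_heightFrom a).comp contDiff_fst).sub
      ((contDiff_pansuHeight hl).comp (by fun_prop)))) (fun q hq _ _ v h1 h2 => ?_)
    (fun q hqr _ hN => ?_) hp trivial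
  · simp only [alpha_xi]
    exact (hasDerivAt_heightFrom_xi (state N α k q) (ha q hq) h1 h2).sub_const _
  · set σ := state N α k q with hσ
    have hkσ : σ.2.2.2 = lam := hk q hqr
    have h1 := (hasDerivAt_heightFrom_char σ c hN (ha q hqr)).sub
      (HasDerivAt.comp (0 : ℝ) (by exact hasDerivAt_pansuHeight hl _) (hasDerivAt_alpha_char σ c))
    refine h1.congr_deriv ?_
    have h00 : σ + (0 : ℝ) • charVelocity c σ = σ := by simp
    have hs : lam ^ 2 + σ.2.2.1 ^ 2 ≠ 0 := by positivity
    rw [curvatureSq, hkσ, h00, hcl]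
    field_simp
    ring

/-- A hypersurface with center `a` has no regular point at which `α / |ζ|² - c t`, with the height
`t` from `a`, is maximal. Therefore a closed hypersurface has a singular point. -/
theorem IsUmbilicData.not_isLocalExtrOn (hn : 2 ≤ n) (h : IsUmbilicData c M N α k)
    {a : Cn n} {p : Hn n} (hp : p ∈ regularPart M) (h0 : curvatureSq (state N α k p) ≠ 0)
    (ha : center (state N α k p) = a) :
    ¬ IsLocalExtrOn (fun q => α q / curvatureSq (state N α k q) - c * heightFrom a q) M p := by
  intro hext
  set σ := state N α k p with hσ
  have h00 : σ + (0 : ℝ) • charVelocity c σ = σ := by simp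
  have h1 := ((hasDerivAt_alpha_char σ c).div (hasDerivAt_curvatureSq_char σ c)
    (by rwa [h00])).sub ((hasDerivAt_heightFrom_char σ c (h.norm hp) ha).const_mul c)
  have hd : DifferentiableAt ℝ
      (fun σ : StateSpace n => σ.2.2.1 / curvatureSq σ - c * heightFrom a σ.1) σ := by
    have hα : ContDiffAt ℝ 1 (fun σ : StateSpace n => σ.2.2.1) σ := by fun_prop
    refine ((hα.div contDiff_curvatureSq.contDiffAt h0).differentiableAt (by norm_num)).sub ?_
    exact (((contDiff_heightFrom a (m := 1)).differentiable (by norm_num)).comp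
      differentiable_fst σ).const_mul c
  have h2 := h.char_eq_zero hn hp hd hext h1
  have hs : 0 < curvatureSq σ := lt_of_le_of_ne (by unfold curvatureSq; positivity) (Ne.symm h0)
  have hn2 : (2 : ℝ) ≤ n := by exact_mod_cast hn
  rw [h00] at h2
  have h3 : 1 + (2 * n - 2) * σ.2.2.2 ^ 2 / curvatureSq σ = 0 := by
    rw [← h2]
    field_simp
    rw [curvatureSq]
    ring
  have h4 : 0 ≤ (2 * n - 2) * σ.2.2.2 ^ 2 / curvatureSq σ :=
    div_nonneg (mul_nonneg (by linarith) (sq_nonneg _)) hs.le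
  linarith

end data

/-! ### Singular points -/

/-- Data of a hypersurface near a singular point: the horizontal gradient of a defining function
vanishes there, and its `t`-derivative does not. -/
theorem IsEmbeddedHypersurface.exists_of_singular {M : Set (Hn n)} (hM : IsEmbeddedHypersurface M)
    {p : Hn n} (hp : p ∈ M) (hps : p ∉ regularPart M) :
    ∃ (u : Hn n → ℝ) (U : Set (Hn n)), IsOpen U ∧ p ∈ U ∧ ContDiffOn ℝ 2 u U ∧
      (∀ q ∈ U, fderiv ℝ u q ≠ 0) ∧ M ∩ U = {q ∈ U | u q = 0} ∧ horizontalGradient u p = 0 ∧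
      fderiv ℝ u p (0, 1) ≠ 0 := by
  obtain ⟨u, U, hU, hpU, hu, hne, hMU⟩ := hM.exists_C2 p hp
  have hg : horizontalGradient u p = 0 := by
    by_contra h
    exact hps ((mem_regularPart_iff ⟨U, hU, hpU, hu.of_le (by norm_num), hne, hMU⟩ hp).2 h)
  refine ⟨u, U, hU, hpU, hu, hne, hMU, hg, fun h1 => hne p hpU ?_⟩
  refine ContinuousLinearMap.ext fun X => ?_
  rw [fderiv_eq_horizontalGradient, hg, h1]
  simp

/-- The regular points are dense: otherwise the contact planes would be integrable along an open
part of `M`. -/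
theorem IsEmbeddedHypersurface.frequently_mem_regularPart (hn : 1 ≤ n) {M : Set (Hn n)}
    (hM : IsEmbeddedHypersurface M) {p : Hn n} (hp : p ∈ M) :
    ∃ᶠ x in 𝓝[M] p, x ∈ regularPart M := by
  by_cases hps : p ∈ regularPart M
  · intro h
    exact h.self_of_nhdsWithin hp hps
  intro h
  obtain ⟨u, U, hU, hpU, hu, hne, hMU, hg, hT⟩ := hM.exists_of_singular hp hps
  have hu2 := hu.contDiffAt (hU.mem_nhds hpU)
  have hdu : DifferentiableAt ℝ (fderiv ℝ u) p :=
    (hu2.fderiv_right (m := 1) (by norm_num)).differentiableAt (by norm_num)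
  have hg0 : ∀ᶠ x in 𝓝[M] p, horizontalGradient u x = 0 := by
    filter_upwards [h, self_mem_nhdsWithin, mem_nhdsWithin_of_mem_nhds (hU.mem_nhds hpU)]
      with x hx hxM hxU
    by_contra h1
    exact hx ((mem_regularPart_iff ⟨U, hU, hxU, hu.of_le (by norm_num), hne, hMU⟩ hxM).2 h1)
  have hder : ∀ v w : Cn n, fderiv ℝ (fun x => fderiv ℝ u x (frame x v)) p (frame p w) = 0 := by
    intro v w
    refine hM.fderiv_eq_zero hp
      (hdu.clm_apply (fderiv_frame (differentiableAt_const v) 0).1) ?_ ?_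
    · filter_upwards [hg0] with x hx
      rw [← inner_horizontalGradient, hx, inner_zero_left]
    · rw [tangentSpaceAt_eq ⟨U, hU, hpU, hu.of_le (by norm_num), hne, hMU⟩ hp]
      change fderiv ℝ u p (frame p w) = 0
      rw [← inner_horizontalGradient, hg, inner_zero_left]
  have : Nonempty (Fin n) := ⟨⟨0, hn⟩⟩
  obtain ⟨v, hv⟩ := exists_ne (0 : Cn n)
  have key := fderiv_commutator hu2 (differentiableAt_const v)
    (differentiableAt_const (Complex.I • v))
  rw [hder, hder, fderiv_fun_const, fderiv_fun_const] at key
  simp only [Pi.zero_apply, zero_apply, sub_self, map_zero, zero_add, inner_I_I, smul_eq_mul] at key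
  rcases mul_eq_zero.1 key.symm with h1 | h1
  · rcases mul_eq_zero.1 h1 with h2 | h2
    · norm_num at h2
    · exact hv (inner_self_eq_zero.1 h2)
  · exact hT h1

/-- Near a singular point, a hypersurface is a graph over `ℂⁿ`. -/
theorem IsEmbeddedHypersurface.exists_injOn_fst {M : Set (Hn n)} (hM : IsEmbeddedHypersurface M)
    {p : Hn n} (hp : p ∈ M) (hps : p ∉ regularPart M) :
    ∃ O ∈ 𝓝 p, Set.InjOn Prod.fst (M ∩ O) := by
  obtain ⟨u, U, hU, hpU, hu, hne, hMU, hg, hT⟩ := hM.exists_of_singular hp hps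
  have hc : ContinuousOn (fun q => fderiv ℝ u q (0, 1)) U :=
    (hu.continuousOn_fderiv_of_isOpen hU (by norm_num)).clm_apply continuousOn_const
  have hnhds : {q | q ∈ U ∧ fderiv ℝ u q (0, 1) ≠ 0} ∈ 𝓝 p :=
    Filter.inter_mem (hU.mem_nhds hpU)
      ((hc.continuousAt (hU.mem_nhds hpU)).eventually_ne hT)
  obtain ⟨r, hr, hball⟩ := Metric.mem_nhds_iff.1 hnhds
  refine ⟨Metric.ball p r, Metric.ball_mem_nhds p hr, ?_⟩
  -- two points of `M` on a vertical line would enclose a zero of the `t`-derivative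
  have key : ∀ q q' : Hn n, q ∈ M ∩ Metric.ball p r → q' ∈ M ∩ Metric.ball p r → q.1 = q'.1 →
      ¬ q.2 < q'.2 := by
    rintro ⟨z, t⟩ ⟨z', t'⟩ hq hq' hz hlt
    change z = z' at hz
    subst hz
    change t < t' at hlt
    have hline : ∀ s ∈ Set.Icc t t', ((z, s) : Hn n) ∈ Metric.ball p r := by
      intro s hs
      have h1 := hq.2
      have h2 := hq'.2
      rw [← ball_prod_same, Set.mem_prod] at h1 h2 ⊢
      refine ⟨h1.1, ?_⟩
      have h3 := h1.2
      have h4 := h2.2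
      rw [Real.ball_eq_Ioo] at h3 h4 ⊢
      exact ⟨h3.1.trans_le hs.1, hs.2.trans_lt h4.2⟩
    have hd : ∀ s ∈ Set.Icc t t', HasDerivAt (fun s => u (z, s)) (fderiv ℝ u (z, s) (0, 1)) s := by
      intro s hs
      have h1 : HasFDerivAt u (fderiv ℝ u (z, s)) (z, s) :=
        ((hu.contDiffAt (hU.mem_nhds (hball (hline s hs)).1)).differentiableAt
          (by norm_num)).hasFDerivAt
      exact h1.comp_hasDerivAt s ((hasDerivAt_const s z).prodMk (hasDerivAt_id s))
    have hzero : ∀ q ∈ M ∩ Metric.ball p r, u q = 0 := fun q hq => by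
      have : q ∈ M ∩ U := ⟨hq.1, (hball hq.2).1⟩
      rw [hMU] at this
      exact this.2
    obtain ⟨s, hs, hs0⟩ := exists_hasDerivAt_eq_zero hlt
      (fun s hs => (hd s hs).continuousAt.continuousWithinAt)
      (by rw [hzero _ hq, hzero _ hq']) (fun s hs => hd s (Set.Ioo_subset_Icc_self hs))
    exact (hball (hline s (Set.Ioo_subset_Icc_self hs))).2 hs0
  intro q hq q' hq' hz
  rcases lt_trichotomy q.2 q'.2 with h | h | h
  · exact absurd h (key q q' hq hq' hz)
  · exact Prod.ext hz h
  · exact absurd h (key q' q hq' hq hz.symm)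

section data

variable {M : Set (Hn n)} {N : Hn n → Cn n} {α k : Hn n → ℝ} {c : ℝ}

/-- At the singular points `|ζ|` tends to infinity, because `α` does: the vectors `α e_{2n} + T`
are tangent, while `T` is transversal near a singular point and the horizontal gradient tends to
zero. -/
theorem IsUmbilicData.eventually_lt_curvatureSq (h : IsUmbilicData c M N α k) {p : Hn n}
    (hp : p ∈ M) (hps : p ∉ regularPart M) (R : ℝ) :
    ∀ᶠ x in 𝓝[M] p, x ∈ regularPart M → R < curvatureSq (state N α k x) := by
  obtain ⟨u, U, hU, hpU, hu, hne, hMU, hg, hT⟩ := h.isEmbedded.exists_of_singular hp hps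
  have hUp := hU.mem_nhds hpU
  have hgc : ContinuousAt (horizontalGradient u) p :=
    ((contDiffOn_horizontalGradient hU hu (m' := 1) (by norm_num)).continuousOn).continuousAt hUp
  have hc : ContinuousAt (fun q => fderiv ℝ u q (0, 1)) p :=
    ((hu.continuousOn_fderiv_of_isOpen hU (by norm_num)).clm_apply
      continuousOn_const).continuousAt hUp
  have hev : ∀ᶠ x in 𝓝 p,
      ‖horizontalGradient u x‖ ^ 2 * max R 0 < fderiv ℝ u x (0, 1) ^ 2 := by
    refine ContinuousAt.eventually_lt ((hgc.norm.pow 2).mul continuousAt_const) (hc.pow 2) ?_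
    rw [hg]
    simp only [norm_zero, ne_eq, OfNat.ofNat_ne_zero, not_false_eq_true, zero_pow, zero_mul]
    positivity
  filter_upwards [mem_nhdsWithin_of_mem_nhds hev, mem_nhdsWithin_of_mem_nhds hUp,
    self_mem_nhdsWithin] with x hx hxU hxM hxr
  -- the vector `α e_{2n} + T` is tangent to `M`
  have htan : transversal N α x ∈ tangentSpaceAt M x := by
    have h1 := contactForm_frame_add_smul x (α x • N x) 1
    rw [one_smul] at h1
    rw [h.mem_tangent hxr, transversal, h1, Prod.fst_add, frame_fst, add_zero,
      real_inner_smul_right, h.norm hxr]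
  rw [tangentSpaceAt_eq ⟨U, hU, hxU, hu.of_le (by norm_num), hne, hMU⟩ hxM] at htan
  have h2 : fderiv ℝ u x (transversal N α x) = 0 := htan
  rw [transversal, map_add, ← inner_horizontalGradient, real_inner_smul_right] at h2
  have h3 : fderiv ℝ u x (0, 1) ^ 2 ≤ α x ^ 2 * ‖horizontalGradient u x‖ ^ 2 := by
    have h4 : ‖N x‖ = 1 := by
      have := h.norm hxr
      rw [real_inner_self_eq_norm_sq] at this
      exact (pow_eq_one_iff_of_nonneg (norm_nonneg _) two_ne_zero).1 this
    have h5 : |⟪horizontalGradient u x, N x⟫_ℝ| ≤ ‖horizontalGradient u x‖ := by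
      have := abs_real_inner_le_norm (horizontalGradient u x) (N x)
      rwa [h4, mul_one] at this
    have h6 : fderiv ℝ u x (0, 1) = -(α x * ⟪horizontalGradient u x, N x⟫_ℝ) := by linarith
    rw [h6, neg_sq, mul_pow]
    refine mul_le_mul_of_nonneg_left ?_ (sq_nonneg _)
    exact sq_le_sq' (abs_le.1 h5).1 (abs_le.1 h5).2
  have h7 : max R 0 < α x ^ 2 := by
    by_contra! h8
    have := mul_le_mul_of_nonneg_right h8 (sq_nonneg ‖horizontalGradient u x‖)
    linarith
  have h9 : curvatureSq (state N α k x) = k x ^ 2 + α x ^ 2 := rfl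
  rw [h9]
  linarith [le_max_left R 0, sq_nonneg (k x)]

/-- The distance from the center is `|N / ζ| = 1 / |ζ|`. -/
theorem norm_sub_center_sq {σ : StateSpace n} (hN : ⟪σ.2.1, σ.2.1⟫_ℝ = 1)
    (h0 : curvatureSq σ ≠ 0) : ‖σ.1.1 - center σ‖ ^ 2 = 1 / curvatureSq σ := by
  have h1 : σ.1.1 - center σ = -((σ.2.2.2 / curvatureSq σ) • σ.2.1 +
      (σ.2.2.1 / curvatureSq σ) • (Complex.I • σ.2.1)) := by
    rw [center]; abel
  rw [h1, norm_neg, ← real_inner_self_eq_norm_sq]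
  simp only [inner_add_left, inner_add_right, real_inner_smul_left, real_inner_smul_right,
    inner_I_I, hN, inner_I_self, inner_I_smul_self_right]
  field_simp
  rw [curvatureSq]
  ring

/-- The center and the regular points near a singular point have the same limit in `ℂⁿ`. -/
theorem IsUmbilicData.fst_eq_of_frequently (h : IsUmbilicData c M N α k)
    (h0 : ∀ q ∈ regularPart M, curvatureSq (state N α k q) ≠ 0) {p : Hn n} (hp : p ∈ M)
    (hps : p ∉ regularPart M) {a : Cn n}
    (hfr : ∃ᶠ x in 𝓝[M] p, x ∈ regularPart M ∧ center (state N α k x) = a) : p.1 = a := by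
  by_contra hne
  set d := ‖p.1 - a‖ with hd
  have hdpos : 0 < d := norm_pos_iff.2 (sub_ne_zero.2 hne)
  have hcont : ContinuousAt (fun x : Hn n => ‖x.1 - a‖) p := by fun_prop
  have h1 : ∀ᶠ x in 𝓝[M] p, d / 2 < ‖x.1 - a‖ :=
    (hcont.eventually_const_lt (half_lt_self hdpos)).filter_mono nhdsWithin_le_nhds
  obtain ⟨x, ⟨hxr, hxa⟩, hx1, hx2⟩ := (hfr.and_eventually (h1.and
    (h.eventually_lt_curvatureSq hp hps (4 / d ^ 2)))).exists
  have h4 : ‖x.1 - a‖ ^ 2 = 1 / curvatureSq (state N α k x) := by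
    rw [← norm_sub_center_sq (σ := state N α k x) (h.norm hxr) (h0 _ hxr), hxa]
    rfl
  have h5 : (d / 2) ^ 2 < ‖x.1 - a‖ ^ 2 := by gcongr
  have h6 : 1 / curvatureSq (state N α k x) < 1 / (4 / d ^ 2) :=
    one_div_lt_one_div_of_lt (by positivity) (hx2 hxr)
  have h7 : 1 / (4 / d ^ 2) = (d / 2) ^ 2 := by field_simp; norm_num
  rw [h4, ← h7] at h5
  exact lt_asymm h5 h6

/-- A singular point is isolated: a punctured neighborhood of it in `M` is connected and consists
of regular points. -/
theorem IsUmbilicData.exists_punctured (hn : 2 ≤ n) (h : IsUmbilicData c M N α k)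
    (h0 : ∀ q ∈ regularPart M, curvatureSq (state N α k q) ≠ 0) {p : Hn n} (hp : p ∈ M)
    (hps : p ∉ regularPart M) :
    ∃ U, IsOpen U ∧ p ∈ U ∧ (M ∩ U) \ {p} ⊆ regularPart M ∧ IsPreconnected ((M ∩ U) \ {p}) := by
  obtain ⟨O, hO, hinj⟩ := h.isEmbedded.exists_injOn_fst hp hps
  obtain ⟨u, hu⟩ := h.isEmbedded.exists_C2 p hp
  obtain ⟨m, φ, U, hm, hφ, hφi, hU, hpU, hUO, hran⟩ :=
    (hu.of_le (m' := 1) (by norm_num)).exists_parametrization (by omega) hp hO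
  have hmem : ∀ x, φ x ∈ M ∩ U := fun x => hran ▸ Set.mem_range_self x
  have hφc := hφ.continuous
  have htend : ∀ x, Filter.Tendsto φ (𝓝 x) (𝓝[M] (φ x)) := fun x =>
    tendsto_nhdsWithin_iff.2 ⟨hφc.continuousAt, Filter.Eventually.of_forall fun y => (hmem y).1⟩
  obtain ⟨y₀, hy₀⟩ : p ∈ Set.range φ := hran ▸ ⟨hp, hpU⟩
  obtain ⟨y₁, hy₁⟩ : ∃ y, φ y ∈ regularPart M := by
    obtain ⟨x, hx, hxr⟩ := ((h.isEmbedded.frequently_mem_regularPart (by omega) hp).and_eventually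
      (mem_nhdsWithin_of_mem_nhds (hU.mem_nhds hpU))).exists
    obtain ⟨y, rfl⟩ : x ∈ Set.range φ := hran ▸ ⟨hx.1, hxr⟩
    exact ⟨y, hx⟩
  set a := center (state N α k (φ y₁)) with ha
  -- the regular points with a given center form an open set with at most one boundary point
  set A : Set (EuclideanSpace ℝ (Fin m)) :=
    {y | φ y ∈ regularPart M ∧ center (state N α k (φ y)) = a} with hA
  have hAo : IsOpen A := by
    rw [isOpen_iff_mem_nhds]
    rintro y ⟨hyr, hya⟩
    filter_upwards [(htend y).eventually (h.eventually_center_eq hn hyr (h0 _ hyr))] with x hx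
    exact ⟨hx.1, hx.2.trans hya⟩
  have hbd : ∀ y ∈ closure A, y ∉ A → φ y ∉ regularPart M ∧ (φ y).1 = a := by
    intro y hy hyA
    have hfr : ∃ᶠ x in 𝓝 y, x ∈ A := mem_closure_iff_frequently.1 hy
    have hys : φ y ∉ regularPart M := fun hyr => by
      obtain ⟨x, hx, hx'⟩ := (hfr.and_eventually
        ((htend y).eventually (h.eventually_center_eq hn hyr (h0 _ hyr)))).exists
      exact hyA ⟨hyr, hx'.2.symm.trans hx.2⟩
    refine ⟨hys, ?_⟩
    exact h.fst_eq_of_frequently h0 (hmem y).1 hys ((htend y).frequently hfr)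
  have hrank : 1 < Module.rank ℝ (EuclideanSpace ℝ (Fin m)) := by
    rw [← Module.finrank_eq_rank, finrank_euclideanSpace_fin]
    exact_mod_cast hm
  have hy₁A : y₁ ∈ A := ⟨hy₁, rfl⟩
  have hy₀A : y₀ ∉ A := fun h1 => hps (hy₀ ▸ h1.1)
  obtain ⟨y, hy, hyA⟩ : ∃ y ∈ closure A, y ∉ A := by
    by_contra! hcl
    have : (Set.univ : Set (EuclideanSpace ℝ (Fin m))) ⊆ A :=
      isPreconnected_univ.subset_of_closure_inter_subset hAo ⟨y₁, trivial, hy₁A⟩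
        fun x hx => hcl x hx.1
    exact hy₀A (this trivial)
  have huniq : ∀ y' ∈ closure A, y' ∉ A → y' = y := fun y' hy' hy'A => by
    refine hφi (hinj ⟨(hmem y').1, hUO (hmem y').2⟩ ⟨(hmem y).1, hUO (hmem y).2⟩ ?_)
    rw [(hbd y' hy' hy'A).2, (hbd y hy hyA).2]
  have hconn : IsPreconnected ({y}ᶜ : Set (EuclideanSpace ℝ (Fin m))) :=
    (isConnected_compl_singleton_of_one_lt_rank hrank y).isPreconnected
  have hsub : ({y}ᶜ : Set (EuclideanSpace ℝ (Fin m))) ⊆ A :=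
    hconn.subset_of_closure_inter_subset hAo
      ⟨y₁, fun h1 => hyA (by rw [← Set.mem_singleton_iff.1 h1]; exact hy₁A), hy₁A⟩
      fun x hx => by
        by_contra hxA
        exact hx.2 (huniq x hx.1 hxA)
  have hyy : y = y₀ := by
    by_contra hne
    exact hy₀A (hsub fun h1 => hne (Set.mem_singleton_iff.1 h1).symm)
  have himg : (M ∩ U) \ {p} = φ '' {y}ᶜ := by
    rw [← hran, ← hy₀, hyy, ← Set.image_univ, ← Set.image_singleton, ← Set.image_sdiff hφi,
      Set.compl_eq_univ_sdiff]
  refine ⟨U, hU, hpU, ?_, ?_⟩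
  · rw [himg]
    rintro _ ⟨x, hx, rfl⟩
    exact (hsub hx).1
  · rw [himg]
    exact hconn.image φ hφc.continuousOn

/-- Locally constant functions on the regular part of a connected hypersurface with `ζ ≠ 0` are
constant, since the singular points are isolated and do not separate. -/
theorem IsUmbilicData.eq_of_eventually_eq (hn : 2 ≤ n) (h : IsUmbilicData c M N α k)
    (hconn : IsPreconnected M) (h0 : ∀ q ∈ regularPart M, curvatureSq (state N α k q) ≠ 0)
    {X : Type*} {f : Hn n → X}
    (hf : ∀ p ∈ regularPart M, ∀ᶠ x in 𝓝[M] p, x ∈ regularPart M ∧ f x = f p) {p q : Hn n}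
    (hp : p ∈ regularPart M) (hq : q ∈ regularPart M) : f q = f p := by
  -- near each point of `M`, the function is constant on the regular part
  have hloc : ∀ x ∈ M, ∃ d, ∀ᶠ y in 𝓝[M] x, y ∈ regularPart M → f y = d := by
    intro x hx
    by_cases hxr : x ∈ regularPart M
    · exact ⟨f x, (hf x hxr).mono fun y hy _ => hy.2⟩
    obtain ⟨U, hU, hxU, hreg, hpre⟩ := h.exists_punctured hn h0 hx hxr
    -- for the discrete topology, locally constant functions are the continuous ones
    let : TopologicalSpace X := ⊥
    have : DiscreteTopology X := ⟨rfl⟩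
    have hcont : ContinuousOn f ((M ∩ U) \ {x}) := fun y hy => by
      have h1 : ∀ᶠ z in 𝓝[(M ∩ U) \ {x}] y, f z = f y :=
        ((hf y (hreg hy)).mono fun z hz => hz.2).filter_mono
          (nhdsWithin_mono y fun z hz => hz.1.1)
      exact (tendsto_const_nhds (x := f y)).congr' (h1.mono fun z hz => hz.symm)
    have hev : ∀ᶠ y in 𝓝[M] x, y ∈ M ∩ U :=
      Filter.inter_mem self_mem_nhdsWithin (mem_nhdsWithin_of_mem_nhds (hU.mem_nhds hxU))
    have hne : ∀ y ∈ M ∩ U, y ∈ regularPart M → y ∈ (M ∩ U) \ {x} := fun y hy hyr =>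
      ⟨hy, fun h1 => hxr (by rw [← Set.mem_singleton_iff.1 h1]; exact hyr)⟩
    obtain ⟨y₁, hy₁, hy₁U⟩ :=
      ((h.isEmbedded.frequently_mem_regularPart (by omega) hx).and_eventually hev).exists
    refine ⟨f y₁, hev.mono fun y hy hyr => ?_⟩
    exact hpre.constant hcont (hne y hy hyr) (hne y₁ hy₁U hy₁)
  have : PreconnectedSpace M := Subtype.preconnectedSpace hconn
  have hsubt : ∀ (x : M) (P : Hn n → Prop), (∀ᶠ y : M in 𝓝 x, P y) ↔ ∀ᶠ y in 𝓝[M] (x : Hn n), P y :=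
    fun x P => by
      rw [nhdsWithin_eq_map_subtype_coe x.2, Filter.eventually_map]
  -- the points of `M` near which this constant is `f p` form an open and closed set
  set D : Set M := {x | ∀ᶠ y : M in 𝓝 x, (y : Hn n) ∈ regularPart M → f y = f p} with hD
  have hDo : IsOpen D := isOpen_iff_mem_nhds.2 fun x hx => eventually_eventually_nhds.2 hx
  have hDc : IsOpen Dᶜ := by
    refine isOpen_iff_mem_nhds.2 fun x hx => ?_
    obtain ⟨d, hd⟩ := hloc x x.2
    have hd' := (hsubt x (fun y => y ∈ regularPart M → f y = d)).2 hd
    have hdp : d ≠ f p := fun h1 => hx (by rw [h1] at hd'; exact hd')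
    filter_upwards [eventually_eventually_nhds.2 hd'] with y hy hyD
    have h1 := ((hsubt y (fun y => y ∈ regularPart M → f y = d)).1 hy)
    have h2 := ((hsubt y (fun y => y ∈ regularPart M → f y = f p)).1 hyD)
    obtain ⟨z, hz, hz1, hz2⟩ := ((h.isEmbedded.frequently_mem_regularPart (by omega)
      y.2).and_eventually (h1.and h2)).exists
    exact hdp ((hz1 hz).symm.trans (hz2 hz))
  have hDu : D = Set.univ := IsClopen.eq_univ ⟨isOpen_compl_iff.1 hDc, hDo⟩
    ⟨⟨p, hp.1⟩, (hsubt ⟨p, hp.1⟩ (fun y => y ∈ regularPart M → f y = f p)).2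
      ((hf p hp).mono fun y hy _ => hy.2)⟩
  have hqD : (⟨q, hq.1⟩ : M) ∈ D := hDu ▸ Set.mem_univ _
  exact Filter.Eventually.self_of_nhds hqD hq

end data

/-! ### Closed hypersurfaces -/

section data

variable {M : Set (Hn n)} {N : Hn n → Cn n} {α k : Hn n → ℝ} {c : ℝ}

theorem IsEmbeddedHypersurface.regularPart_nonempty (hn : 1 ≤ n) (hM : IsEmbeddedHypersurface M)
    (hne : M.Nonempty) : (regularPart M).Nonempty := by
  obtain ⟨p, hp⟩ := hne
  obtain ⟨x, hx⟩ := (hM.frequently_mem_regularPart hn hp).exists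
  exact ⟨x, hx⟩

/-- On a closed connected hypersurface, `ζ` vanishes nowhere: otherwise it would vanish everywhere,
and `T` would be tangent to the hypersurface also at the maximum of `t`. -/
theorem IsUmbilicData.curvatureSq_ne_zero (hn : 2 ≤ n) (hc : 0 < c) (h : IsUmbilicData c M N α k)
    (hcomp : IsCompact M) (hconn : IsPreconnected M) {p : Hn n} (hp : p ∈ regularPart M) :
    curvatureSq (state N α k p) ≠ 0 := by
  intro hp0
  set D : Set (Hn n) := {x | x ∈ regularPart M ∧ curvatureSq (state N α k x) = 0} with hD
  have hcs : Continuous (curvatureSq (n := n)) := (contDiff_curvatureSq (m := 0)).continuous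
  -- the zeros of `ζ` form an open and closed subset of `M`
  have hloc : ∀ x ∈ M, (∀ᶠ y in 𝓝[M] x, y ∈ D) ∨ ∀ᶠ y in 𝓝[M] x, y ∉ D := by
    intro x hx
    by_cases hxr : x ∈ regularPart M
    · by_cases hx0 : curvatureSq (state N α k x) = 0
      · exact Or.inl (h.eventually_curvatureSq_eq_zero hn hc hxr hx0)
      · right
        filter_upwards [(hcs.continuousAt.comp_continuousWithinAt
          (h.continuousWithinAt_state hxr)).eventually_ne hx0] with y hy hyD
        exact hy hyD.2
    · right
      filter_upwards [h.eventually_lt_curvatureSq hx hxr 0] with y hy hyD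
      exact (hy hyD.1).ne' hyD.2
  have hsub : M ⊆ D := by
    have hpre : PreconnectedSpace M := Subtype.preconnectedSpace hconn
    have hsubt : ∀ (x : M) (P : Hn n → Prop),
        (∀ᶠ y in 𝓝[M] (x : Hn n), P y) → ∀ᶠ y : M in 𝓝 x, P y := fun x P hP => by
      rw [nhdsWithin_eq_map_subtype_coe x.2, Filter.eventually_map] at hP
      exact hP
    have hopen : IsOpen ((↑) ⁻¹' D : Set M) := isOpen_iff_mem_nhds.2 fun x hx => by
      rcases hloc x x.2 with h1 | h1
      · exact hsubt x _ h1
      · exact absurd hx (h1.self_of_nhdsWithin x.2)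
    have hclosed : IsOpen ((↑) ⁻¹' D : Set M)ᶜ := isOpen_iff_mem_nhds.2 fun x hx => by
      rcases hloc x x.2 with h1 | h1
      · exact absurd (h1.self_of_nhdsWithin x.2) hx
      · exact hsubt x _ h1
    have hu := IsClopen.eq_univ (s := ((↑) ⁻¹' D : Set M)) ⟨isOpen_compl_iff.1 hclosed, hopen⟩
      ⟨⟨p, hp.1⟩, hp, hp0⟩
    intro x hx
    have : (⟨x, hx⟩ : M) ∈ ((↑) ⁻¹' D : Set M) := hu ▸ Set.mem_univ _
    exact this
  obtain ⟨q, hqM, hq⟩ := hcomp.exists_isMaxOn ⟨p, hp.1⟩ (continuous_snd.continuousOn)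
  obtain ⟨hqr, hq0⟩ := hsub hqM
  have hα : α q = 0 := by
    have h1 : k q ^ 2 + α q ^ 2 = 0 := hq0
    nlinarith [sq_nonneg (k q), sq_nonneg (α q)]
  have htan : ((0, 1) : Hn n) ∈ tangentSpaceAt M q := by
    rw [h.mem_tangent hqr, hα]
    simp
  have h1 := h.isEmbedded.fderiv_eq_zero_of_isLocalExtrOn hqM (f := fun x : Hn n => x.2)
    differentiableAt_snd (Or.inr hq.localize) htan
  rw [fderiv_snd] at h1
  simp at h1

theorem IsUmbilicData.exists_center (hn : 2 ≤ n) (hc : 0 < c) (h : IsUmbilicData c M N α k)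
    (hcomp : IsCompact M) (hconn : IsConnected M) :
    ∃ a, ∀ q ∈ regularPart M, center (state N α k q) = a := by
  have h0 := fun q hq => h.curvatureSq_ne_zero hn hc hcomp hconn.isPreconnected (p := q) hq
  obtain ⟨p, hp⟩ := h.isEmbedded.regularPart_nonempty (by omega) hconn.nonempty
  exact ⟨_, fun q hq => h.eq_of_eventually_eq hn hconn.isPreconnected h0
    (f := fun q => center (state N α k q))
    (fun q hq => h.eventually_center_eq hn hq (h0 q hq)) hp hq⟩

theorem IsUmbilicData.exists_singular (hn : 2 ≤ n) (hc : 0 < c) (h : IsUmbilicData c M N α k)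
    (hcomp : IsCompact M) (hconn : IsConnected M) : ∃ p ∈ M, p ∉ regularPart M := by
  by_contra! hreg
  have h0 := fun q hq => h.curvatureSq_ne_zero hn hc hcomp hconn.isPreconnected (p := q) hq
  obtain ⟨a, ha⟩ := h.exists_center hn hc hcomp hconn
  have hcont : ContinuousOn
      (fun q => α q / curvatureSq (state N α k q) - c * heightFrom a q) M := by
    intro q hq
    have hst := h.continuousWithinAt_state (hreg q hq)
    have hcs : Continuous (curvatureSq (n := n)) := (contDiff_curvatureSq (m := 0)).continuous
    have hα : ContinuousWithinAt α M q :=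
      ContinuousAt.comp_continuousWithinAt (g := fun σ : StateSpace n => σ.2.2.1)
        (by fun_prop) hst
    exact (hα.div (hcs.continuousAt.comp_continuousWithinAt hst) (h0 q (hreg q hq))).sub
      (((contDiff_heightFrom a (m := 0)).continuous.continuousWithinAt).const_mul c)
  obtain ⟨p, hp, hmax⟩ := hcomp.exists_isMaxOn hconn.nonempty hcont
  exact h.not_isLocalExtrOn hn (hreg p hp) (h0 p (hreg p hp)) (ha p (hreg p hp))
    (Or.inr hmax.localize)

/-- The constant energy `(k - c / 2n) / |ζ|²ⁿ` vanishes, as it tends to zero at the singular points: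
there `|ζ|` tends to infinity, and `|k| ≤ |ζ|`. -/
theorem IsUmbilicData.eigenvalue_eq (hn : 2 ≤ n) (hc : 0 < c) (h : IsUmbilicData c M N α k)
    (hcomp : IsCompact M) (hconn : IsConnected M) {q : Hn n} (hq : q ∈ regularPart M) :
    k q = c / (2 * n) := by
  have h0 := fun q hq => h.curvatureSq_ne_zero hn hc hcomp hconn.isPreconnected (p := q) hq
  obtain ⟨p, hp, hps⟩ := h.exists_singular hn hc hcomp hconn
  have hconst := fun x hx => h.eq_of_eventually_eq hn hconn.isPreconnected h0
    (f := fun q => (k q - c / (2 * n)) / curvatureSq (state N α k q) ^ n)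
    (fun q hq => h.eventually_energy_eq hn hq (h0 q hq)) hq (q := x) hx
  set lam := c / (2 * n) with hlam
  have hl : 0 < lam := by positivity
  set E := (k q - lam) / curvatureSq (state N α k q) ^ n with hE
  have hE0 : E = 0 := by
    by_contra hne
    have hEpos : 0 < |E| := abs_pos.2 hne
    obtain ⟨x, hx, hx1⟩ := ((h.isEmbedded.frequently_mem_regularPart (by omega) hp).and_eventually
      (h.eventually_lt_curvatureSq hp hps (max 1 ((1 + lam) / |E|)))).exists
    have hx2 := hx1 hx
    have hx3 : (k x - lam) / curvatureSq (state N α k x) ^ n = E := hconst x hx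
    have hks : k x ^ 2 ≤ curvatureSq (state N α k x) := by
      have : curvatureSq (state N α k x) = k x ^ 2 + α x ^ 2 := rfl
      rw [this]
      linarith [sq_nonneg (α x)]
    set s := curvatureSq (state N α k x)
    have hs1 : 1 < s := (le_max_left _ _).trans_lt hx2
    have hs2 : (1 + lam) / |E| < s := (le_max_right _ _).trans_lt hx2
    have hspos : 0 < s := one_pos.trans hs1
    have hk : |k x| ≤ s := by
      have : |k x| ^ 2 ≤ s ^ 2 := by rw [sq_abs]; nlinarith
      exact le_of_sq_le_sq this hspos.le
    -- `|E| s ^ n = |k - lam| ≤ s + lam`, which is impossible for large `s` as `n ≥ 2`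
    have h1 : |k x - lam| = |E| * s ^ n := by
      rw [← hx3, abs_div, abs_of_pos (pow_pos hspos n)]
      field_simp
    have h2 : |k x - lam| ≤ s + lam := by
      have := abs_sub (k x) lam
      rw [abs_of_pos hl] at this
      linarith
    have h3 : s ^ 2 ≤ s ^ n := pow_le_pow_right₀ hs1.le hn
    have h4 : 1 + lam < |E| * s := by
      rw [div_lt_iff₀ hEpos] at hs2
      linarith
    have h5 : (1 + lam) * s < |E| * s ^ 2 := by nlinarith
    have h6 : |E| * s ^ 2 ≤ |E| * s ^ n := by gcongr
    nlinarith
  rcases div_eq_zero_iff.1 hE0 with h1 | h1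
  · linarith
  · exact absurd h1 (pow_ne_zero n (h0 q hq))

end data

/-! ### Pansu spheres -/

theorem pansuHeight_neg (lam β : ℝ) : pansuHeight lam (-β) = -pansuHeight lam β := by
  unfold pansuHeight
  rw [neg_div, Real.arctan_neg]
  ring

theorem strictMono_pansuHeight {lam : ℝ} (hl : 0 < lam) : StrictMono (pansuHeight lam) :=
  strictMono_of_hasDerivAt_pos (hasDerivAt_pansuHeight hl) fun β => by positivity

/-- The parametrization by `β` of the upper half of the Pansu sphere. -/
theorem pansuProfile_eq {lam β : ℝ} (hl : 0 < lam) (hβ : 0 ≤ β) :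
    pansuProfile lam (1 / √(lam ^ 2 + β ^ 2)) = pansuHeight lam β := by
  have hs : 0 < lam ^ 2 + β ^ 2 := by positivity
  have hsq := Real.sq_sqrt hs.le
  have hs0 := Real.sqrt_pos.2 hs
  have h1 : lam ^ 2 * (1 / √(lam ^ 2 + β ^ 2)) ^ 2 = lam ^ 2 / (lam ^ 2 + β ^ 2) := by
    rw [div_pow, hsq]; ring
  have h2 : 1 - lam ^ 2 / (lam ^ 2 + β ^ 2) = (β / √(lam ^ 2 + β ^ 2)) ^ 2 := by
    rw [div_pow, hsq]; field_simp; ring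
  have h3 : √(1 + (β / lam) ^ 2) = √(lam ^ 2 + β ^ 2) / lam := by
    rw [Real.sqrt_eq_iff_mul_self_eq (by positivity) (by positivity), ← sq, div_pow, div_pow, hsq]
    field_simp
  rw [pansuProfile, pansuHeight, h1, h2, Real.sqrt_sq (by positivity),
    Real.arctan_eq_arccos (by positivity), h3, inv_div, mul_one_div]
  have h4 : lam / √(lam ^ 2 + β ^ 2) * (β / √(lam ^ 2 + β ^ 2)) = lam * β / (lam ^ 2 + β ^ 2) := by
    rw [div_mul_div_comm, ← sq, hsq]
  rw [h4]
  ring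

theorem mem_pansuSphere_of_norm_eq {lam β : ℝ} (hl : 0 < lam) {z : Cn n}
    (hz : ‖z‖ = 1 / √(lam ^ 2 + β ^ 2)) : (z, pansuHeight lam β) ∈ pansuSphere n lam := by
  refine ⟨?_, ?_⟩
  · change ‖z‖ ≤ 1 / lam
    rw [hz]
    refine one_div_le_one_div_of_le hl (Real.le_sqrt_of_sq_le ?_)
    linarith [sq_nonneg β]
  · rcases le_total 0 β with hβ | hβ
    · left
      change pansuHeight lam β = pansuProfile lam ‖z‖
      rw [hz, pansuProfile_eq hl hβ]
    · right
      change pansuHeight lam β = -pansuProfile lam ‖z‖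
      have h1 := pansuProfile_eq hl (neg_nonneg.2 hβ)
      rw [neg_sq] at h1
      rw [hz, h1, pansuHeight_neg, neg_neg]

theorem exists_of_mem_pansuSphere {lam : ℝ} (hl : 0 < lam) {q : Hn n} (hq : q ∈ pansuSphere n lam)
    (hq0 : q.1 ≠ 0) : ∃ β, ‖q.1‖ = 1 / √(lam ^ 2 + β ^ 2) ∧ q.2 = pansuHeight lam β := by
  obtain ⟨h1, h2⟩ := hq
  have hr : 0 < ‖q.1‖ := norm_pos_iff.2 hq0
  set r := ‖q.1‖
  have hrl : lam ^ 2 ≤ 1 / r ^ 2 := by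
    rw [le_div_iff₀ (by positivity), ← mul_pow]
    have : lam * r ≤ 1 := by
      rw [le_div_iff₀ hl] at h1; linarith
    exact pow_le_one₀ (by positivity) this
  set β := √(1 / r ^ 2 - lam ^ 2) with hβ
  have hβ2 : lam ^ 2 + β ^ 2 = (1 / r) ^ 2 := by
    rw [hβ, Real.sq_sqrt (by linarith), one_div_pow]; ring
  have hr' : r = 1 / √(lam ^ 2 + β ^ 2) := by
    rw [hβ2, Real.sqrt_sq (by positivity), one_div_one_div]
  have hp := pansuProfile_eq hl (Real.sqrt_nonneg (1 / r ^ 2 - lam ^ 2))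
  rw [← hβ, ← hr'] at hp
  rcases h2 with h2 | h2
  · exact ⟨β, hr', by rw [h2, hp]⟩
  · exact ⟨-β, by rw [neg_sq]; exact hr', by rw [h2, hp, pansuHeight_neg]⟩

theorem continuous_pansuProfile (lam : ℝ) : Continuous (pansuProfile lam) := by
  unfold pansuProfile
  have := Real.continuous_arccos
  fun_prop

theorem isClosed_pansuSphere (lam : ℝ) : IsClosed (pansuSphere n lam) := by
  have h1 : Continuous fun q : Hn n => pansuProfile lam ‖q.1‖ :=
    (continuous_pansuProfile lam).comp (continuous_norm.comp continuous_fst)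
  exact (isClosed_le (continuous_norm.comp continuous_fst) continuous_const).inter
    ((isClosed_eq continuous_snd h1).union (isClosed_eq continuous_snd h1.neg))

/-! ### Identification of the hypersurface -/

/-- The left translation by `(a, b)`. -/
def translate (a : Cn n) (b : ℝ) (q : Hn n) : Hn n := (a + q.1, b + q.2 + ⟪Complex.I • q.1, a⟫_ℝ)

theorem isRigidMotion_translate (a : Cn n) (b : ℝ) : IsRigidMotion (translate a b) :=
  ⟨(a, b), LinearIsometryEquiv.refl ℂ _, fun q => by
    have h := congrArg Prod.snd (frame_apply (a, b) q.1)
    change _ = ⟪Complex.I • q.1, a⟫_ℝ at h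
    rw [translate, ← h]
    rfl⟩

theorem continuous_translate (a : Cn n) (b : ℝ) : Continuous (translate a b) := by
  have h : Continuous fun q : Hn n => IL q.1 := IL.continuous.comp continuous_fst
  exact (continuous_const.add continuous_fst).prodMk
    ((continuous_const.add continuous_snd).add (h.inner continuous_const))

theorem translate_sub (a : Cn n) (b : ℝ) (q : Hn n) :
    translate a b (q.1 - a, heightFrom a q - b) = q := by
  ext1
  · exact add_sub_cancel a q.1
  · simp only [translate, heightFrom, smul_sub, inner_sub_left, inner_I_self]
    ring

theorem heightFrom_translate (a : Cn n) (b : ℝ) (q : Hn n) :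
    heightFrom a (translate a b q) = b + q.2 := by
  simp only [translate, heightFrom, smul_add, inner_add_left, inner_I_self]
  ring

theorem hasDerivAt_translate (a w : Cn n) (b s : ℝ) :
    HasDerivAt (fun r : ℝ => translate a b (r • w, s)) (frame (translate a b (w, s)) w) 1 := by
  have h1 : (fun r : ℝ => translate a b (r • w, s)) =
      fun r => translate a b (0, s) + r • frame (translate a b (w, s)) w := by
    funext r
    ext1
    · simp [translate, frame_apply]
    · simp only [translate, frame_apply, Prod.snd_add, Prod.smul_snd, smul_comm Complex.I r,
        real_inner_smul_left, inner_add_right, inner_I_self, smul_zero, inner_zero_left,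
        smul_eq_mul]
      ring
  rw [h1]
  simpa using ((hasDerivAt_id (1 : ℝ)).smul_const (frame (translate a b (w, s)) w)).const_add
    (translate a b (0, s))

/-- Simple zeros of a continuous family of functions persist. -/
theorem eventually_exists_zero {X : Type*} [TopologicalSpace X] {F : X → ℝ → ℝ} {x₀ : X}
    {r₀ d ε : ℝ} (hF : ∀ᶠ y in 𝓝 (x₀, r₀), ContinuousAt (fun y : X × ℝ => F y.1 y.2) y)
    (hd : HasDerivAt (F x₀) d r₀) (hd0 : d ≠ 0) (h0 : F x₀ r₀ = 0) (hε : 0 < ε) :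
    ∀ᶠ x in 𝓝 x₀, ∃ r ∈ Set.Ioo (r₀ - ε) (r₀ + ε), F x r = 0 := by
  wlog hpos : 0 < d generalizing F d
  · have := this (F := fun x r => -F x r) (hF.mono fun y hy => hy.neg) hd.neg
      (neg_ne_zero.2 hd0) (by rw [h0, neg_zero])
      (neg_pos.2 (lt_of_le_of_ne (not_lt.1 hpos) hd0))
    simpa only [neg_eq_zero] using this
  obtain ⟨V, hV, W, hW, hVW⟩ := Filter.mem_prod_iff.1 (nhds_prod_eq (x := x₀) (y := r₀) ▸ hF)
  obtain ⟨δ, hδ, hδW⟩ := Metric.mem_nhds_iff.1 (Filter.inter_mem hW (Metric.ball_mem_nhds r₀ hε))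
  rw [Real.ball_eq_Ioo, Real.ball_eq_Ioo] at hδW
  have hsign : ∀ᶠ r in 𝓝 r₀, SignType.sign (F x₀ r) = SignType.sign (r - r₀) :=
    eventually_nhdsWithin_sign_eq_of_deriv_pos (by rwa [hd.deriv]) h0
  obtain ⟨η, hη, hηs⟩ := Metric.mem_nhds_iff.1 hsign
  rw [Real.ball_eq_Ioo] at hηs
  set τ := min δ η / 2 with hτ
  have hτ0 : 0 < τ := by positivity
  have hτδ : τ < δ := (half_lt_self (lt_min hδ hη)).trans_le (min_le_left _ _)
  have hτη : τ < η := (half_lt_self (lt_min hδ hη)).trans_le (min_le_right _ _)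
  have hcc : ∀ x ∈ V, ∀ r ∈ Set.Icc (r₀ - τ) (r₀ + τ),
      ContinuousAt (fun y : X × ℝ => F y.1 y.2) (x, r) := fun x hx r hr =>
    hVW ⟨hx, (hδW ⟨by linarith [hr.1], by linarith [hr.2]⟩).1⟩
  have hcx : ∀ r ∈ Set.Icc (r₀ - τ) (r₀ + τ), ContinuousAt (fun x => F x r) x₀ := fun r hr =>
    ContinuousAt.comp (f := fun x : X => (x, r)) (hcc x₀ (mem_of_mem_nhds hV) r hr)
      (by fun_prop)
  have h1 : F x₀ (r₀ - τ) < 0 := by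
    have h : SignType.sign (F x₀ (r₀ - τ)) = SignType.sign (r₀ - τ - r₀) :=
      hηs ⟨by linarith, by linarith⟩
    exact sign_eq_neg_one_iff.1 (h.trans (sign_neg (by linarith)))
  have h2 : 0 < F x₀ (r₀ + τ) := by
    have h : SignType.sign (F x₀ (r₀ + τ)) = SignType.sign (r₀ + τ - r₀) :=
      hηs ⟨by linarith, by linarith⟩
    exact sign_eq_one_iff.1 (h.trans (sign_pos (by linarith)))
  filter_upwards [hV, (hcx (r₀ - τ) ⟨by linarith, by linarith⟩).eventually_lt_const h1,
    (hcx (r₀ + τ) ⟨by linarith, by linarith⟩).eventually_const_lt h2] with x hxV hx1 hx2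
  have hcr : ContinuousOn (F x) (Set.Icc (r₀ - τ) (r₀ + τ)) := fun r hr =>
    (ContinuousAt.comp (f := fun r : ℝ => (x, r)) (hcc x hxV r hr)
      (by fun_prop)).continuousWithinAt
  obtain ⟨r, hr, hr0⟩ := intermediate_value_Icc (by linarith) hcr ⟨hx1.le, hx2.le⟩
  exact ⟨r, (hδW ⟨by linarith [hr.1], by linarith [hr.2]⟩).2, hr0⟩

/-- The regular points of `M` lie on the translate by `(a, b)` of the Pansu sphere, at the points
with parameter `α`; there the Euclidean dilation from `a` in `ℂⁿ` is transversal to `M`. -/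
structure HasPansuProfile (lam : ℝ) (a : Cn n) (b : ℝ) (M : Set (Hn n)) (α : Hn n → ℝ) :
    Prop where
  isEmbedded : IsEmbeddedHypersurface M
  isClosed : IsClosed M
  pos : 0 < lam
  norm_sub : ∀ q ∈ regularPart M, ‖q.1 - a‖ = 1 / √(lam ^ 2 + α q ^ 2)
  height : ∀ q ∈ regularPart M, heightFrom a q = b + pansuHeight lam (α q)
  transversal : ∀ q ∈ regularPart M, frame q (q.1 - a) ∉ tangentSpaceAt M q
  singular : ∀ p ∈ M, p ∉ regularPart M → p.1 = a

section profile

variable {lam b : ℝ} {a : Cn n} {M : Set (Hn n)} {α : Hn n → ℝ}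

theorem HasPansuProfile.eq_translate (h : HasPansuProfile lam a b M α) {q : Hn n}
    (hq : q ∈ regularPart M) : translate a b (q.1 - a, pansuHeight lam (α q)) = q := by
  have h1 := translate_sub a b q
  rwa [h.height q hq, add_sub_cancel_left] at h1

theorem HasPansuProfile.subset (h : HasPansuProfile lam a b M α) (hn : 1 ≤ n) :
    M ⊆ translate a b '' pansuSphere n lam := by
  intro p hp
  have hcont : Continuous fun q : Hn n => (q.1 - a, heightFrom a q - b) :=
    (continuous_fst.sub continuous_const).prodMk
      ((contDiff_heightFrom a (m := 0)).continuous.sub continuous_const)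
  have hcl := (isClosed_pansuSphere (n := n) lam).preimage hcont
  refine ⟨_, ?_, translate_sub a b p⟩
  have hfr : ∃ᶠ x in 𝓝 p,
      x ∈ (fun q : Hn n => (q.1 - a, heightFrom a q - b)) ⁻¹' pansuSphere n lam :=
    ((h.isEmbedded.frequently_mem_regularPart hn hp).filter_mono nhdsWithin_le_nhds).mono
      fun x hx => by
        rw [Set.mem_preimage, h.height x hx, add_sub_cancel_left]
        exact mem_pansuSphere_of_norm_eq h.pos (h.norm_sub x hx)
  exact hcl.closure_subset (mem_closure_iff_frequently.2 hfr)

/-- The image under the dilation by `r` of `ℂⁿ`, from the axis and at constant height, of the point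
with parameters `x` of the translated Pansu sphere. -/
def dilate (lam : ℝ) (a : Cn n) (b : ℝ) (x : Metric.sphere (0 : Cn n) 1 × ℝ) (r : ℝ) : Hn n :=
  translate a b (r • (1 / √(lam ^ 2 + x.2 ^ 2)) • (x.1 : Cn n), pansuHeight lam x.2)

theorem continuous_dilate (hl : 0 < lam) (a : Cn n) (b : ℝ) :
    Continuous fun y : (Metric.sphere (0 : Cn n) 1 × ℝ) × ℝ => dilate lam a b y.1 y.2 := by
  have h1 : Continuous fun y : (Metric.sphere (0 : Cn n) 1 × ℝ) × ℝ =>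
      1 / √(lam ^ 2 + y.1.2 ^ 2) := by
    refine continuous_const.div (by fun_prop) fun y => ?_
    positivity
  have h2 : Continuous (pansuHeight lam) :=
    continuous_iff_continuousAt.2 fun β => (hasDerivAt_pansuHeight hl β).continuousAt
  refine (continuous_translate a b).comp (Continuous.prodMk ?_ ?_)
  · exact continuous_snd.smul (h1.smul (by fun_prop))
  · exact h2.comp (by fun_prop)

theorem norm_dilate (hl : 0 < lam) (x : Metric.sphere (0 : Cn n) 1 × ℝ) {r : ℝ} (hr : 0 < r) :
    ‖(dilate lam a b x r).1 - a‖ = r * (1 / √(lam ^ 2 + x.2 ^ 2)) := by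
  have h1 : (0 : ℝ) ≤ 1 / √(lam ^ 2 + x.2 ^ 2) := by positivity
  simp only [dilate, translate, add_sub_cancel_left]
  rw [norm_smul, norm_smul, norm_eq_of_mem_sphere, mul_one, Real.norm_of_nonneg h1,
    Real.norm_of_nonneg hr.le]

/-- A dilate of a point of the Pansu sphere can lie in `M` only if it is the point itself. -/
theorem HasPansuProfile.eq_one_of_dilate_mem (h : HasPansuProfile lam a b M α)
    {x : Metric.sphere (0 : Cn n) 1 × ℝ} {r : ℝ} (hr : 0 < r) (hx : dilate lam a b x r ∈ M) :
    dilate lam a b x r ∈ regularPart M ∧ r = 1 := by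
  have hl := h.pos
  have h1 : 0 < 1 / √(lam ^ 2 + x.2 ^ 2) := by positivity
  have h2 := norm_dilate (a := a) (b := b) hl x hr
  have hreg : dilate lam a b x r ∈ regularPart M := by
    by_contra hns
    rw [h.singular _ hx hns, sub_self, norm_zero] at h2
    exact (mul_pos hr h1).ne h2
  refine ⟨hreg, ?_⟩
  have h3 : pansuHeight lam (α (dilate lam a b x r)) = pansuHeight lam x.2 := by
    have h4 := h.height _ hreg
    have h5 := heightFrom_translate a b
      (r • (1 / √(lam ^ 2 + x.2 ^ 2)) • (x.1 : Cn n), pansuHeight lam x.2)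
    change heightFrom a (dilate lam a b x r) = _ at h5
    rw [h4] at h5
    exact add_left_cancel h5
  rw [h.norm_sub _ hreg, (strictMono_pansuHeight hl).injective h3] at h2
  exact (mul_eq_right₀ h1.ne').1 h2.symm

/-- `M` contains all the points of the translated Pansu sphere off its axis: the set of the
parameters of the points in `M` is closed, and it is open by transversality. -/
theorem HasPansuProfile.dilate_mem (h : HasPansuProfile lam a b M α) (hn : 1 ≤ n)
    (hne : (regularPart M).Nonempty) (x : Metric.sphere (0 : Cn n) 1 × ℝ) :
    dilate lam a b x 1 ∈ M := by
  have hl := h.pos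
  have hcont := continuous_dilate hl a b
  set D : Set (Metric.sphere (0 : Cn n) 1 × ℝ) := {x | dilate lam a b x 1 ∈ M} with hD
  have hclosed : IsClosed D :=
    h.isClosed.preimage (hcont.comp (continuous_id.prodMk continuous_const))
  have hopen : IsOpen D := by
    refine isOpen_iff_mem_nhds.2 fun x hx => ?_
    obtain ⟨hreg, -⟩ := h.eq_one_of_dilate_mem one_pos hx
    obtain ⟨u, hu⟩ := h.isEmbedded.exists_C2 _ hx
    have htan := h.transversal _ hreg
    rw [tangentSpaceAt_eq (hu.of_le (by norm_num)) hx] at htan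
    obtain ⟨U, hU, hxU, hsm, -, hMU⟩ := hu
    have hmem : ∀ q ∈ U, q ∈ M ↔ u q = 0 := fun q hq =>
      ⟨fun hqM => ((Set.ext_iff.1 hMU q).1 ⟨hqM, hq⟩).2,
        fun hq0 => ((Set.ext_iff.1 hMU q).2 ⟨hq, hq0⟩).1⟩
    have hUx : ∀ᶠ y in 𝓝 (x, (1 : ℝ)), dilate lam a b y.1 y.2 ∈ U :=
      hcont.continuousAt.eventually_mem (hU.mem_nhds hxU)
    have hF : ∀ᶠ y in 𝓝 (x, (1 : ℝ)),
        ContinuousAt (fun y : (Metric.sphere (0 : Cn n) 1 × ℝ) × ℝ =>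
          u (dilate lam a b y.1 y.2)) y := hUx.mono fun y hy =>
      ContinuousAt.comp (f := fun y : (Metric.sphere (0 : Cn n) 1 × ℝ) × ℝ =>
        dilate lam a b y.1 y.2) (hsm.continuousOn.continuousAt (hU.mem_nhds hy))
        hcont.continuousAt
    have hder : HasDerivAt (fun r => u (dilate lam a b x r))
        (fderiv ℝ u (dilate lam a b x 1)
          (frame (dilate lam a b x 1) ((dilate lam a b x 1).1 - a))) 1 := by
      have hd := hasDerivAt_translate a ((1 / √(lam ^ 2 + x.2 ^ 2)) • (x.1 : Cn n)) b
        (pansuHeight lam x.2)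
      have h1 : translate a b ((1 / √(lam ^ 2 + x.2 ^ 2)) • (x.1 : Cn n), pansuHeight lam x.2) =
          dilate lam a b x 1 := by rw [dilate, one_smul]
      have h2 : (1 / √(lam ^ 2 + x.2 ^ 2)) • (x.1 : Cn n) = (dilate lam a b x 1).1 - a := by
        rw [← h1, translate, add_sub_cancel_left]
      rw [h1] at hd
      rw [← h2]
      exact (((hsm.contDiffAt (hU.mem_nhds hxU)).differentiableAt
        (by norm_num)).hasFDerivAt).comp_hasDerivAt (1 : ℝ) hd
    obtain ⟨V, hV, W, hW, hVW⟩ := Filter.mem_prod_iff.1 (nhds_prod_eq (x := x) (y := (1 : ℝ)) ▸ hUx)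
    obtain ⟨δ, hδ, hδW⟩ := Metric.mem_nhds_iff.1
      (Filter.inter_mem hW (lt_mem_nhds (one_pos (α := ℝ))))
    rw [Real.ball_eq_Ioo] at hδW
    filter_upwards [hV, eventually_exists_zero
      (F := fun (x : Metric.sphere (0 : Cn n) 1 × ℝ) r => u (dilate lam a b x r)) hF hder htan
      ((hmem _ hxU).1 hx) hδ] with x' hx'V ⟨r, hr, hr0⟩
    have hrU : dilate lam a b x' r ∈ U := hVW (Set.mk_mem_prod hx'V (hδW hr).1)
    have hrM := (hmem _ hrU).2 hr0
    obtain ⟨-, hr1⟩ := h.eq_one_of_dilate_mem (hδW hr).2 hrM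
    rwa [hr1] at hrM
  have hrank : 1 < Module.rank ℝ (Cn n) := by
    rw [← Module.finrank_eq_rank, ← Module.finrank_mul_finrank ℝ ℂ (Cn n),
      Complex.finrank_real_complex, finrank_euclideanSpace_fin]
    exact_mod_cast (by omega : 1 < 2 * n)
  have : PreconnectedSpace (Metric.sphere (0 : Cn n) 1) :=
    Subtype.preconnectedSpace (isPreconnected_sphere hrank 0 1)
  have hDne : D.Nonempty := by
    obtain ⟨q, hq⟩ := hne
    have h1 : 0 < √(lam ^ 2 + α q ^ 2) := by positivity
    refine ⟨(⟨√(lam ^ 2 + α q ^ 2) • (q.1 - a), ?_⟩, α q), ?_⟩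
    · rw [mem_sphere_zero_iff_norm, norm_smul, h.norm_sub q hq, Real.norm_of_nonneg h1.le,
        mul_one_div_cancel h1.ne']
    · change dilate lam a b _ 1 ∈ M
      rw [dilate, one_smul, smul_smul, one_div_mul_cancel h1.ne', one_smul, h.eq_translate hq]
      exact hq.1
  have hu : D = Set.univ := IsClopen.eq_univ ⟨hclosed, hopen⟩ hDne
  exact hu.superset (Set.mem_univ x)

theorem HasPansuProfile.image_subset (h : HasPansuProfile lam a b M α) (hn : 1 ≤ n)
    (hne : (regularPart M).Nonempty) : translate a b '' pansuSphere n lam ⊆ M := by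
  have hl := h.pos
  have hoff : ∀ q ∈ pansuSphere n lam, q.1 ≠ 0 → translate a b q ∈ M := by
    intro q hq hq0
    obtain ⟨β, h1, h2⟩ := exists_of_mem_pansuSphere hl hq hq0
    have h3 : 0 < √(lam ^ 2 + β ^ 2) := by positivity
    have h4 := h.dilate_mem hn hne (⟨√(lam ^ 2 + β ^ 2) • q.1, by
      rw [mem_sphere_zero_iff_norm, norm_smul, h1, Real.norm_of_nonneg h3.le,
        mul_one_div_cancel h3.ne']⟩, β)
    rwa [dilate, one_smul, smul_smul, one_div_mul_cancel h3.ne', one_smul, ← h2] at h4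
  rintro _ ⟨q, hq, rfl⟩
  by_cases hq0 : q.1 = 0
  swap
  · exact hoff q hq hq0
  -- the poles are limits of points off the axis
  obtain ⟨σ, hσ⟩ : ∃ σ : ℝ, (σ = 1 ∨ σ = -1) ∧ q = (0, σ * pansuProfile lam 0) := by
    obtain ⟨-, h2 | h2⟩ := hq <;> rw [hq0, norm_zero] at h2
    · exact ⟨1, Or.inl rfl, Prod.ext hq0 (by rw [h2, one_mul])⟩
    · exact ⟨-1, Or.inr rfl, Prod.ext hq0 (by rw [h2, neg_one_mul])⟩
  obtain ⟨hσ1, hqσ⟩ := hσ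
  have : Nonempty (Fin n) := ⟨⟨0, hn⟩⟩
  obtain ⟨w, hw⟩ := exists_norm_eq (Cn n) zero_le_one
  set f : ℝ → Hn n := fun r => translate a b (r • w, σ * pansuProfile lam r) with hf
  have hfc : Continuous f := (continuous_translate a b).comp
    ((continuous_id.smul continuous_const).prodMk
      (continuous_const.mul (continuous_pansuProfile lam)))
  have hf0 : f 0 = translate a b q := by
    rw [hf, hqσ]
    simp only [zero_smul]
  rw [← hf0]
  refine h.isClosed.mem_of_tendsto (hfc.continuousWithinAt (s := Set.Ioi 0)) ?_
  filter_upwards [self_mem_nhdsWithin, mem_nhdsWithin_of_mem_nhds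
    (ge_mem_nhds (one_div_pos.2 hl))] with r hr0 hr1
  have hr : ‖r • w‖ = r := by
    rw [norm_smul, hw, mul_one, Real.norm_of_nonneg (le_of_lt hr0)]
  refine hoff _ ⟨?_, ?_⟩ ?_
  · change ‖r • w‖ ≤ 1 / lam
    rw [hr]; exact hr1
  · change σ * pansuProfile lam r = pansuProfile lam ‖r • w‖ ∨
      σ * pansuProfile lam r = -pansuProfile lam ‖r • w‖
    rw [hr]
    rcases hσ1 with rfl | rfl
    · left; rw [one_mul]
    · right; rw [neg_one_mul]
  · change r • w ≠ 0
    rw [← norm_pos_iff, hr]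
    exact hr0

end profile

theorem IsUmbilicData.exists_hasPansuProfile {M : Set (Hn n)} {N : Hn n → Cn n} {α k : Hn n → ℝ}
    {c : ℝ} (hn : 2 ≤ n) (hc : 0 < c) (h : IsUmbilicData c M N α k) (hcomp : IsCompact M)
    (hconn : IsConnected M) : ∃ a b, HasPansuProfile (c / (2 * n)) a b M α := by
  have h0 := fun q hq => h.curvatureSq_ne_zero hn hc hcomp hconn.isPreconnected (p := q) hq
  have hk := fun q hq => h.eigenvalue_eq hn hc hcomp hconn (q := q) hq
  obtain ⟨a, ha⟩ := h.exists_center hn hc hcomp hconn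
  obtain ⟨p, hp⟩ := h.isEmbedded.regularPart_nonempty (by omega) hconn.nonempty
  have hn0 : (0 : ℝ) < n := by positivity
  have hl : 0 < c / (2 * n) := by positivity
  have hs : ∀ q ∈ regularPart M,
      curvatureSq (state N α k q) = (c / (2 * n)) ^ 2 + α q ^ 2 := fun q hq => by
    rw [← hk q hq]; rfl
  refine ⟨a, heightFrom a p - pansuHeight (c / (2 * n)) (α p), h.isEmbedded, hcomp.isClosed, hl,
    fun q hq => ?_, fun q hq => ?_, fun q hq hmem => ?_, fun q hq hqs => ?_⟩
  · have h1 := norm_sub_center_sq (σ := state N α k q) (h.norm hq) (h0 q hq)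
    rw [ha q hq, hs q hq] at h1
    rw [← Real.sqrt_one, ← Real.sqrt_div zero_le_one, ← h1, Real.sqrt_sq (norm_nonneg _)]
    rfl
  · have h1 := h.eq_of_eventually_eq hn hconn.isPreconnected h0
      (f := fun x => heightFrom a x - pansuHeight (c / (2 * n)) (α x))
      (fun x hx => h.eventually_height_eq hn hc hk ha hx) hp hq
    change heightFrom a q - pansuHeight (c / (2 * n)) (α q) = _ at h1
    linarith
  · rw [h.mem_tangent hq, contactForm_frame, mul_zero, frame_fst] at hmem
    have h1 := inner_center_sub (σ := state N α k q) (h.norm hq) (ha q hq)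
    change ⟪N q, q.1 - a⟫_ℝ = -(k q / curvatureSq (state N α k q)) at h1
    rw [hmem, hk q hq] at h1
    exact div_ne_zero hl.ne' (h0 q hq) (neg_eq_zero.1 h1.symm)
  · exact h.fst_eq_of_frequently h0 hq hqs
      ((h.isEmbedded.frequently_mem_regularPart (by omega) hq).mono fun x hx => ⟨hx, ha x hx⟩)

end Heisenberg

end

theorem mainTheorem4 (n : ℕ) (hn : 2 ≤ n) (c : ℝ) (hc : 0 < c)
    (M : Set (Heisenberg.Hn n))
    (hM : Heisenberg.IsEmbeddedHypersurface M) (hcompact : IsCompact M) (hconn : IsConnected M)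
    (e : Heisenberg.Hn n → Heisenberg.Cn n) (he : Heisenberg.IsCharacteristicField M e)
    (humb : Heisenberg.IsUmbilic M e)
    (hH : ∀ p ∈ Heisenberg.regularPart M, Heisenberg.HasPMeanCurvatureAt M e p c) :
    ∃ Φ : Heisenberg.Hn n → Heisenberg.Hn n, Heisenberg.IsRigidMotion Φ ∧
      M = Φ '' Heisenberg.pansuSphere n (c / (2 * n)) := by
  obtain ⟨N, α, k, h⟩ := humb.exists_isUmbilicData hn hM he hH
  obtain ⟨a, b, hab⟩ := h.exists_hasPansuProfile hn hc hcompact hconn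
  have hne := hM.regularPart_nonempty (by omega) hconn.nonempty
  exact ⟨Heisenberg.translate a b, Heisenberg.isRigidMotion_translate a b,
    (hab.subset (by omega)).antisymm (hab.image_subset (by omega) hne)⟩
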